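/- Let $n\ge 3$, let $\int$ denote integration over the unit sphere $\mathbb S^{n-1}\subset\mathbb R^n$ with respect to surface measure normalized to total mass one, let $\nabla_T$ be the (weak) tangential gradient, and for $w\in W^{1,2}(\mathbb S^{n-1};\mathbb R^n)$ let $\mathrm{div}\,w=\sum_j\langle\nabla_Tw^j,e_j\rangle$ be the tangential divergence and $A(w)(x)=(\mathrm{div}\,w)\,x-\sum_{j=1}^n x_j\nabla_Tw^j$. The space $W^{1,2}$ carries the inner product $\int\langle v,w\rangle+\int\langle\nabla_Tv,\nabla_Tw\rangle$. Put $$H_n=\Big\{w\in W^{1,2}(\mathbb S^{n-1};\mathbb R^n):\ \int w=0,\ \int\langle w,x\rangle=0\Big\},$$ $$Q_n(w)=\frac{n}{2(n-1)}\int\Big(|\nabla_Tw|^2+\frac{n-3}{n-1}(\mathrm{div}\,w)^2\Big)-\frac n2\int\langle w,A(w)\rangle .$$ For $k\ge1$ let $H_{n,k}\subset H_n$ be the subspace of maps all of whose components are spherical harmonics of order $k$ (restrictions of homogeneous harmonic polynomials of degree $k$), let $H_{n,k,\mathrm{sol}}\subset H_{n,k}$ be the subspace of those whose componentwise harmonic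 extension to the unit ball is divergence free, let $H_{n,k,2}$ be the eigenspace $\{w\in H_{n,k,\mathrm{sol}}: A(w)=w\}$, let $H_{n,k,3}$ be the $W^{1,2}$-orthogonal complement of $H_{n,k,\mathrm{sol}}$ in $H_{n,k}$, and let $H_{n,0}=H_{n,1,2}+H_{n,2,3}$. Then: (a) the sum $H_{n,0}=H_{n,1,2}\oplus H_{n,2,3}$ is direct and $W^{1,2}$-orthogonal; (b) $H_{n,0}$ is the kernel of $Q_n$ in $H_n$: it consists of the $w\in H_n$ with $Q_n(v,w)=0$ for all $v\in H_n$ (where $Q_n(\cdot,\cdot)$ is the associated symmetric bilinear form), and equally of the $w\in H_n$ with $Q_n(w)=0$; (c) the map $Y\mapsto Y-\int Y$ is a linear isomorphism onto $H_{n,0}$ from the Lie algebra of infinitesimal Möbius transformations of $\mathbb S^{n-1}$, i.e. from the tangent space at the identity (all velocities at time 0 of curves through the identity) of the conformal group $\{O\phi_{\xi,\lambda}: O\in O(n),\ \xi\in\mathbb S^{n-1},\ \lambda>0\}$, where $$\phi_{\xi,\lambda}(x)=\frac{-\lambda^2(1-\langle x,\xi\rangle)\xi+2\lambda(x-\langle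 x,\xi\rangle\xi)+(1+\langle x,\xi\rangle)\xi}{\lambda^2(1-\langle x,\xi\rangle)+(1+\langle x,\xi\rangle)};$$ (d) there is a constant $C_n>0$, depending only on $n$, such that for every $w\in H_n$ $$Q_n(w)\ \ge\ C_n\int\big|\nabla_Tw-\nabla_T(\Pi_{n,0}w)\big|^2 ,$$ where $\Pi_{n,0}$ is the $W^{1,2}$-orthogonal projection onto $H_{n,0}$. -/

import Mathlib

open MeasureTheory Metric
open scoped ContDiff InnerProductSpace RealInnerProductSpace

noncomputable section

/-! ### The round sphere and its normalized surface measure -/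

/-- Euclidean space `ℝⁿ`. -/
abbrev Euc (n : ℕ) : Type := EuclideanSpace ℝ (Fin n)

/-- The unit sphere `𝕊ⁿ⁻¹ ⊂ ℝⁿ`. -/
abbrev Sph (n : ℕ) : Type := sphere (0 : Euc n) 1

/-- Values of tangential gradients of maps `w : 𝕊ⁿ⁻¹ → ℝⁿ`: the `j`-th entry is the vector
`∇_T wʲ ∈ ℝⁿ`. The norm is the Frobenius norm, `|∇_T w|² = ∑ j, |∇_T wʲ|²`. -/
abbrev Grad (n : ℕ) : Type := PiLp 2 (fun _ : Fin n => Euc n)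

/-- The surface measure on the unit sphere, normalized to total mass one, so that integrals
with respect to it are the averages over the sphere. -/
def sphereMeasure (n : ℕ) : Measure (Sph n) :=
  ((volume : Measure (Euc n)).toSphere Set.univ)⁻¹ • (volume : Measure (Euc n)).toSphere

instance (n : ℕ) : IsFiniteMeasure (sphereMeasure n) := by
  constructor
  simp only [sphereMeasure, Measure.smul_apply, smul_eq_mul]
  exact lt_of_le_of_lt (ENNReal.inv_mul_le_one _) ENNReal.one_lt_top

/-! ### The Sobolev space `W^{1,2}(𝕊ⁿ⁻¹; ℝⁿ)` -/

/-- The tangential divergence at `x ∈ 𝕊ⁿ⁻¹` of a smooth field `X` given in the ambient space: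
the trace of `DX(x)` over the tangent space `x^⊥`. -/
def tangDiv {n : ℕ} (X : Euc n → Euc n) (x : Euc n) : ℝ :=
  (∑ i, (fderiv ℝ X x (EuclideanSpace.single i 1)) i) - ⟪fderiv ℝ X x x, x⟫

/-- Smooth tangential vector fields on the sphere (given by a smooth extension to `ℝⁿ`). -/
def IsTangentTestField {n : ℕ} (X : Euc n → Euc n) : Prop :=
  ContDiff ℝ ∞ X ∧ ∀ x : Sph n, ⟪X x, (x : Euc n)⟫ = 0

/-- `g` is the weak tangential gradient of the scalar function `u` on the sphere:
`g` is tangential and `∫ u div X = - ∫ ⟨g, X⟩` for every smooth tangential field `X`. -/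
def IsWeakTangGrad {n : ℕ} (u : Sph n → ℝ) (g : Sph n → Euc n) : Prop :=
  (∀ᵐ x ∂sphereMeasure n, ⟪g x, (x : Euc n)⟫ = 0) ∧
  ∀ X : Euc n → Euc n, IsTangentTestField X →
    ∫ x : Sph n, u x * tangDiv X x ∂sphereMeasure n
      = - ∫ x : Sph n, ⟪g x, X x⟫ ∂sphereMeasure n

/-- The Hilbert space `L²(𝕊ⁿ⁻¹; ℝⁿ) × L²(𝕊ⁿ⁻¹; ℝⁿˣⁿ)`. -/
abbrev L2Pair (n : ℕ) : Type :=
  WithLp 2 (Lp (Euc n) 2 (sphereMeasure n) × Lp (Grad n) 2 (sphereMeasure n))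

lemma memLp_sphere_of_continuous {n : ℕ} {F : Type*} [NormedAddCommGroup F]
    [SecondCountableTopology F] {f : Sph n → F} (hf : Continuous f) :
    MemLp f 2 (sphereMeasure n) := by
  obtain ⟨C, hC⟩ := isCompact_univ.exists_bound_of_continuousOn hf.continuousOn
  borelize F
  exact MemLp.of_bound hf.aestronglyMeasurable C (.of_forall fun x => hC x (Set.mem_univ x))

lemma continuous_tangDiv {n : ℕ} {X : Euc n → Euc n} (hX : ContDiff ℝ ∞ X) :
    Continuous (fun x : Sph n => tangDiv X (x : Euc n)) := by
  have h : Continuous (fderiv ℝ X) := hX.continuous_fderiv (by simp)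
  have h' : Continuous (fun x : Sph n => fderiv ℝ X (x : Euc n)) :=
    h.comp continuous_subtype_val
  have hc : ∀ v : Sph n → Euc n, Continuous v →
      Continuous (fun x : Sph n => fderiv ℝ X (x : Euc n) (v x)) :=
    fun v hv => h'.clm_apply hv
  unfold tangDiv
  refine Continuous.sub (continuous_finsetSum _ fun i _ => ?_) ?_
  · exact (EuclideanSpace.proj (𝕜 := ℝ) i).continuous.comp (hc _ continuous_const)
  · exact (hc _ continuous_subtype_val).inner continuous_subtype_val

lemma memLp_coord {n : ℕ} (u : Lp (Euc n) 2 (sphereMeasure n)) (j : Fin n) :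
    MemLp (fun x => u x j) 2 (sphereMeasure n) :=
  (EuclideanSpace.proj (𝕜 := ℝ) j).comp_memLp' (Lp.memLp u)

lemma memLp_row {n : ℕ} (g : Lp (Grad n) 2 (sphereMeasure n)) (j : Fin n) :
    MemLp (fun x => g x j) 2 (sphereMeasure n) :=
  (PiLp.proj (𝕜 := ℝ) 2 (fun _ : Fin n => Euc n) j).comp_memLp' (Lp.memLp g)

lemma integrable_coord_tangDiv {n : ℕ} (u : Lp (Euc n) 2 (sphereMeasure n)) (j : Fin n)
    {X : Euc n → Euc n} (hX : ContDiff ℝ ∞ X) :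
    Integrable (fun x : Sph n => u x j * tangDiv X (x : Euc n)) (sphereMeasure n) :=
  (memLp_coord u j).integrable_mul (memLp_sphere_of_continuous (continuous_tangDiv hX))

lemma integrable_inner_of_memLp {n : ℕ} {f g : Sph n → Euc n}
    (hf : MemLp f 2 (sphereMeasure n)) (hg : MemLp g 2 (sphereMeasure n)) :
    Integrable (fun x => ⟪f x, g x⟫) (sphereMeasure n) := by
  refine (L2.integrable_inner (𝕜 := ℝ) hf.toLp hg.toLp).congr ?_
  filter_upwards [hf.coeFn_toLp, hg.coeFn_toLp] with x h1 h2
  rw [h1, h2]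

lemma integrable_row_inner {n : ℕ} (g : Lp (Grad n) 2 (sphereMeasure n)) (j : Fin n)
    {X : Euc n → Euc n} (hX : ContDiff ℝ ∞ X) :
    Integrable (fun x : Sph n => ⟪g x j, X (x : Euc n)⟫) (sphereMeasure n) :=
  integrable_inner_of_memLp (memLp_row g j)
    (memLp_sphere_of_continuous (hX.continuous.comp continuous_subtype_val))

/-- The Sobolev space `W^{1,2}(𝕊ⁿ⁻¹; ℝⁿ)`, realized as the space of pairs `(w, ∇_T w)` of an
`L²` map and its weak tangential gradient in `L²`. Its inner product is
`∫ ⟨v, w⟩ + ∫ ⟨∇_T v, ∇_T w⟩`. -/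
def sobolevW12 (n : ℕ) : Submodule ℝ (L2Pair n) where
  carrier := {p | ∀ j : Fin n, IsWeakTangGrad (fun x => p.fst x j) (fun x => p.snd x j)}
  zero_mem' := by
    intro j
    have h1 : ∀ᵐ x ∂sphereMeasure n, (0 : L2Pair n).fst x = 0 :=
      Lp.coeFn_zero (Euc n) 2 (sphereMeasure n)
    have h2 : ∀ᵐ x ∂sphereMeasure n, (0 : L2Pair n).snd x = 0 :=
      Lp.coeFn_zero (Grad n) 2 (sphereMeasure n)
    refine ⟨?_, fun X hX => ?_⟩
    · filter_upwards [h2] with x hx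
      rw [hx]
      simp
    · rw [integral_eq_zero_of_ae, integral_eq_zero_of_ae, neg_zero]
      · filter_upwards [h2] with x hx
        rw [hx]
        simp
      · filter_upwards [h1] with x hx
        rw [hx]
        simp
  add_mem' := by
    intro p q hp hq j
    have h1 : ∀ᵐ x ∂sphereMeasure n, (p + q).fst x = p.fst x + q.fst x :=
      Lp.coeFn_add p.fst q.fst
    have h2 : ∀ᵐ x ∂sphereMeasure n, (p + q).snd x = p.snd x + q.snd x :=
      Lp.coeFn_add p.snd q.snd
    refine ⟨?_, fun X hX => ?_⟩
    · filter_upwards [h2, (hp j).1, (hq j).1] with x hx h3 h4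
      rw [hx, PiLp.add_apply, inner_add_left, h3, h4, add_zero]
    · have e1 : ∫ x : Sph n, (p + q).fst x j * tangDiv X x ∂sphereMeasure n
          = ∫ x : Sph n, (p.fst x j * tangDiv X x + q.fst x j * tangDiv X x)
              ∂sphereMeasure n := by
        refine integral_congr_ae ?_
        filter_upwards [h1] with x hx
        rw [hx, PiLp.add_apply, add_mul]
      have e2 : ∫ x : Sph n, ⟪(p + q).snd x j, X x⟫ ∂sphereMeasure n
          = ∫ x : Sph n, (⟪p.snd x j, X x⟫ + ⟪q.snd x j, X x⟫) ∂sphereMeasure n := by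
        refine integral_congr_ae ?_
        filter_upwards [h2] with x hx
        rw [hx, PiLp.add_apply, inner_add_left]
      rw [e1, e2, integral_add (integrable_coord_tangDiv _ j hX.1)
        (integrable_coord_tangDiv _ j hX.1), integral_add (integrable_row_inner _ j hX.1)
        (integrable_row_inner _ j hX.1), (hp j).2 X hX, (hq j).2 X hX]
      ring
  smul_mem' := by
    intro c p hp j
    have h1 : ∀ᵐ x ∂sphereMeasure n, (c • p).fst x = c • p.fst x :=
      Lp.coeFn_smul c p.fst
    have h2 : ∀ᵐ x ∂sphereMeasure n, (c • p).snd x = c • p.snd x :=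
      Lp.coeFn_smul c p.snd
    refine ⟨?_, fun X hX => ?_⟩
    · filter_upwards [h2, (hp j).1] with x hx h3
      rw [hx, PiLp.smul_apply, real_inner_smul_left, h3, mul_zero]
    · have e1 : ∫ x : Sph n, (c • p).fst x j * tangDiv X x ∂sphereMeasure n
          = ∫ x : Sph n, c * (p.fst x j * tangDiv X x) ∂sphereMeasure n := by
        refine integral_congr_ae ?_
        filter_upwards [h1] with x hx
        rw [hx, PiLp.smul_apply, smul_eq_mul, mul_assoc]
      have e2 : ∫ x : Sph n, ⟪(c • p).snd x j, X x⟫ ∂sphereMeasure n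
          = ∫ x : Sph n, c * ⟪p.snd x j, X x⟫ ∂sphereMeasure n := by
        refine integral_congr_ae ?_
        filter_upwards [h2] with x hx
        rw [hx, PiLp.smul_apply, real_inner_smul_left]
      rw [e1, e2, integral_const_mul, integral_const_mul, (hp j).2 X hX]
      ring

/-- The Hilbert space `W^{1,2}(𝕊ⁿ⁻¹; ℝⁿ)`. -/
abbrev W12 (n : ℕ) : Type := sobolevW12 n

instance (n : ℕ) : InnerProductSpace ℝ (W12 n) := Submodule.innerProductSpace _

namespace W12

variable {n : ℕ}

/-- The underlying map `w : 𝕊ⁿ⁻¹ → ℝⁿ` (a representative). -/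
def fn (w : W12 n) : Sph n → Euc n := fun x => (w : L2Pair n).fst x

/-- The tangential gradient `∇_T w`; its `j`-th entry is `∇_T wʲ`. -/
def grad (w : W12 n) : Sph n → Grad n := fun x => (w : L2Pair n).snd x

/-- The tangential divergence `div w = ∑ j, ⟨∇_T wʲ, e_j⟩`. -/
def div (w : W12 n) (x : Sph n) : ℝ := ∑ j, w.grad x j j

/-- The first order operator `A(w) = (div w) x - ∑ j, x_j ∇_T wʲ`. -/
def opA (w : W12 n) (x : Sph n) : Euc n :=
  w.div x • (x : Euc n) - ∑ j, (x : Euc n) j • w.grad x j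

lemma fn_zero : (0 : W12 n).fn =ᵐ[sphereMeasure n] 0 := Lp.coeFn_zero _ _ _

lemma grad_zero : (0 : W12 n).grad =ᵐ[sphereMeasure n] 0 := Lp.coeFn_zero _ _ _

lemma fn_add (v w : W12 n) : (v + w).fn =ᵐ[sphereMeasure n] v.fn + w.fn :=
  Lp.coeFn_add _ _

lemma grad_add (v w : W12 n) : (v + w).grad =ᵐ[sphereMeasure n] v.grad + w.grad :=
  Lp.coeFn_add _ _

lemma fn_smul (c : ℝ) (w : W12 n) : (c • w).fn =ᵐ[sphereMeasure n] c • w.fn :=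
  Lp.coeFn_smul _ _

lemma grad_smul (c : ℝ) (w : W12 n) : (c • w).grad =ᵐ[sphereMeasure n] c • w.grad :=
  Lp.coeFn_smul _ _

lemma memLp_fn (w : W12 n) : MemLp w.fn 2 (sphereMeasure n) := Lp.memLp _

lemma integrable_fn (w : W12 n) : Integrable w.fn (sphereMeasure n) :=
  (memLp_fn w).integrable one_le_two

lemma integrable_fn_inner (w : W12 n) :
    Integrable (fun x : Sph n => ⟪w.fn x, (x : Euc n)⟫) (sphereMeasure n) :=
  integrable_inner_of_memLp (memLp_fn w) (memLp_sphere_of_continuous continuous_subtype_val)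

end W12

/-- The quadratic form
`Q_n(w) = n/(2(n-1)) ⨍ (|∇_T w|² + (n-3)/(n-1) (div w)²) - n/2 ⨍ ⟨w, (div w) x - ∑ x_j ∇_T wʲ⟩`. -/
def quadQ (n : ℕ) (w : W12 n) : ℝ :=
  (n : ℝ) / (2 * ((n : ℝ) - 1)) *
      ∫ x, (‖w.grad x‖ ^ 2 + ((n : ℝ) - 3) / ((n : ℝ) - 1) * w.div x ^ 2) ∂sphereMeasure n
    - (n : ℝ) / 2 * ∫ x, ⟪w.fn x, w.opA x⟫ ∂sphereMeasure n

/-! ### The space `H_n` and its subspaces -/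

/-- `H_n`: the maps `w ∈ W^{1,2}(𝕊ⁿ⁻¹; ℝⁿ)` with `⨍ w = 0` and `⨍ ⟨w, x⟩ = 0`. -/
def spaceH (n : ℕ) : Submodule ℝ (W12 n) where
  carrier := {w | ∫ x, w.fn x ∂sphereMeasure n = 0 ∧
    ∫ x : Sph n, ⟪w.fn x, (x : Euc n)⟫ ∂sphereMeasure n = 0}
  zero_mem' := by
    constructor
    · exact integral_eq_zero_of_ae W12.fn_zero
    · refine integral_eq_zero_of_ae ?_
      filter_upwards [W12.fn_zero (n := n)] with x hx
      simp [hx]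
  add_mem' := by
    rintro v w ⟨hv, hv'⟩ ⟨hw, hw'⟩
    constructor
    · rw [integral_congr_ae (W12.fn_add v w)]
      simp only [Pi.add_apply]
      rw [integral_add v.integrable_fn w.integrable_fn, hv, hw, add_zero]
    · have : (fun x : Sph n => ⟪(v + w).fn x, (x : Euc n)⟫) =ᵐ[sphereMeasure n]
          fun x : Sph n => ⟪v.fn x, (x : Euc n)⟫ + ⟪w.fn x, (x : Euc n)⟫ := by
        filter_upwards [W12.fn_add v w] with x hx
        simp [hx, inner_add_left]
      rw [integral_congr_ae this, integral_add v.integrable_fn_inner w.integrable_fn_inner,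
        hv', hw', add_zero]
  smul_mem' := by
    rintro c w ⟨hw, hw'⟩
    constructor
    · rw [integral_congr_ae (W12.fn_smul c w)]
      simp only [Pi.smul_apply]
      rw [integral_smul, hw, smul_zero]
    · have : (fun x : Sph n => ⟪(c • w).fn x, (x : Euc n)⟫) =ᵐ[sphereMeasure n]
          fun x : Sph n => c * ⟪w.fn x, (x : Euc n)⟫ := by
        filter_upwards [W12.fn_smul c w] with x hx
        simp [hx, inner_smul_left]
      rw [integral_congr_ae this, integral_const_mul, hw', mul_zero]

/-- Tuples `p = (p¹, …, pⁿ)` of harmonic polynomials on `ℝⁿ`, homogeneous of degree `k`. Their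
restrictions to the sphere are the `ℝⁿ`-valued spherical harmonics of order `k`, and `p` is the
(componentwise) harmonic extension of its restriction. -/
def solidHarmonics (n k : ℕ) : Submodule ℝ (Fin n → MvPolynomial (Fin n) ℝ) where
  carrier := {p | ∀ j, (p j).IsHomogeneous k ∧
    ∑ i, MvPolynomial.pderiv i (MvPolynomial.pderiv i (p j)) = 0}
  zero_mem' := fun j => ⟨MvPolynomial.isHomogeneous_zero _ _ _, by simp⟩
  add_mem' := fun hp hq j => ⟨(hp j).1.add (hq j).1, by
    simp [Finset.sum_add_distrib, (hp j).2, (hq j).2]⟩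
  smul_mem' := fun c p hp j => ⟨by
      have := (MvPolynomial.homogeneousSubmodule (Fin n) ℝ k).smul_mem c (hp j).1
      exact this, by
    simp [← Finset.smul_sum, (hp j).2]⟩

/-- The divergence `∑ j, ∂_j pʲ` of a polynomial vector field. -/
def polyDiv {n : ℕ} (p : Fin n → MvPolynomial (Fin n) ℝ) : MvPolynomial (Fin n) ℝ :=
  ∑ j, MvPolynomial.pderiv j (p j)

/-- `w` is (almost everywhere) the restriction to the sphere of the polynomial field `p`. -/
def IsRestriction {n : ℕ} (w : W12 n) (p : Fin n → MvPolynomial (Fin n) ℝ) : Prop :=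
  ∀ᵐ x : Sph n ∂sphereMeasure n, ∀ j, w.fn x j = MvPolynomial.eval (fun i => (x : Euc n) i) (p j)

lemma IsRestriction.zero {n : ℕ} : IsRestriction (0 : W12 n) 0 := by
  filter_upwards [W12.fn_zero (n := n)] with x hx j
  simp [hx]

lemma IsRestriction.add {n : ℕ} {v w : W12 n} {p q : Fin n → MvPolynomial (Fin n) ℝ}
    (hp : IsRestriction v p) (hq : IsRestriction w q) : IsRestriction (v + w) (p + q) := by
  filter_upwards [W12.fn_add v w, hp, hq] with x hx h1 h2 j
  simp [hx, h1 j, h2 j]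

lemma IsRestriction.smul {n : ℕ} (c : ℝ) {w : W12 n} {p : Fin n → MvPolynomial (Fin n) ℝ}
    (hp : IsRestriction w p) : IsRestriction (c • w) (c • p) := by
  filter_upwards [W12.fn_smul c w, hp] with x hx h1 j
  simp [hx, h1 j, MvPolynomial.smul_eval]

/-- `H_{n,k}`: the maps in `H_n` all of whose components are `k`-th order spherical harmonics. -/
def spaceHk (n k : ℕ) : Submodule ℝ (W12 n) where
  carrier := {w | w ∈ spaceH n ∧ ∃ p ∈ solidHarmonics n k, IsRestriction w p}
  zero_mem' := ⟨Submodule.zero_mem _, 0, Submodule.zero_mem _, .zero⟩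
  add_mem' := fun ⟨hv, p, hp, hvp⟩ ⟨hw, q, hq, hwq⟩ =>
    ⟨Submodule.add_mem _ hv hw, p + q, Submodule.add_mem _ hp hq, hvp.add hwq⟩
  smul_mem' := fun c _ ⟨hw, p, hp, hwp⟩ =>
    ⟨Submodule.smul_mem _ c hw, c • p, Submodule.smul_mem _ c hp, hwp.smul c⟩

/-- `H_{n,k,sol}`: the maps in `H_{n,k}` whose harmonic extension is divergence free. -/
def spaceHkSol (n k : ℕ) : Submodule ℝ (W12 n) where
  carrier := {w | w ∈ spaceH n ∧ ∃ p ∈ solidHarmonics n k, IsRestriction w p ∧ polyDiv p = 0}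
  zero_mem' := ⟨Submodule.zero_mem _, 0, Submodule.zero_mem _, .zero, by simp [polyDiv]⟩
  add_mem' := fun ⟨hv, p, hp, hvp, hp0⟩ ⟨hw, q, hq, hwq, hq0⟩ =>
    ⟨Submodule.add_mem _ hv hw, p + q, Submodule.add_mem _ hp hq, hvp.add hwq, by
      unfold polyDiv at *
      simp [Finset.sum_add_distrib, hp0, hq0]⟩
  smul_mem' := fun c _ ⟨hw, p, hp, hwp, hp0⟩ =>
    ⟨Submodule.smul_mem _ c hw, c • p, Submodule.smul_mem _ c hp, hwp.smul c, by
      unfold polyDiv at *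
      simp [← Finset.smul_sum, hp0]⟩

/-- The eigenspace of the operator `A` in `H_{n,k,sol}` for the eigenvalue `c`. -/
def eigenSol (n k : ℕ) (c : ℝ) : Submodule ℝ (W12 n) where
  carrier := {w | w ∈ spaceHkSol n k ∧ ∀ᵐ x ∂sphereMeasure n, w.opA x = c • w.fn x}
  zero_mem' := by
    refine ⟨Submodule.zero_mem _, ?_⟩
    filter_upwards [W12.fn_zero (n := n), W12.grad_zero (n := n)] with x h1 h2
    simp [W12.opA, W12.div, h1, h2]
  add_mem' := by
    rintro v w ⟨hv, hv'⟩ ⟨hw, hw'⟩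
    refine ⟨Submodule.add_mem _ hv hw, ?_⟩
    filter_upwards [W12.fn_add v w, W12.grad_add v w, hv', hw'] with x h1 h2 h3 h4
    have : (v + w).opA x = v.opA x + w.opA x := by
      simp only [W12.opA, W12.div, h2, Pi.add_apply, PiLp.add_apply, Finset.sum_add_distrib,
        add_smul, smul_add]
      abel
    rw [this, h1, h3, h4, Pi.add_apply, smul_add]
  smul_mem' := by
    rintro a w ⟨hw, hw'⟩
    refine ⟨Submodule.smul_mem _ a hw, ?_⟩
    filter_upwards [W12.fn_smul a w, W12.grad_smul a w, hw'] with x h1 h2 h3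
    have : (a • w).opA x = a • w.opA x := by
      simp only [W12.opA, W12.div, h2, Pi.smul_apply, PiLp.smul_apply, ← Finset.smul_sum,
        smul_sub, smul_assoc, smul_comm _ a]
    rw [this, h1, h3, Pi.smul_apply, smul_comm]

/-- `H_{n,k,1}`: the eigenspace of `A` in `H_{n,k,sol}` for the eigenvalue `-k`. -/
def spaceHk1 (n k : ℕ) : Submodule ℝ (W12 n) := eigenSol n k (-(k : ℝ))

/-- `H_{n,k,2}`: the eigenspace of `A` in `H_{n,k,sol}` for the eigenvalue `1`. -/
def spaceHk2 (n k : ℕ) : Submodule ℝ (W12 n) := eigenSol n k 1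

/-- `H_{n,k,3}`: the `W^{1,2}`-orthogonal complement of `H_{n,k,sol}` in `H_{n,k}`. -/
def spaceHk3 (n k : ℕ) : Submodule ℝ (W12 n) := spaceHk n k ⊓ (spaceHkSol n k)ᗮ

/-- `H_{n,0} = H_{n,1,2} ⊕ H_{n,2,3}`. -/
def spaceH0 (n : ℕ) : Submodule ℝ (W12 n) := spaceHk2 n 1 ⊔ spaceHk3 n 2

/-! ### `H_{n,0}` is finite dimensional, so that the orthogonal projection exists -/

lemma eq_zero_of_forall_test {n : ℕ} {f : Sph n → ℝ} (hf : Integrable f (sphereMeasure n))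
    (h : ∀ φ : Euc n → ℝ, ContDiff ℝ ∞ φ → ∫ x : Sph n, φ x * f x ∂sphereMeasure n = 0) :
    f =ᵐ[sphereMeasure n] 0 := by
  have hι : MeasurableEmbedding (Subtype.val : Sph n → Euc n) :=
    MeasurableEmbedding.subtype_coe isClosed_sphere.measurableSet
  set F : Euc n → ℝ := Function.extend Subtype.val f 0 with hF
  have hFv : ∀ x : Sph n, F x = f x := fun x => Subtype.val_injective.extend_apply f 0 x
  have hFi : Integrable F ((sphereMeasure n).map Subtype.val) := by
    rw [hι.integrable_map_iff]
    exact hf.congr (.of_forall fun x => (hFv x).symm)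
  have key := ae_eq_zero_of_integral_contDiff_smul_eq_zero hFi.locallyIntegrable
    (fun φ hφ _ => by
      rw [hι.integral_map]
      simpa [hFv] using h φ hφ)
  have := (hι.ae_map_iff).1 key
  filter_upwards [this] with x hx
  rw [← hFv x, hx]
  rfl

/-- The weak tangential gradient is unique. -/
lemma W12.eq_of_fn_ae {n : ℕ} {v w : W12 n} (h : v.fn =ᵐ[sphereMeasure n] w.fn) : v = w := by
  rw [← sub_eq_zero]
  set z : W12 n := v - w with hz
  have hz0 : z.fn =ᵐ[sphereMeasure n] 0 := by
    have : z.fn =ᵐ[sphereMeasure n] v.fn - w.fn := Lp.coeFn_sub _ _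
    filter_upwards [this, h] with x h1 h2
    rw [h1, Pi.sub_apply, h2, sub_self]
    rfl
  have hg : z.grad =ᵐ[sphereMeasure n] 0 := by
    have hji : ∀ j i : Fin n, (fun x => z.grad x j i) =ᵐ[sphereMeasure n] 0 := by
      intro j i
      refine eq_zero_of_forall_test ?_ fun φ hφ => ?_
      · exact ((EuclideanSpace.proj (𝕜 := ℝ) i).comp_memLp'
          (memLp_row (z : L2Pair n).snd j)).integrable one_le_two
      · let X : Euc n → Euc n := fun y =>
          φ y • (⟪y, y⟫ • EuclideanSpace.single i (1 : ℝ) - y i • y)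
        have hX : IsTangentTestField X := by
          constructor
          · have hi : ContDiff ℝ ∞ (fun y : Euc n => y i) :=
              (EuclideanSpace.proj (𝕜 := ℝ) i).contDiff
            exact hφ.smul (((contDiff_id.inner ℝ contDiff_id).smul contDiff_const).sub
              (hi.smul contDiff_id))
          · intro x
            simp only [X, real_inner_smul_left, inner_sub_left, EuclideanSpace.inner_single_left]
            simp
        have h2 := (z.2 j).2 X hX
        have h3 : ∫ x : Sph n, (z : L2Pair n).fst x j * tangDiv X x ∂sphereMeasure n = 0 := by
          refine integral_eq_zero_of_ae ?_
          filter_upwards [hz0] with x hx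
          have hx' : (z : L2Pair n).fst x = 0 := hx
          rw [hx']
          simp
        rw [h3, eq_comm, neg_eq_zero] at h2
        rw [← h2]
        refine integral_congr_ae ?_
        filter_upwards [(z.2 j).1] with x hx
        have hx1 : ⟪(x : Euc n), (x : Euc n)⟫ = 1 := by
          rw [real_inner_self_eq_norm_sq, norm_eq_of_mem_sphere, one_pow]
        simp only [X, real_inner_smul_right, inner_sub_right, EuclideanSpace.inner_single_right,
          hx, hx1, W12.grad]
        simp
    have hall : ∀ᵐ x ∂sphereMeasure n, ∀ j i, z.grad x j i = 0 := by
      rw [ae_all_iff]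
      intro j
      rw [ae_all_iff]
      exact fun i => hji j i
    filter_upwards [hall] with x hx
    ext j i
    exact hx j i
  have e1 : (z : L2Pair n).fst = 0 := Lp.ext (hz0.trans (Lp.coeFn_zero _ _ _).symm)
  have e2 : (z : L2Pair n).snd = 0 := Lp.ext (hg.trans (Lp.coeFn_zero _ _ _).symm)
  apply Subtype.ext
  exact (WithLp.ext_iff 2).2 (Prod.ext e1 e2)

instance finiteDimensional_solidHarmonics (n k : ℕ) :
    FiniteDimensional ℝ (solidHarmonics n k) := by
  let P := MvPolynomial.homogeneousSubmodule (Fin n) ℝ k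
  have hP : FiniteDimensional ℝ P :=
    Module.Finite.iff_fg.2 (MvPolynomial.homogeneousSubmodule_fg _ _ k)
  let L : solidHarmonics n k →ₗ[ℝ] (Fin n → P) :=
    { toFun := fun p j => ⟨p.1 j, (p.2 j).1⟩
      map_add' := fun _ _ => rfl
      map_smul' := fun _ _ => rfl }
  refine FiniteDimensional.of_injective L fun p q h => Subtype.ext (funext fun j => ?_)
  exact congrArg Subtype.val (congrFun h j)

instance finiteDimensional_spaceHk (n k : ℕ) : FiniteDimensional ℝ (spaceHk n k) := by
  let K : Submodule ℝ (spaceHk n k × solidHarmonics n k) :=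
    { carrier := {q | IsRestriction (q.1 : W12 n) q.2}
      zero_mem' := .zero
      add_mem' := fun h1 h2 => h1.add h2
      smul_mem' := fun c _ h => h.smul c }
  have hinj : Function.Injective ((LinearMap.snd ℝ _ _).comp K.subtype) := by
    rintro ⟨⟨w, p⟩, h⟩ ⟨⟨w', p'⟩, h'⟩ hpp
    have hpp' : p = p' := hpp
    subst hpp'
    have : (w : W12 n) = w' := W12.eq_of_fn_ae (by
      filter_upwards [h, h'] with x h1 h2
      ext j
      exact (h1 j).trans (h2 j).symm)
    have : w = w' := Subtype.ext this
    subst this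
    rfl
  have : FiniteDimensional ℝ K := FiniteDimensional.of_injective _ hinj
  refine Module.Finite.of_surjective ((LinearMap.fst ℝ _ _).comp K.subtype) fun w => ?_
  obtain ⟨p, hp, hwp⟩ := w.2.2
  exact ⟨⟨(w, ⟨p, hp⟩), hwp⟩, rfl⟩

lemma spaceHkSol_le (n k : ℕ) : spaceHkSol n k ≤ spaceHk n k :=
  fun _ ⟨hw, p, hp, hwp, _⟩ => ⟨hw, p, hp, hwp⟩

instance finiteDimensional_spaceH0 (n : ℕ) : FiniteDimensional ℝ (spaceH0 n) := by
  have h2 : spaceHk2 n 1 ≤ spaceHk n 1 := fun w hw => spaceHkSol_le n 1 hw.1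
  have h3 : spaceHk3 n 2 ≤ spaceHk n 2 := inf_le_left
  have := Submodule.finiteDimensional_of_le h2
  have := Submodule.finiteDimensional_of_le h3
  unfold spaceH0
  infer_instance

instance hasOrthogonalProjection_spaceH0 (n : ℕ) : (spaceH0 n).HasOrthogonalProjection := by
  have : CompleteSpace (spaceH0 n) := FiniteDimensional.complete ℝ (spaceH0 n)
  exact Submodule.HasOrthogonalProjection.ofCompleteSpace (spaceH0 n)

/-- The `W^{1,2}`-orthogonal projection onto `H_{n,0}`. -/
def projH0 (n : ℕ) : W12 n →L[ℝ] W12 n := (spaceH0 n).starProjection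

/-! ### Infinitesimal Möbius transformations -/

/-- The Möbius transformation `φ_{ξ,λ}` of the sphere: the stereographic projection from `-ξ` onto
the tangent plane at `ξ`, followed by the dilation by the factor `λ` about `ξ` in this plane,
followed by the inverse stereographic projection. -/
def mobiusDilation {n : ℕ} (ξ : Sph n) (l : ℝ) (x : Sph n) : Euc n :=
  (l ^ 2 * (1 - ⟪(x : Euc n), ξ⟫) + (1 + ⟪(x : Euc n), ξ⟫))⁻¹ •
    (-(l ^ 2 * (1 - ⟪(x : Euc n), ξ⟫)) • (ξ : Euc n)
      + (2 * l) • ((x : Euc n) - ⟪(x : Euc n), ξ⟫ • (ξ : Euc n))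
      + (1 + ⟪(x : Euc n), ξ⟫) • (ξ : Euc n))

/-- The conformal group of the sphere, `{O φ_{ξ,λ} : O ∈ O(n), ξ ∈ 𝕊ⁿ⁻¹, λ > 0}`. -/
def confSphere (n : ℕ) : Set (Sph n → Euc n) :=
  {φ | ∃ (O : Euc n ≃ₗᵢ[ℝ] Euc n) (ξ : Sph n) (l : ℝ), 0 < l ∧
    φ = fun x => O (mobiusDilation ξ l x)}

/-- The Lie algebra of infinitesimal Möbius transformations of the sphere, i.e. the tangent
space at the identity of the conformal group: the span of the velocities at time `0` of curves
of Möbius transformations that start at the identity. -/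
def mobiusAlgebra (n : ℕ) : Submodule ℝ (Sph n → Euc n) :=
  Submodule.span ℝ {Y | ∃ γ : ℝ → Sph n → Euc n, (∀ t, γ t ∈ confSphere n) ∧
    (∀ x, γ 0 x = x) ∧ ∀ x, HasDerivAt (fun t => γ t x) (Y x) 0}

end

open MeasureTheory Metric
open scoped ContDiff InnerProductSpace RealInnerProductSpace

noncomputable section

/-! ### Invariance of the surface measure and the divergence theorem -/

-- Everything follows from one estimate: on `spaceH n` the form controls the squared `W^{1,2}`
-- distance to `spaceH0 n` (`exists_coercivity`). Together with the vanishing of the form on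
-- `spaceH0 n`, it gives the zero set, the kernel of the polar form (a nonnegative form is
-- degenerate exactly on its null vectors) and the gradient estimate.
--
-- The estimate is proved for polynomial fields. Write `w = Y + f x` with `f = ⟨w, x⟩` and `Y`
-- tangential on the sphere. The only coupling between `Y` and `f` in the energy is `(n - 3) (f div
-- Y + ⟨∇f, Y⟩) = (n - 3) div (f Y)`, which integrates to zero (`integral_energyDensity`). The
-- normal energy `∫ |∇f|² - (n - 1) f²` ignores the linear part of `f`, and `∫ f = 0`, so the
-- spectrum from `2n` upwards controls what is left. In the tangential energy let `c` be the mean of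
-- `Y`. Splitting off the conformal gradient field with mean `c` leaves a deficit which is absorbed
-- exactly by completing the square in the divergence term (`tangential_energy_eq`). The remainder
-- `r` is orthogonal to all affine functions and again has a spectral gap. The linear part of `Y`
-- costs no energy: its skew part is an infinitesimal rotation, and its symmetric part `s` obeys
-- `⟨x, s x⟩ = -⟨x, r⟩` by tangency, hence is bounded by `r` (`sum_sInt_lin_sq_le`). Up to
-- controlled terms, `w` is therefore `S x + e / n - ⟨e, x⟩ x` with `S` skew
-- (`exists_mobiusField_near`).
--
-- The spectral input needs no expansion in spherical harmonics: the spherical Laplacian is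
-- triangular for the degree filtration of polynomials, with diagonal `-k (k + n - 2)`. The same
-- triangularity and Stone–Weierstrass make polynomial fields dense in `W^{1,2}`, and continuity
-- extends the estimate.
--
-- The fields `S x + e / n - ⟨e, x⟩ x` are exactly `spaceH0 n`: the eigenvalue equation in degree
-- one says that the matrix is skew, and in degree two the divergence identifies the complement of
-- the solenoidal fields with the linear forms. On the group side, every Möbius map becomes affine
-- after multiplication by an affine weight. Differentiating along a curve gives a tangential field
-- that is affine minus an affine multiple of `x`, which must be `S x + b - ⟨b, x⟩ x`. Subtracting
-- the mean turns `b` into `b / n`.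

instance sphereMeasure_isOpenPosMeasure (n : ℕ) : (sphereMeasure n).IsOpenPosMeasure := by
  rw [sphereMeasure]
  exact Measure.isOpenPosMeasure_smul _ (ENNReal.inv_ne_zero.2 (measure_ne_top _ _))

lemma isProbabilityMeasure_sphereMeasure {n : ℕ} (hn : 1 ≤ n) :
    IsProbabilityMeasure (sphereMeasure n) := by
  have : Nonempty (Fin n) := ⟨⟨0, hn⟩⟩
  have : Nontrivial (Euc n) := inferInstance
  constructor
  rw [sphereMeasure, Measure.smul_apply, smul_eq_mul, ENNReal.inv_mul_cancel]
  · rw [Ne, Measure.measure_univ_eq_zero]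
    exact Measure.toSphere_ne_zero _
  · exact measure_ne_top _ _

lemma integrable_sphere_of_continuous {n : ℕ} {F : Type*} [NormedAddCommGroup F]
    [SecondCountableTopology F] {f : Sph n → F} (hf : Continuous f) :
    Integrable f (sphereMeasure n) :=
  (memLp_sphere_of_continuous hf).integrable one_le_two

/-- The action of a linear isometry on the sphere. -/
def sphereMap {n : ℕ} (O : Euc n ≃ₗᵢ[ℝ] Euc n) (x : Sph n) : Sph n :=
  ⟨O x, by simp⟩

lemma continuous_sphereMap {n : ℕ} (O : Euc n ≃ₗᵢ[ℝ] Euc n) : Continuous (sphereMap O) :=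
  Continuous.subtype_mk (O.continuous.comp continuous_subtype_val) _

-- The surface measure of a set is a multiple of the Lebesgue measure of the cone over it, and a
-- linear isometry commutes with forming cones and preserves Lebesgue measure.
open scoped Pointwise in
lemma measurePreserving_sphereMap {n : ℕ} (O : Euc n ≃ₗᵢ[ℝ] Euc n) :
    MeasurePreserving (sphereMap O) (sphereMeasure n) (sphereMeasure n) := by
  refine MeasurePreserving.smul_measure ⟨(continuous_sphereMap O).measurable, ?_⟩ _
  ext s hs
  rw [Measure.map_apply (continuous_sphereMap O).measurable hs,
    Measure.toSphere_apply' _ ((continuous_sphereMap O).measurable hs),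
    Measure.toSphere_apply' _ hs]
  congr 1
  have key : (O : Euc n → Euc n) ⁻¹' (Set.Ioo (0 : ℝ) 1 • ((↑) '' s : Set (Euc n))) =
      Set.Ioo (0 : ℝ) 1 • ((↑) '' (sphereMap O ⁻¹' s) : Set (Euc n)) := by
    ext y
    simp only [Set.mem_preimage, Set.mem_smul, Set.mem_image]
    constructor
    · rintro ⟨r, hr, -, ⟨z, hz, rfl⟩, h⟩
      refine ⟨r, hr, _, ⟨sphereMap O.symm z, ?_, rfl⟩, ?_⟩
      · have : sphereMap O (sphereMap O.symm z) = z := Subtype.ext (O.apply_symm_apply _)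
        show _ ∈ s
        rwa [this]
      · apply O.injective
        rw [← h, map_smul]
        exact congrArg _ (O.apply_symm_apply _)
    · rintro ⟨r, hr, -, ⟨z, hz, rfl⟩, rfl⟩
      exact ⟨r, hr, _, ⟨_, hz, rfl⟩, (map_smul O r _).symm⟩
  rw [← key]
  exact O.measurePreserving.measure_preimage_equiv (f := O.toMeasurableEquiv) _

lemma integral_sphereMap {n : ℕ} (O : Euc n ≃ₗᵢ[ℝ] Euc n) {f : Sph n → ℝ} (hf : Continuous f) :
    ∫ x, f (sphereMap O x) ∂sphereMeasure n = ∫ x, f x ∂sphereMeasure n := by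
  rw [← integral_map (continuous_sphereMap O).measurable.aemeasurable
    hf.aestronglyMeasurable, (measurePreserving_sphereMap O).map_eq]

/-- The rotation by the angle `2 t` in the plane spanned by `e_i` and `e_j`, written as the
product of two reflections. -/
def planeRotation {n : ℕ} (i j : Fin n) (t : ℝ) : Euc n ≃ₗᵢ[ℝ] Euc n :=
  (Submodule.reflection (Submodule.span ℝ {EuclideanSpace.single i (1 : ℝ)})).trans
    (Submodule.reflection (Submodule.span ℝ
      {Real.cos t • EuclideanSpace.single i (1 : ℝ) + Real.sin t • EuclideanSpace.single j 1}))

lemma planeRotation_apply {n : ℕ} {i j : Fin n} (hij : i ≠ j) (t : ℝ) (v : Euc n) :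
    planeRotation i j t v = (2 * (Real.cos t * v i - Real.sin t * v j)) •
      (Real.cos t • EuclideanSpace.single i (1 : ℝ) + Real.sin t • EuclideanSpace.single j 1)
        - (2 * v i) • EuclideanSpace.single i (1 : ℝ) + v := by
  have hu : ‖Real.cos t • EuclideanSpace.single i (1 : ℝ)
      + Real.sin t • EuclideanSpace.single j (1 : ℝ)‖ ^ 2 = 1 := by
    rw [norm_add_sq_real, norm_smul, norm_smul, real_inner_smul_left, real_inner_smul_right,
      EuclideanSpace.inner_single_left]
    simp [hij]
  rw [planeRotation, LinearIsometryEquiv.trans_apply, Submodule.reflection_singleton_apply,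
    Submodule.reflection_singleton_apply]
  simp only [RCLike.ofReal_real_eq_id, id, hu]
  simp only [EuclideanSpace.inner_single_left, inner_add_left, real_inner_smul_left,
    inner_sub_right]
  simp [two_smul, hij.symm]
  match_scalars <;> ring

/-- The velocity of `planeRotation i j · v`. -/
def planeRotationDeriv {n : ℕ} (i j : Fin n) (t : ℝ) (v : Euc n) : Euc n :=
  (2 * (-Real.sin t * v i - Real.cos t * v j)) •
      (Real.cos t • EuclideanSpace.single i (1 : ℝ) + Real.sin t • EuclideanSpace.single j 1) +
    (2 * (Real.cos t * v i - Real.sin t * v j)) •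
      (-Real.sin t • EuclideanSpace.single i (1 : ℝ) + Real.cos t • EuclideanSpace.single j 1)

lemma hasDerivAt_planeRotation {n : ℕ} {i j : Fin n} (hij : i ≠ j) (t : ℝ) (v : Euc n) :
    HasDerivAt (fun t => planeRotation i j t v) (planeRotationDeriv i j t v) t := by
  have h : (fun t => planeRotation i j t v) = fun t => _ := funext fun t =>
    planeRotation_apply hij t v
  rw [h]
  have h1 : HasDerivAt (fun t => 2 * (Real.cos t * v i - Real.sin t * v j))
      (2 * (-Real.sin t * v i - Real.cos t * v j)) t :=
    (((Real.hasDerivAt_cos t).mul_const _).sub ((Real.hasDerivAt_sin t).mul_const _)).const_mul 2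
  have h2 : HasDerivAt (fun t => Real.cos t • EuclideanSpace.single i (1 : ℝ)
      + Real.sin t • EuclideanSpace.single j (1 : ℝ))
      (-Real.sin t • EuclideanSpace.single i (1 : ℝ) + Real.cos t • EuclideanSpace.single j 1) t :=
    ((Real.hasDerivAt_cos t).smul_const _).add ((Real.hasDerivAt_sin t).smul_const _)
  have h3 := ((h1.smul h2).sub_const ((2 * v i) • EuclideanSpace.single i (1 : ℝ))).add_const v
  refine h3.congr_deriv ?_
  simp only [planeRotationDeriv]
  exact add_comm _ _

lemma planeRotationDeriv_zero {n : ℕ} (i j : Fin n) (v : Euc n) :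
    planeRotationDeriv i j 0 v =
      (2 * v i) • EuclideanSpace.single j 1 - (2 * v j) • EuclideanSpace.single i (1 : ℝ) := by
  simp [planeRotationDeriv]
  abel

lemma planeRotation_zero {n : ℕ} {i j : Fin n} (hij : i ≠ j) (v : Euc n) :
    planeRotation i j 0 v = v := by
  simp [planeRotation_apply hij]

/-- By invariance, the integral of `g` composed with a plane rotation does not depend on the angle;
differentiation under the integral sign at angle zero gives the identity. It is the source of every
integration by parts below. -/
lemma integral_rotation_field {n : ℕ} (i j : Fin n) {g : Euc n → ℝ} (hg : ContDiff ℝ 1 g) :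
    ∫ x : Sph n, ((x : Euc n) i * fderiv ℝ g x (EuclideanSpace.single j 1)
      - (x : Euc n) j * fderiv ℝ g x (EuclideanSpace.single i 1)) ∂sphereMeasure n = 0 := by
  rcases eq_or_ne i j with rfl | hij
  · simp
  have hfd : Continuous (fderiv ℝ g) := hg.continuous_fderiv (by simp)
  have hc : ∀ k : Fin n, Continuous fun p : ℝ × Sph n => (p.2 : Euc n) k := fun k =>
    (EuclideanSpace.proj (𝕜 := ℝ) k).continuous.comp (continuous_subtype_val.comp continuous_snd)
  have hR : Continuous fun p : ℝ × Sph n => planeRotation i j p.1 (p.2 : Euc n) := by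
    simp only [planeRotation_apply hij]
    have := hc i
    have := hc j
    fun_prop
  have hR' : Continuous fun p : ℝ × Sph n => planeRotationDeriv i j p.1 (p.2 : Euc n) := by
    simp only [planeRotationDeriv]
    have := hc i
    have := hc j
    fun_prop
  obtain ⟨F', hF'⟩ : ∃ F' : ℝ × Sph n → ℝ, F' = fun p =>
    fderiv ℝ g (planeRotation i j p.1 p.2) (planeRotationDeriv i j p.1 p.2) := ⟨_, rfl⟩
  have hF'c : Continuous F' := hF' ▸ (hfd.comp hR).clm_apply hR'
  obtain ⟨C, hC⟩ := (isCompact_Icc (a := (-1 : ℝ)) (b := 1)).prod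
    (isCompact_univ (X := Sph n)) |>.exists_bound_of_continuousOn hF'c.continuousOn
  have hder : ∀ (t : ℝ) (x : Sph n),
      HasDerivAt (fun t => g (planeRotation i j t (x : Euc n))) (F' (t, x)) t := fun t x => by
    rw [hF']
    exact ((hg.differentiable (by simp) _).hasFDerivAt).comp_hasDerivAt t
      (hasDerivAt_planeRotation hij t (x : Euc n))
  have hgc : ∀ t, Continuous fun x : Sph n => g (planeRotation i j t x) := fun t =>
    hg.continuous.comp ((planeRotation i j t).continuous.comp continuous_subtype_val)
  have hF'm : ∀ t, Continuous fun x : Sph n => F' (t, x) := fun t =>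
    hF'c.comp (Continuous.prodMk_right t)
  have key := hasDerivAt_integral_of_dominated_loc_of_deriv_le (μ := sphereMeasure n)
    (F := fun t (x : Sph n) => g (planeRotation i j t x)) (F' := fun t x => F' (t, x)) (x₀ := 0)
    (s := Set.Icc (-1) 1) (bound := fun _ => C) (Icc_mem_nhds (by norm_num) (by norm_num))
    (.of_forall fun t => (hgc t).aestronglyMeasurable) (integrable_sphere_of_continuous (hgc 0))
    (hF'm 0).aestronglyMeasurable
    (.of_forall fun x t ht => hC (t, x) ⟨ht, Set.mem_univ _⟩) (integrable_const C)
    (.of_forall fun x t _ => hder t x)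
  have hconst : (fun t => ∫ x : Sph n, g (planeRotation i j t x) ∂sphereMeasure n) =
      fun _ => ∫ x : Sph n, g x ∂sphereMeasure n := by
    funext t
    exact integral_sphereMap (planeRotation i j t)
      (f := fun x => g x) (hg.continuous.comp continuous_subtype_val)
  rw [hconst] at key
  have h0 := key.2.unique (hasDerivAt_const _ _)
  simp only [hF', planeRotation_zero hij, planeRotationDeriv_zero, map_sub, map_smul,
    smul_eq_mul] at h0
  -- The factor 2 is the angular speed of `planeRotation`.
  have h1 : ∫ x : Sph n, (2 * (x : Euc n) i * fderiv ℝ g x (EuclideanSpace.single j 1)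
      - 2 * (x : Euc n) j * fderiv ℝ g x (EuclideanSpace.single i 1)) ∂sphereMeasure n =
      2 * ∫ x : Sph n, ((x : Euc n) i * fderiv ℝ g x (EuclideanSpace.single j 1)
      - (x : Euc n) j * fderiv ℝ g x (EuclideanSpace.single i 1)) ∂sphereMeasure n := by
    rw [← integral_const_mul]
    congr 1
    ext x
    ring
  rw [h1] at h0
  linarith

lemma continuous_coord_sphere {n : ℕ} (i : Fin n) : Continuous fun x : Sph n => (x : Euc n) i :=
  (EuclideanSpace.proj (𝕜 := ℝ) i).continuous.comp continuous_subtype_val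

lemma sum_coord_sq_sphere {n : ℕ} (x : Sph n) : ∑ i, (x : Euc n) i * (x : Euc n) i = 1 := by
  have h : ‖(x : Euc n)‖ ^ 2 = 1 := by simp
  rw [EuclideanSpace.norm_sq_eq] at h
  simpa [pow_two] using h

lemma sum_coord_smul_single {n : ℕ} (x : Euc n) :
    ∑ i, x i • EuclideanSpace.single i (1 : ℝ) = x := by
  ext k
  simp [Pi.single_apply]

/-- Integration by parts on the sphere. -/
lemma integral_fderiv_single {n : ℕ} (i : Fin n) {h : Euc n → ℝ} (hh : ContDiff ℝ 1 h) :
    ∫ x : Sph n, fderiv ℝ h x (EuclideanSpace.single i 1) ∂sphereMeasure n =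
      ∫ x : Sph n, (x : Euc n) i * (fderiv ℝ h x x + ((n : ℝ) - 1) * h x) ∂sphereMeasure n := by
  have hfd : Continuous (fun x : Sph n => fderiv ℝ h x) :=
    (hh.continuous_fderiv (by simp)).comp continuous_subtype_val
  have hhc : Continuous (fun x : Sph n => h x) := hh.continuous.comp continuous_subtype_val
  have hco := fun j => continuous_coord_sphere (n := n) j
  have hder : ∀ (j : Fin n) (x v : Euc n),
      fderiv ℝ (fun y : Euc n => y j * h y) x v = v j * h x + x j * fderiv ℝ h x v := by
    intro j x v
    have h1 : HasFDerivAt (fun y : Euc n => y j) (EuclideanSpace.proj (𝕜 := ℝ) j) x :=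
      (EuclideanSpace.proj (𝕜 := ℝ) j).hasFDerivAt
    have h2 := (hh.differentiable (by simp) x).hasFDerivAt
    rw [(h1.fun_mul h2).fderiv]
    simp
    ring
  -- The rotation identity is applied to `x_j h` in the plane of `e_j` and `e_i`. Summing over `j`
  -- with `∑ x_j² = 1` isolates `∂_i h`, and the sum over `j` of the derivatives of `x_j` produces
  -- the factor `n - 1`.
  have key : ∀ j, ∫ x : Sph n, ((x : Euc n) j *
      fderiv ℝ (fun y : Euc n => y j * h y) x (EuclideanSpace.single i 1)
      - (x : Euc n) i * fderiv ℝ (fun y : Euc n => y j * h y) x (EuclideanSpace.single j 1))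
        ∂sphereMeasure n = 0 := fun j =>
    integral_rotation_field j i ((EuclideanSpace.proj (𝕜 := ℝ) j).contDiff.mul hh)
  simp only [hder] at key
  have hsum := Finset.sum_eq_zero fun j (_ : j ∈ Finset.univ) => key j
  rw [← integral_finsetSum _ fun j _ => integrable_sphere_of_continuous (by fun_prop)] at hsum
  rw [← sub_eq_zero, ← integral_sub (integrable_sphere_of_continuous (by fun_prop))
    (integrable_sphere_of_continuous (by fun_prop)), ← hsum]
  congr 1
  ext x
  have e1 : fderiv ℝ h x x = ∑ j, (x : Euc n) j * fderiv ℝ h x (EuclideanSpace.single j 1) := by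
    have := congrArg (fderiv ℝ h x) (sum_coord_smul_single (x : Euc n))
    rw [← this, map_sum]
    simp only [map_smul, smul_eq_mul]
  have e2 : ∀ j, (x : Euc n) j * ((EuclideanSpace.single i (1:ℝ) : Euc n) j * h x +
        (x : Euc n) j * fderiv ℝ h x (EuclideanSpace.single i 1)) - (x : Euc n) i *
        ((EuclideanSpace.single j (1:ℝ) : Euc n) j * h x + (x : Euc n) j *
          fderiv ℝ h x (EuclideanSpace.single j 1)) =
      (if j = i then (x : Euc n) j * h x else 0) + (x : Euc n) j * (x : Euc n) j *
        fderiv ℝ h x (EuclideanSpace.single i 1) - (x : Euc n) i * h x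
        - (x : Euc n) i * ((x : Euc n) j * fderiv ℝ h x (EuclideanSpace.single j 1)) := by
    intro j
    by_cases hij : j = i
    · simp [hij]; ring
    · simp [hij]; ring
  simp only [e2, Finset.sum_add_distrib, Finset.sum_sub_distrib, ← Finset.mul_sum,
    ← Finset.sum_mul, sum_coord_sq_sphere, Finset.sum_ite_eq', Finset.mem_univ, if_true, ← e1]
  simp
  ring

/-! ### Calculus of polynomials on the sphere -/

/-- Real polynomials on `ℝⁿ`. -/
abbrev RPoly (n : ℕ) : Type := MvPolynomial (Fin n) ℝ

section PolynomialCalculus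

open MvPolynomial

variable {n : ℕ}

/-- The polynomial function on Euclidean space. -/
def ev (p : RPoly n) (x : Euc n) : ℝ := eval (fun i => x i) p

@[simp] lemma ev_add (p q : RPoly n) (x : Euc n) : ev (p + q) x = ev p x + ev q x := by simp [ev]
@[simp] lemma ev_sub (p q : RPoly n) (x : Euc n) : ev (p - q) x = ev p x - ev q x := by simp [ev]
@[simp] lemma ev_mul (p q : RPoly n) (x : Euc n) : ev (p * q) x = ev p x * ev q x := by simp [ev]
@[simp] lemma ev_smul (c : ℝ) (p : RPoly n) (x : Euc n) : ev (c • p) x = c * ev p x := by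
  simp [ev, smul_eval]
@[simp] lemma ev_C (c : ℝ) (x : Euc n) : ev (C c) x = c := by simp [ev]
@[simp] lemma ev_zero (x : Euc n) : ev (0 : RPoly n) x = 0 := by simp [ev]
@[simp] lemma ev_one (x : Euc n) : ev (1 : RPoly n) x = 1 := by simp [ev]
@[simp] lemma ev_X (i : Fin n) (x : Euc n) : ev (X i) x = x i := by simp [ev]
@[simp] lemma ev_sum {ι : Type*} (s : Finset ι) (p : ι → RPoly n) (x : Euc n) :
    ev (∑ i ∈ s, p i) x = ∑ i ∈ s, ev (p i) x := by simp [ev]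

lemma contDiff_ev (p : RPoly n) : ContDiff ℝ ∞ (ev p) := by
  induction p using MvPolynomial.induction_on with
  | C a => simp only [funext (ev_C a)]; exact contDiff_const
  | add p q hp hq => simp only [funext (ev_add p q)]; exact hp.add hq
  | mul_X p i hp =>
    simp only [funext (ev_mul p (X i)), ev_X]
    exact hp.mul (EuclideanSpace.proj (𝕜 := ℝ) i).contDiff

lemma continuous_ev_sphere (p : RPoly n) : Continuous fun x : Sph n => ev p x :=
  (contDiff_ev p).continuous.comp continuous_subtype_val

lemma fderiv_ev (p : RPoly n) (x v : Euc n) :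
    fderiv ℝ (ev p) x v = ∑ i, v i * ev (pderiv i p) x := by
  have hd : ∀ q : RPoly n, HasFDerivAt (ev q) (fderiv ℝ (ev q) x) x := fun q =>
    ((contDiff_ev q).differentiable (by simp) x).hasFDerivAt
  induction p using MvPolynomial.induction_on with
  | C a => simp [funext (ev_C (n := n) a)]
  | add p q hp hq =>
    rw [funext (ev_add p q), ((hd p).fun_add (hd q)).fderiv]
    simp [hp, hq, mul_add, Finset.sum_add_distrib]
  | mul_X p j hp =>
    have hX : HasFDerivAt (ev (X j)) (EuclideanSpace.proj (𝕜 := ℝ) j) x := by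
      rw [funext (ev_X j)]
      exact (EuclideanSpace.proj (𝕜 := ℝ) j).hasFDerivAt
    rw [funext (ev_mul p (X j)), ((hd p).fun_mul hX).fderiv]
    have h1 : ∀ i, v i * ev (pderiv i (p * X j)) x =
        (if j = i then v i * ev p x else 0) + x j * (v i * ev (pderiv i p) x) := by
      intro i
      rw [pderiv_mul, pderiv_X]
      by_cases hij : j = i
      · subst hij; simp; ring
      · simp [hij]; ring
    simp only [h1, Finset.sum_add_distrib, Finset.sum_ite_eq, Finset.mem_univ, if_true,
      ← Finset.mul_sum]
    simp [hp]
    ring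

/-- The Euler derivation `∑ i, x_i ∂_i`. -/
def euler : Derivation ℝ (RPoly n) (RPoly n) := mkDerivation ℝ X

@[simp] lemma euler_X (i : Fin n) : euler (X i : RPoly n) = X i := mkDerivation_X _ _ _

@[simp] lemma euler_C (c : ℝ) : euler (C c : RPoly n) = 0 := Derivation.map_algebraMap _ _

lemma euler_apply (p : RPoly n) : euler p = ∑ i, X i * pderiv i p := by
  induction p using MvPolynomial.induction_on with
  | C a => simp
  | add p q hp hq => simp [hp, hq, mul_add, Finset.sum_add_distrib]
  | mul_X p j hp =>
    rw [Derivation.leibniz, euler_X, hp]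
    simp [pderiv_X, Pi.single_apply, mul_add, Finset.sum_add_distrib, Finset.mul_sum, apply_ite]
    congr 1
    · ring
    · exact Finset.sum_congr rfl fun i _ => by ring

lemma euler_mul (p q : RPoly n) : euler (p * q) = p * euler q + q * euler p := by
  rw [Derivation.leibniz, smul_eq_mul, smul_eq_mul]

lemma euler_of_isHomogeneous {p : RPoly n} {k : ℕ} (hp : p.IsHomogeneous k) :
    euler p = (k : ℝ) • p := by
  rw [euler_apply, hp.sum_X_mul_pderiv, Nat.cast_smul_eq_nsmul]

/-- The average of a polynomial over the sphere. -/
def sInt : RPoly n →ₗ[ℝ] ℝ where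
  toFun p := ∫ x : Sph n, ev p x ∂sphereMeasure n
  map_add' p q := by
    simp only [ev_add]
    exact integral_add (integrable_sphere_of_continuous (continuous_ev_sphere p))
      (integrable_sphere_of_continuous (continuous_ev_sphere q))
  map_smul' c p := by
    simp only [ev_smul]
    exact integral_const_mul _ _

lemma sInt_apply (p : RPoly n) : sInt p = ∫ x : Sph n, ev p x ∂sphereMeasure n := rfl

lemma sInt_congr {p q : RPoly n} (h : ∀ x : Sph n, ev p x = ev q x) : sInt p = sInt q := by
  simp only [sInt_apply, h]

lemma sInt_one (hn : 1 ≤ n) : sInt (1 : RPoly n) = 1 := by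
  have := isProbabilityMeasure_sphereMeasure hn
  simp [sInt_apply]

lemma sInt_C (hn : 1 ≤ n) (c : ℝ) : sInt (C c : RPoly n) = c := by
  have := isProbabilityMeasure_sphereMeasure hn
  simp [sInt_apply]

lemma sInt_mul_self_nonneg (p : RPoly n) : 0 ≤ sInt (p * p) :=
  integral_nonneg fun x => by simpa using mul_self_nonneg _

lemma fderiv_ev_single (p : RPoly n) (x : Euc n) (i : Fin n) :
    fderiv ℝ (ev p) x (EuclideanSpace.single i 1) = ev (pderiv i p) x := by
  simp [fderiv_ev]

lemma fderiv_ev_self (p : RPoly n) (x : Euc n) : fderiv ℝ (ev p) x x = ev (euler p) x := by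
  simp [fderiv_ev, euler_apply]

lemma sInt_pderiv (i : Fin n) (p : RPoly n) :
    sInt (pderiv i p) = sInt (X i * (euler p + ((n : ℝ) - 1) • p)) := by
  have h := integral_fderiv_single i ((contDiff_ev p).of_le (by simp) : ContDiff ℝ 1 (ev p))
  simp only [fderiv_ev_single, fderiv_ev_self] at h
  simp only [sInt_apply, h]
  simp

/-- On homogeneous polynomials the radial derivative is multiplication by the degree. The resulting
recursion lowers the degree by two and yields all the moments that are needed. -/
lemma sInt_X_mul_of_isHomogeneous (i : Fin n) {p : RPoly n} {k : ℕ} (hp : p.IsHomogeneous k) :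
    ((n : ℝ) - 1 + k) * sInt (X i * p) = sInt (pderiv i p) := by
  rw [sInt_pderiv, euler_of_isHomogeneous hp, ← add_smul, mul_smul_comm, map_smul, smul_eq_mul]
  ring

/-- The tangential gradient of a polynomial. -/
def tgrad (p : RPoly n) (x : Euc n) : Euc n :=
  WithLp.toLp 2 (fun i => ev (pderiv i p) x) - ev (euler p) x • x

lemma tgrad_apply (p : RPoly n) (x : Euc n) (i : Fin n) :
    tgrad p x i = ev (pderiv i p) x - ev (euler p) x * x i := by simp [tgrad]

lemma contDiff_tgrad (p : RPoly n) : ContDiff ℝ ∞ (tgrad p) := by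
  rw [contDiff_euclidean]
  intro i
  simp only [tgrad_apply]
  exact (contDiff_ev _).sub ((contDiff_ev _).mul (EuclideanSpace.proj (𝕜 := ℝ) i).contDiff)

lemma continuous_tgrad_sphere (p : RPoly n) : Continuous fun x : Sph n => tgrad p x :=
  (contDiff_tgrad p).continuous.comp continuous_subtype_val

lemma inner_eq_sum (x y : Euc n) : ⟪x, y⟫ = ∑ i, x i * y i := by
  rw [PiLp.inner_apply]
  exact Finset.sum_congr rfl fun i _ => mul_comm _ _

lemma inner_self_sphere (x : Sph n) : ⟪(x : Euc n), (x : Euc n)⟫ = 1 := by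
  rw [inner_eq_sum, sum_coord_sq_sphere]

lemma inner_tgrad_sphere (p : RPoly n) (x : Sph n) : ⟪tgrad p x, (x : Euc n)⟫ = 0 := by
  rw [tgrad, inner_sub_left, real_inner_smul_left, inner_self_sphere, inner_eq_sum, euler_apply]
  simp [mul_comm]

lemma tgrad_add (p q : RPoly n) (x : Euc n) : tgrad (p + q) x = tgrad p x + tgrad q x := by
  ext i
  simp [tgrad_apply]
  ring

lemma tgrad_sub (p q : RPoly n) (x : Euc n) : tgrad (p - q) x = tgrad p x - tgrad q x := by
  ext i
  simp [tgrad_apply]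
  ring

lemma tgrad_mul (p q : RPoly n) (x : Euc n) :
    tgrad (p * q) x = ev p x • tgrad q x + ev q x • tgrad p x := by
  ext i
  simp [tgrad_apply]
  ring

lemma tgrad_X (i : Fin n) (x : Euc n) :
    tgrad (X i) x = EuclideanSpace.single i 1 - x i • x := by
  ext j
  rw [tgrad_apply, pderiv_X]
  by_cases hij : j = i
  · subst hij; simp
  · simp [hij, Ne.symm hij]

lemma tgrad_C (c : ℝ) (x : Euc n) : tgrad (C c : RPoly n) x = 0 := by
  ext j
  simp [tgrad_apply]

lemma tgrad_one (x : Euc n) : tgrad (1 : RPoly n) x = 0 := by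
  rw [← C_1, tgrad_C]

lemma tgrad_sum {ι : Type*} (s : Finset ι) (p : ι → RPoly n) (x : Euc n) :
    tgrad (∑ i ∈ s, p i) x = ∑ i ∈ s, tgrad (p i) x := by
  classical
  induction s using Finset.induction_on with
  | empty => ext j; simp [tgrad_apply]
  | insert a s ha ih => rw [Finset.sum_insert ha, Finset.sum_insert ha, tgrad_add, ih]

/-- The flat Laplacian. -/
def flatLap : RPoly n →ₗ[ℝ] RPoly n where
  toFun p := ∑ i, pderiv i (pderiv i p)
  map_add' p q := by simp [Finset.sum_add_distrib]
  map_smul' c p := by simp [Finset.smul_sum]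

lemma flatLap_apply (p : RPoly n) : flatLap p = ∑ i, pderiv i (pderiv i p) := rfl

/-- A polynomial which agrees on the sphere with the spherical Laplacian of `p`. -/
def sphLap : RPoly n →ₗ[ℝ] RPoly n where
  toFun p := flatLap p - euler (euler p) - ((n : ℝ) - 2) • euler p
  map_add' p q := by simp only [map_add, smul_add]; abel
  map_smul' c p := by
    simp only [map_smul, Derivation.map_smul, smul_sub, smul_comm c, RingHom.id_apply]

lemma sphLap_apply (p : RPoly n) :
    sphLap p = flatLap p - euler (euler p) - ((n : ℝ) - 2) • euler p := rfl

lemma sphLap_of_isHomogeneous {p : RPoly n} {k : ℕ} (hp : p.IsHomogeneous k) :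
    sphLap p = flatLap p - ((k : ℝ) * (k + n - 2)) • p := by
  rw [sphLap_apply, euler_of_isHomogeneous hp, Derivation.map_smul, euler_of_isHomogeneous hp, sub_sub,
    smul_smul, smul_smul, ← add_smul]
  congr 2
  ring

/-- The Dirichlet form on the sphere. -/
def dirichlet (p q : RPoly n) : ℝ := ∫ x : Sph n, ⟪tgrad p x, tgrad q x⟫ ∂sphereMeasure n

lemma integrable_inner_tgrad (p q : RPoly n) :
    Integrable (fun x : Sph n => ⟪tgrad p x, tgrad q x⟫) (sphereMeasure n) :=
  integrable_sphere_of_continuous ((continuous_tgrad_sphere p).inner (continuous_tgrad_sphere q))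

lemma dirichlet_self_nonneg (p : RPoly n) : 0 ≤ dirichlet p p :=
  integral_nonneg fun _ => real_inner_self_nonneg

lemma dirichlet_comm (p q : RPoly n) : dirichlet p q = dirichlet q p := by
  simp only [dirichlet, real_inner_comm]

lemma dirichlet_add_left (p q r : RPoly n) :
    dirichlet (p + q) r = dirichlet p r + dirichlet q r := by
  simp only [dirichlet, tgrad_add, inner_add_left]
  exact integral_add (integrable_inner_tgrad _ _) (integrable_inner_tgrad _ _)

lemma dirichlet_add_right (p q r : RPoly n) :
    dirichlet p (q + r) = dirichlet p q + dirichlet p r := by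
  rw [dirichlet_comm, dirichlet_add_left, dirichlet_comm q, dirichlet_comm r]

lemma dirichlet_add_self (p q : RPoly n) :
    dirichlet (p + q) (p + q) = dirichlet p p + 2 * dirichlet p q + dirichlet q q := by
  rw [dirichlet_add_left, dirichlet_add_right, dirichlet_add_right, dirichlet_comm q p]
  ring

/-- Integration by parts against a polynomial field which is tangential on the sphere. -/
lemma integral_inner_tgrad_field (p : RPoly n) (Y : Fin n → RPoly n)
    (hY : ∀ x : Sph n, ∑ i, (x : Euc n) i * ev (Y i) x = 0) :
    ∫ x : Sph n, ∑ i, tgrad p x i * ev (Y i) x ∂sphereMeasure n =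
      -sInt (p * (∑ i, pderiv i (Y i) - ∑ i, X i * euler (Y i))) := by
  -- The divergence identity is applied to each `p Y_i`. In the sum, the terms with the radial
  -- derivative of `p` and with `n - 1` carry the factor `∑ x_i Y_i`, which vanishes on the sphere.
  have h1 : ∑ i, sInt (pderiv i (p * Y i)) =
      ∑ i, sInt (X i * (euler (p * Y i) + ((n : ℝ) - 1) • (p * Y i))) :=
    Finset.sum_congr rfl fun i _ => sInt_pderiv i _
  rw [← map_sum, ← map_sum] at h1
  have h2 : ∫ x : Sph n, ∑ i, tgrad p x i * ev (Y i) x ∂sphereMeasure n =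
      sInt (∑ i, pderiv i p * Y i) := by
    refine integral_congr_ae (.of_forall fun x => ?_)
    simp only [tgrad_apply, sub_mul, Finset.sum_sub_distrib, ev_sum, ev_mul, mul_assoc,
      ← Finset.mul_sum, hY, mul_zero, sub_zero]
  have h3 : sInt (∑ i, pderiv i (p * Y i)) =
      sInt (∑ i, pderiv i p * Y i) + sInt (p * ∑ i, pderiv i (Y i)) := by
    rw [← map_add]
    congr 1
    rw [Finset.mul_sum, ← Finset.sum_add_distrib]
    exact Finset.sum_congr rfl fun i _ => by rw [pderiv_mul]
  have h4 : sInt (∑ i, X i * (euler (p * Y i) + ((n : ℝ) - 1) • (p * Y i))) =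
      sInt (p * ∑ i, X i * euler (Y i)) := by
    refine sInt_congr fun x => ?_
    have e : ev (∑ i, X i * (euler (p * Y i) + ((n : ℝ) - 1) • (p * Y i))) x =
        ev p x * ∑ i, (x : Euc n) i * ev (euler (Y i)) x + (ev (euler p) x + (n - 1) * ev p x) *
          ∑ i, (x : Euc n) i * ev (Y i) x := by
      rw [Finset.mul_sum, Finset.mul_sum, ← Finset.sum_add_distrib]
      simp only [ev_sum, ev_mul, ev_add, ev_smul, ev_X, euler_mul]
      exact Finset.sum_congr rfl fun i _ => by ring
    rw [e, hY]
    simp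
  rw [h2, mul_sub, map_sub]
  linarith

lemma euler_pderiv (i : Fin n) (p : RPoly n) : euler (pderiv i p) = pderiv i (euler p) - pderiv i p := by
  induction p using MvPolynomial.induction_on with
  | C a => simp
  | add p q hp hq => simp only [map_add, hp, hq]; ring
  | mul_X p j hp =>
    simp only [pderiv_mul, euler_mul, map_add, hp, euler_X, pderiv_X, Pi.single_apply]
    split_ifs <;> simp <;> ring

lemma sum_X_mul_X_sphere (x : Sph n) : ev (∑ i, X i * X i : RPoly n) x = 1 := by
  simp [sum_coord_sq_sphere]

/-- The tangential divergence of the tangential gradient, for the polynomial representatives. -/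
lemma ev_tangDiv_tgrad (q : RPoly n) (x : Sph n) :
    ev (∑ i, pderiv i (pderiv i q - X i * euler q)
      - ∑ i, X i * euler (pderiv i q - X i * euler q)) x = ev (sphLap q) x := by
  have h1 : (∑ i, pderiv i (pderiv i q - X i * euler q) : RPoly n) =
      flatLap q - (n : ℝ) • euler q - euler (euler q) := by
    have e : ∀ i, (pderiv i (pderiv i q - X i * euler q) : RPoly n) =
        pderiv i (pderiv i q) - euler q - X i * pderiv i (euler q) := by
      intro i
      rw [map_sub, pderiv_mul, pderiv_X_self]
      ring
    simp only [e, Finset.sum_sub_distrib, ← euler_apply, ← flatLap_apply, Finset.sum_const,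
      Finset.card_univ, Fintype.card_fin, Nat.cast_smul_eq_nsmul]
  have h2 : (∑ i, X i * euler (pderiv i q - X i * euler q) : RPoly n) =
      euler (euler q) - euler q - (∑ i, X i * X i) * (euler q + euler (euler q)) := by
    have e : ∀ i, (X i * euler (pderiv i q - X i * euler q) : RPoly n) =
        X i * pderiv i (euler q) - X i * pderiv i q
          - X i * X i * (euler q + euler (euler q)) := by
      intro i
      rw [map_sub, euler_mul, euler_X, euler_pderiv]
      ring
    simp only [e, Finset.sum_sub_distrib, ← Finset.sum_mul, ← euler_apply]
  rw [h1, h2, sphLap_apply]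
  simp only [ev_sub, ev_smul, ev_mul, ev_add, sum_X_mul_X_sphere]
  ring

/-- Green's formula: on the sphere the tangential gradient of `q` has the polynomial components `∂_i
q - x_i (euler q)`, so integration by parts against a tangential polynomial field applies. -/
lemma dirichlet_eq (p q : RPoly n) : dirichlet p q = -sInt (p * sphLap q) := by
  have h := integral_inner_tgrad_field p (fun i => pderiv i q - X i * euler q) fun x => by
    have := inner_tgrad_sphere q x
    rw [inner_eq_sum] at this
    rw [← this]
    refine Finset.sum_congr rfl fun i _ => ?_
    simp [tgrad_apply]
    ring
  have e1 : dirichlet p q = ∫ x : Sph n, ∑ i, tgrad p x i *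
      ev (pderiv i q - X i * euler q) x ∂sphereMeasure n := by
    refine integral_congr_ae (.of_forall fun x => ?_)
    simp only [inner_eq_sum]
    refine Finset.sum_congr rfl fun i _ => ?_
    simp only [tgrad_apply, ev_sub, ev_mul, ev_X]
    ring
  rw [e1, h]
  congr 1
  exact sInt_congr fun x => by rw [ev_mul, ev_tangDiv_tgrad, ev_mul]

end PolynomialCalculus

/-! ### The Poincaré inequality for polynomials -/

section Poincare

open MvPolynomial

variable {n : ℕ}

/-- Polynomials of degree at most `N`. -/
abbrev polyLE (n N : ℕ) : Submodule ℝ (RPoly n) := restrictTotalDegree (Fin n) ℝ N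

lemma polyLE_mono {N M : ℕ} (h : N ≤ M) : polyLE n N ≤ polyLE n M := fun p hp => by
  rw [mem_restrictTotalDegree] at hp ⊢
  exact hp.trans h

lemma isHomogeneous_mem_polyLE {p : RPoly n} {k N : ℕ} (hp : p.IsHomogeneous k) (hk : k ≤ N) :
    p ∈ polyLE n N := by
  rw [mem_restrictTotalDegree]
  exact hp.totalDegree_le.trans hk

lemma exists_mem_polyLE (p : RPoly n) : ∃ N, p ∈ polyLE n N :=
  ⟨_, (mem_restrictTotalDegree _ _ _).2 le_rfl⟩

lemma sub_homogeneousComponent_mem {p : RPoly n} {N : ℕ} (hp : p ∈ polyLE n (N + 1)) :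
    p - homogeneousComponent (N + 1) p ∈ polyLE n N := by
  rw [mem_restrictTotalDegree] at hp ⊢
  refine Finset.sup_le fun d hd => ?_
  rw [mem_support_iff, coeff_sub, coeff_homogeneousComponent] at hd
  by_contra hlt
  have hdeg : d.degree = d.sum fun _ e => e := rfl
  have h2 : p.coeff d ≠ 0 := by
    intro h0
    simp [h0] at hd
  have h3 := le_totalDegree (mem_support_iff.2 h2)
  have h4 : d.degree = N + 1 := by omega
  simp [h4] at hd

lemma isHomogeneous_flatLap {p : RPoly n} {k : ℕ} (hp : p.IsHomogeneous k) :
    (flatLap p).IsHomogeneous (k - 1 - 1) := by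
  rw [flatLap_apply]
  exact IsHomogeneous.sum _ _ _ fun i _ => hp.pderiv.pderiv

lemma sphLap_C (c : ℝ) : sphLap (C c : RPoly n) = 0 := by
  simp [sphLap_apply, flatLap_apply]

lemma mem_polyLE_zero {p : RPoly n} (hp : p ∈ polyLE n 0) : ∃ c, p = C c := by
  rw [mem_restrictTotalDegree, Nat.le_zero] at hp
  exact ⟨_, totalDegree_eq_zero_iff_eq_C.1 hp⟩

mutual
-- On the top homogeneous component the spherical Laplacian is a scalar plus the flat Laplacian,
-- which drops the degree. Thus it is triangular for the degree filtration, with diagonal `-k (k + n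
-- - 2)`. The induction runs jointly with the invariance of `polyLE n N`.
lemma sphLap_add_smul_mem {N : ℕ} {p : RPoly n} (hp : p ∈ polyLE n (N + 1)) :
    sphLap p + (((N + 1 : ℕ) : ℝ) * ((N + 1 : ℕ) + n - 2)) • p ∈ polyLE n N := by
  have hhom := homogeneousComponent_isHomogeneous (N + 1) p
  have hlow := sub_homogeneousComponent_mem hp
  set t := homogeneousComponent (N + 1) p
  have e : sphLap p + (((N + 1 : ℕ) : ℝ) * ((N + 1 : ℕ) + n - 2)) • p =
      flatLap t + sphLap (p - t) + (((N + 1 : ℕ) : ℝ) * ((N + 1 : ℕ) + n - 2)) • (p - t) := by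
    rw [map_sub, sphLap_of_isHomogeneous hhom, smul_sub]
    abel
  rw [e]
  exact add_mem (add_mem (isHomogeneous_mem_polyLE (isHomogeneous_flatLap hhom) (by omega))
    (sphLap_mem hlow)) (Submodule.smul_mem _ _ hlow)

lemma sphLap_mem {N : ℕ} {p : RPoly n} (hp : p ∈ polyLE n N) : sphLap p ∈ polyLE n N := by
  cases N with
  | zero =>
    obtain ⟨c, rfl⟩ := mem_polyLE_zero hp
    rw [sphLap_C]
    exact zero_mem _
  | succ N =>
    have h := polyLE_mono (Nat.le_succ N) (sphLap_add_smul_mem hp)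
    have := sub_mem h (Submodule.smul_mem _ (((N + 1 : ℕ) : ℝ) * ((N + 1 : ℕ) + n - 2)) hp)
    rwa [add_sub_cancel_right] at this
end

/-- The class of a polynomial in `L²` of the sphere. -/
def toL2 : RPoly n →ₗ[ℝ] Lp ℝ 2 (sphereMeasure n) where
  toFun p := (memLp_sphere_of_continuous (continuous_ev_sphere p)).toLp
  map_add' p q := by
    rw [← MemLp.toLp_add]
    exact MemLp.toLp_congr _ _ (.of_forall fun x => ev_add p q x)
  map_smul' c p := by
    rw [RingHom.id_apply, ← MemLp.toLp_const_smul]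
    exact MemLp.toLp_congr _ _ (.of_forall fun x => ev_smul c p x)

lemma inner_toL2 (p q : RPoly n) : ⟪toL2 p, toL2 q⟫ = sInt (p * q) := by
  rw [L2.inner_def]
  refine integral_congr_ae ?_
  filter_upwards [(memLp_sphere_of_continuous (continuous_ev_sphere p)).coeFn_toLp,
    (memLp_sphere_of_continuous (continuous_ev_sphere q)).coeFn_toLp] with x h1 h2
  have h1' : toL2 p x = ev p x := h1
  have h2' : toL2 q x = ev q x := h2
  rw [h1', h2', ev_mul, mul_comm]
  rfl

/-- Orthogonal decomposition of a polynomial with respect to the polynomials of degree `≤ N`. -/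
lemma exists_orthogonal_decomposition (N : ℕ) (p : RPoly n) :
    ∃ q ∈ polyLE n N, ∀ s ∈ polyLE n N, sInt ((p - q) * s) = 0 := by
  -- The projection is taken in `L²`. Since `toL2` kills multiples of `|x|² - 1`, the polynomial `q`
  -- is merely some representative of the projection.
  have : FiniteDimensional ℝ ((polyLE n N).map toL2) := inferInstance
  obtain ⟨q, hq, hq'⟩ := ((polyLE n N).map toL2).starProjection_apply_mem (toL2 p)
  refine ⟨q, hq, fun s hs => ?_⟩
  rw [← inner_toL2, map_sub, hq']
  exact ((polyLE n N).map toL2).starProjection_inner_eq_zero _ _ ⟨s, hs, rfl⟩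

lemma eigenvalue_mono {a b : ℕ} (hn : 2 ≤ n) (h : a ≤ b) :
    (a : ℝ) * (a + n - 2) ≤ (b : ℝ) * (b + n - 2) := by
  have h1 : (a : ℝ) ≤ b := by exact_mod_cast h
  have h2 : (2 : ℝ) ≤ n := by exact_mod_cast hn
  have h3 : (0 : ℝ) ≤ a := a.cast_nonneg
  exact mul_le_mul h1 (by linarith) (by linarith) (by linarith)

/-- The Poincaré inequality for polynomials which are orthogonal to all polynomials of degree
at most `K`. -/
lemma poincare_of_mem (hn : 2 ≤ n) (K : ℕ) (N : ℕ) {p : RPoly n} (hp : p ∈ polyLE n N)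
    (horth : ∀ s ∈ polyLE n K, sInt (p * s) = 0) :
    (((K + 1 : ℕ) : ℝ) * ((K + 1 : ℕ) + n - 2)) * sInt (p * p) ≤ dirichlet p p := by
  induction N generalizing p with
  | zero =>
    rw [horth p (polyLE_mono (Nat.zero_le _) hp), mul_zero]
    exact dirichlet_self_nonneg p
  | succ N ih =>
    -- If `N + 1 ≤ K`, then `p` is one of its own test polynomials, so `∫ p² = 0`.
    rcases lt_or_ge N K with hNK | hNK
    · rw [horth p (polyLE_mono hNK hp), mul_zero]
      exact dirichlet_self_nonneg p
    obtain ⟨q, hq, hr⟩ := exists_orthogonal_decomposition N p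
    set r := p - q with hrdef
    have hpqr : p = q + r := by rw [hrdef]; abel
    have hr1 : r ∈ polyLE n (N + 1) := sub_mem hp (polyLE_mono (Nat.le_succ N) hq)
    have hqo : ∀ s ∈ polyLE n K, sInt (q * s) = 0 := by
      intro s hs
      have h1 := horth s hs
      rw [hpqr, add_mul, map_add, hr s (polyLE_mono hNK hs), add_zero] at h1
      exact h1
    have ihq := ih hq hqo
    -- By triangularity `sphLap r + λ r` has degree at most `N`, hence is orthogonal to `r`: the top
    -- layer behaves like an exact eigenfunction in the energy. Likewise `r` is Dirichlet orthogonal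
    -- to `q`.
    have hrr : dirichlet r r = (((N + 1 : ℕ) : ℝ) * ((N + 1 : ℕ) + n - 2)) * sInt (r * r) := by
      have h1 := hr _ (sphLap_add_smul_mem hr1)
      rw [mul_add, map_add, mul_smul_comm, map_smul, smul_eq_mul] at h1
      rw [dirichlet_eq]
      linarith
    have hrq : dirichlet r q = 0 := by
      rw [dirichlet_eq, hr _ (sphLap_mem hq), neg_zero]
    have hB : dirichlet p p = dirichlet q q + dirichlet r r := by
      rw [hpqr, dirichlet_add_left, dirichlet_add_right, dirichlet_add_right, hrq,
        dirichlet_comm q r, hrq]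
      ring
    have hI : sInt (p * p) = sInt (q * q) + sInt (r * r) := by
      have e : p * p = q * q + r * r + 2 • (r * q) := by rw [hpqr]; ring
      rw [e, map_add, map_add, map_nsmul, hr q hq]
      simp
    rw [hB, hI, hrr, mul_add]
    exact add_le_add ihq (mul_le_mul_of_nonneg_right (eigenvalue_mono hn (by omega))
      (sInt_mul_self_nonneg r))

lemma poincare (hn : 2 ≤ n) (K : ℕ) {p : RPoly n}
    (horth : ∀ s ∈ polyLE n K, sInt (p * s) = 0) :
    (((K + 1 : ℕ) : ℝ) * ((K + 1 : ℕ) + n - 2)) * sInt (p * p) ≤ dirichlet p p := by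
  obtain ⟨N, hN⟩ := exists_mem_polyLE p
  exact poincare_of_mem hn K N hN horth

lemma exists_coeff_of_isHomogeneous_one {p : RPoly n} (hp : p.IsHomogeneous 1) :
    ∃ c : Fin n → ℝ, p = ∑ i, c i • X i := by
  have h : p ∈ homogeneousSubmodule (Fin n) ℝ 1 := hp
  rw [homogeneousSubmodule_one_eq_span_X, Submodule.mem_span_range_iff_exists_fun] at h
  exact h.imp fun c hc => hc.symm

/-- Orthogonality to `1` and to the coordinates implies orthogonality to all polynomials of
degree at most one. -/
lemma orthogonal_polyLE_one {p : RPoly n} (h0 : sInt p = 0) (h1 : ∀ i, sInt (p * X i) = 0) :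
    ∀ s ∈ polyLE n 1, sInt (p * s) = 0 := by
  intro s hs
  obtain ⟨c, hc⟩ := mem_polyLE_zero (sub_homogeneousComponent_mem (N := 0) hs)
  obtain ⟨a, ha⟩ := exists_coeff_of_isHomogeneous_one (homogeneousComponent_isHomogeneous 1 s)
  have : s = c • 1 + ∑ i, a i • X i := by
    rw [← ha, smul_eq_C_mul, mul_one, ← hc]
    abel
  rw [this, mul_add, Finset.mul_sum, map_add, map_sum]
  simp [h0, h1]

lemma orthogonal_polyLE_zero {p : RPoly n} (h0 : sInt p = 0) :
    ∀ s ∈ polyLE n 0, sInt (p * s) = 0 := by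
  intro s hs
  obtain ⟨c, rfl⟩ := mem_polyLE_zero hs
  rw [mul_comm, ← smul_eq_C_mul, map_smul, h0, smul_zero]

end Poincare

/-! ### Low order moments and the decoupling of the quadratic form -/

section Decoupling

open MvPolynomial

variable {n : ℕ}

/-- The linear form with coefficients `a`. -/
def lin (a : Fin n → ℝ) : RPoly n := ∑ i, a i • X i

@[simp] lemma ev_lin (a : Fin n → ℝ) (x : Euc n) : ev (lin a) x = ∑ i, a i * x i := by
  simp [lin]

lemma isHomogeneous_lin (a : Fin n → ℝ) : (lin a).IsHomogeneous 1 :=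
  IsHomogeneous.sum _ _ _ fun i _ => by
    rw [smul_eq_C_mul]
    exact isHomogeneous_C_mul_X _ _

lemma pderiv_lin (a : Fin n → ℝ) (i : Fin n) : pderiv i (lin a) = C (a i) := by
  simp only [lin, map_sum, Derivation.map_smul, pderiv_X]
  rw [Finset.sum_eq_single i]
  · simp [smul_eq_C_mul]
  · intro b _ hb
    simp [hb]
  · simp

@[simp] lemma euler_lin (a : Fin n → ℝ) : euler (lin a) = lin a := by
  rw [euler_of_isHomogeneous (isHomogeneous_lin a)]
  simp

@[simp] lemma flatLap_lin (a : Fin n → ℝ) : flatLap (lin a) = 0 := by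
  simp [flatLap_apply, pderiv_lin]

lemma sphLap_lin (a : Fin n → ℝ) : sphLap (lin a) = -(((n : ℝ) - 1) • lin a) := by
  rw [sphLap_of_isHomogeneous (isHomogeneous_lin a), flatLap_lin, zero_sub]
  congr 2
  push_cast
  ring

lemma lin_smul (c : ℝ) (a : Fin n → ℝ) : lin (c • a) = c • lin a := by
  simp [lin, Finset.smul_sum, smul_smul]

lemma lin_add (a b : Fin n → ℝ) : lin (a + b) = lin a + lin b := by
  simp [lin, add_smul, Finset.sum_add_distrib]

lemma lin_sub (a b : Fin n → ℝ) : lin (a - b) = lin a - lin b := by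
  simp [lin, sub_smul, Finset.sum_sub_distrib]

lemma sInt_X (hn : 2 ≤ n) (i : Fin n) : sInt (X i : RPoly n) = 0 := by
  have h := sInt_X_mul_of_isHomogeneous i (isHomogeneous_one (Fin n) ℝ)
  have h2 : (2 : ℝ) ≤ n := by exact_mod_cast hn
  rw [mul_one, pderiv_one, map_zero] at h
  exact (mul_eq_zero.1 h).resolve_left (by push_cast; linarith)

lemma sInt_X_mul_X (hn : 2 ≤ n) (i j : Fin n) :
    sInt (X i * X j : RPoly n) = if i = j then 1 / (n : ℝ) else 0 := by
  have h := sInt_X_mul_of_isHomogeneous i (isHomogeneous_X ℝ j)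
  have h2 : (2 : ℝ) ≤ n := by exact_mod_cast hn
  rw [pderiv_X] at h
  by_cases hij : i = j
  · subst hij
    rw [Pi.single_eq_same, sInt_one (by omega)] at h
    rw [if_pos rfl, eq_div_iff (by linarith), ← h]
    push_cast
    ring
  · rw [Pi.single_eq_of_ne (Ne.symm hij), map_zero] at h
    rw [if_neg hij]
    exact (mul_eq_zero.1 h).resolve_left (by push_cast; linarith)

lemma sInt_X_mul_X_mul_X (hn : 2 ≤ n) (i j k : Fin n) :
    sInt (X i * (X j * X k) : RPoly n) = 0 := by
  have h := sInt_X_mul_of_isHomogeneous i ((isHomogeneous_X ℝ j).mul (isHomogeneous_X ℝ k))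
  have h2 : (2 : ℝ) ≤ n := by exact_mod_cast hn
  have h3 : sInt (pderiv i (X j * X k) : RPoly n) = 0 := by
    rw [pderiv_mul, pderiv_X, pderiv_X, map_add]
    simp only [Pi.single_apply]
    split_ifs <;> simp [sInt_X hn]
  rw [h3] at h
  exact (mul_eq_zero.1 h).resolve_left (by push_cast; linarith)

lemma sInt_lin (hn : 2 ≤ n) (a : Fin n → ℝ) : sInt (lin a) = 0 := by
  simp [lin, sInt_X hn]

lemma sInt_lin_mul_X (hn : 2 ≤ n) (a : Fin n → ℝ) (i : Fin n) :
    sInt (lin a * X i) = a i / n := by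
  simp [lin, Finset.sum_mul, sInt_X_mul_X hn, div_eq_mul_inv]

lemma sInt_X_mul_lin (hn : 2 ≤ n) (a : Fin n → ℝ) (i : Fin n) :
    sInt (X i * lin a) = a i / n := by
  rw [mul_comm, sInt_lin_mul_X hn]

lemma sInt_lin_mul_lin (hn : 2 ≤ n) (a b : Fin n → ℝ) :
    sInt (lin a * lin b) = (∑ i, a i * b i) / n := by
  conv_lhs => rw [lin, Finset.sum_mul, map_sum]
  rw [Finset.sum_div]
  refine Finset.sum_congr rfl fun i _ => ?_
  rw [smul_mul_assoc, map_smul, sInt_X_mul_lin hn, smul_eq_mul, mul_div_assoc]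

lemma sInt_X_mul_lin_mul_X (hn : 2 ≤ n) (a : Fin n → ℝ) (i j : Fin n) :
    sInt (X i * lin a * X j) = 0 := by
  have : (X i * lin a * X j : RPoly n) = ∑ k, a k • (X i * (X j * X k)) := by
    rw [lin, Finset.mul_sum, Finset.sum_mul]
    refine Finset.sum_congr rfl fun k _ => ?_
    rw [mul_smul_comm, smul_mul_assoc]
    congr 1
    ring
  rw [this]
  simp [sInt_X_mul_X_mul_X hn]

lemma tgrad_lin (a : Fin n → ℝ) (x : Euc n) :
    tgrad (lin a) x = WithLp.toLp 2 a - (∑ i, a i * x i) • x := by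
  ext j
  simp [tgrad_apply, pderiv_lin]

/-- The vector field on `ℝⁿ` with polynomial components. -/
def evVec (w : Fin n → RPoly n) (x : Euc n) : Euc n := WithLp.toLp 2 fun j => ev (w j) x

@[simp] lemma evVec_apply (w : Fin n → RPoly n) (x : Euc n) (j : Fin n) :
    evVec w x j = ev (w j) x := rfl

/-- A polynomial which represents the tangential divergence on the sphere. -/
def tDiv (w : Fin n → RPoly n) : RPoly n := ∑ i, pderiv i (w i) - ∑ i, X i * euler (w i)

lemma ev_tDiv (w : Fin n → RPoly n) (x : Euc n) : ev (tDiv w) x = ∑ j, tgrad (w j) x j := by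
  simp only [tDiv, ev_sub, ev_sum, tgrad_apply, ev_mul, ev_X, Finset.sum_sub_distrib]
  congr 1
  exact Finset.sum_congr rfl fun i _ => mul_comm _ _

/-- The operator `A` on polynomial fields. -/
def evA (w : Fin n → RPoly n) (x : Euc n) : Euc n :=
  (∑ j, tgrad (w j) x j) • x - ∑ j, x j • tgrad (w j) x

/-- The integrand of the quadratic form, up to the factor `n / (2 (n - 1))`. -/
def energyDensity (w : Fin n → RPoly n) (x : Euc n) : ℝ :=
  ∑ j, ⟪tgrad (w j) x, tgrad (w j) x⟫
    + ((n : ℝ) - 3) / ((n : ℝ) - 1) * (∑ j, tgrad (w j) x j) ^ 2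
    - ((n : ℝ) - 1) * ⟪evVec w x, evA w x⟫

/-- The decoupling into normal and tangential parts, pointwise. -/
lemma energyDensity_decouple (hn : 2 ≤ n) {w Y : Fin n → RPoly n} {f h : RPoly n}
    (hw : ∀ j, w j = Y j + X j * f) (hY : ∑ j, X j * Y j = (1 - ∑ j, X j * X j) * h) (x : Sph n) :
    energyDensity w x = (∑ j, ⟪tgrad (Y j) x, tgrad (Y j) x⟫
        + ((n : ℝ) - 3) / ((n : ℝ) - 1) * (ev (tDiv Y) x) ^ 2
        - ((n : ℝ) - 1) * ∑ j, ev (Y j) x * ev (Y j) x)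
      + (⟪tgrad f x, tgrad f x⟫ - ((n : ℝ) - 1) * (ev f x * ev f x))
      + ((n : ℝ) - 3) * (ev f x * ev (tDiv Y) x + ∑ i, tgrad f x i * ev (Y i) x) := by
  have h2 : (2 : ℝ) ≤ n := by exact_mod_cast hn
  have hm : (n : ℝ) - 1 ≠ 0 := by linarith
  set G := tgrad f (x : Euc n) with hG
  set a : Fin n → Euc n := fun j => tgrad (Y j) (x : Euc n) with ha
  set φ := ev f (x : Euc n)
  set y : Euc n := evVec Y x with hy
  have hGx : ⟪G, (x : Euc n)⟫ = 0 := inner_tgrad_sphere f x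
  have hax : ∀ j, ⟪a j, (x : Euc n)⟫ = 0 := fun j => inner_tgrad_sphere (Y j) x
  have hyx : ⟪y, (x : Euc n)⟫ = 0 := by
    have := congrArg (fun p => ev p (x : Euc n)) hY
    rw [inner_eq_sum]
    simp only [ev_sum, ev_mul, ev_X, ev_sub, ev_one, sum_coord_sq_sphere, sub_self, zero_mul]
      at this
    rw [← this]
    exact Finset.sum_congr rfl fun i _ => mul_comm _ _
  have hxx : ⟪(x : Euc n), (x : Euc n)⟫ = 1 := inner_self_sphere x
  have hxsum : ∑ j, (x : Euc n) j • EuclideanSpace.single j (1 : ℝ) = (x : Euc n) :=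
    sum_coord_smul_single _
  have htX : ∑ j, (x : Euc n) j • tgrad (X j) (x : Euc n) = 0 := by
    simp only [tgrad_X, smul_sub, Finset.sum_sub_distrib, hxsum, smul_smul, ← Finset.sum_smul,
      sum_coord_sq_sphere, one_smul, sub_self]
  -- The tangential derivative of `⟨x, Y⟩ = 0` reads `∑ x_j ∇Y_j + Y = 0` on the sphere. The right
  -- side of `hY` drops out because both `1 - |x|²` and its tangential gradient vanish there.
  have hax' : ∑ j, (x : Euc n) j • a j = -y := by
    have h1 := congrArg (fun p => tgrad p (x : Euc n)) hY
    have h3 : tgrad (1 - ∑ j, X j * X j : RPoly n) (x : Euc n) = 0 := by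
      simp only [tgrad_sub, tgrad_one, tgrad_sum, tgrad_mul, ev_X, Finset.sum_add_distrib, htX]
      simp
    simp only [tgrad_sum, tgrad_mul, h3, smul_zero, ev_sub, ev_one, sum_X_mul_X_sphere, sub_self,
      zero_smul, add_zero, ev_X, Finset.sum_add_distrib] at h1
    rw [eq_neg_iff_add_eq_zero]
    refine Eq.trans ?_ h1
    congr 1
    simp only [tgrad_X, smul_sub, Finset.sum_sub_distrib, smul_smul, ← Finset.sum_smul]
    have e1 : ∑ j, ev (Y j) (x : Euc n) • EuclideanSpace.single j (1 : ℝ) = y :=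
      sum_coord_smul_single y
    have e2 : ∑ j, ev (Y j) (x : Euc n) * (x : Euc n) j = 0 := by
      rw [← hyx, inner_eq_sum]
      rfl
    rw [e1, e2, zero_smul, sub_zero]
  have htw : ∀ j, tgrad (w j) (x : Euc n) = a j + φ • EuclideanSpace.single j 1
      - (φ * (x : Euc n) j) • (x : Euc n) + (x : Euc n) j • G := by
    intro j
    rw [hw, tgrad_add, tgrad_mul, tgrad_X, ev_X, smul_sub, smul_smul]
    abel
  have hes : ∀ (j : Fin n) (v : Euc n), ⟪v, EuclideanSpace.single j (1 : ℝ)⟫ = v j := by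
    intro j v
    simp [EuclideanSpace.inner_single_right]
  have hes' : ∀ (j : Fin n) (v : Euc n), ⟪EuclideanSpace.single j (1 : ℝ), v⟫ = v j := by
    intro j v
    simp [EuclideanSpace.inner_single_left]
  have hxG : ⟪(x : Euc n), G⟫ = 0 := by rw [real_inner_comm, hGx]
  have hxa : ∀ j, ⟪(x : Euc n), a j⟫ = 0 := fun j => by rw [real_inner_comm, hax]
  have hGxs : ∑ j, (x : Euc n) j * G j = 0 := by rw [← inner_eq_sum, hxG]
  have haG : ∑ j, (x : Euc n) j * ⟪a j, G⟫ = -⟪y, G⟫ := by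
    rw [← inner_neg_left, ← hax', sum_inner]
    simp only [real_inner_smul_left]
  set δ := ev (tDiv Y) (x : Euc n) with hδ
  have hδ' : ∑ j, a j j = δ := (ev_tDiv Y x).symm
  have hnorm : ∑ j, ⟪tgrad (w j) (x : Euc n), tgrad (w j) (x : Euc n)⟫ =
      ∑ j, ⟪a j, a j⟫ + ⟪G, G⟫ + ((n : ℝ) - 1) * φ ^ 2 - 2 * ⟪y, G⟫ + 2 * φ * δ := by
    have e : ∀ j, ⟪tgrad (w j) (x : Euc n), tgrad (w j) (x : Euc n)⟫ =
        ⟪a j, a j⟫ + (x : Euc n) j * (x : Euc n) j * (⟪G, G⟫ - φ ^ 2) + φ ^ 2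
          + 2 * ((x : Euc n) j * ⟪a j, G⟫) + 2 * φ * a j j
          + 2 * φ * ((x : Euc n) j * G j) := by
      intro j
      rw [htw]
      simp only [inner_add_left, inner_add_right, inner_sub_left, inner_sub_right,
        real_inner_smul_left, real_inner_smul_right, hes, hes', hxx, hax, hxa, hGx, hxG,
        real_inner_comm (a j) G]
      simp
      ring
    simp only [e, Finset.sum_add_distrib, ← Finset.mul_sum, ← Finset.sum_mul,
      sum_coord_sq_sphere, haG, hδ', hGxs, Finset.sum_const, Finset.card_univ, Fintype.card_fin,
      nsmul_eq_mul]
    ring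
  have hdiv : ∑ j, tgrad (w j) (x : Euc n) j = δ + ((n : ℝ) - 1) * φ := by
    have e : ∀ j, tgrad (w j) (x : Euc n) j =
        a j j + φ - φ * ((x : Euc n) j * (x : Euc n) j) + (x : Euc n) j * G j := by
      intro j
      rw [htw]
      simp
      ring
    simp only [e, Finset.sum_add_distrib, Finset.sum_sub_distrib, ← Finset.mul_sum,
      sum_coord_sq_sphere, hδ', hGxs, Finset.sum_const, Finset.card_univ, Fintype.card_fin,
      nsmul_eq_mul]
    ring
  have hsum : ∑ j, (x : Euc n) j • tgrad (w j) (x : Euc n) = G - y := by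
    have e : ∀ j, (x : Euc n) j • tgrad (w j) (x : Euc n) = (x : Euc n) j • a j
        + φ • ((x : Euc n) j • EuclideanSpace.single j (1 : ℝ))
        - ((x : Euc n) j * (x : Euc n) j) • (φ • (x : Euc n))
        + ((x : Euc n) j * (x : Euc n) j) • G := by
      intro j
      rw [htw]
      module
    simp only [e, Finset.sum_add_distrib, Finset.sum_sub_distrib, ← Finset.smul_sum,
      ← Finset.sum_smul, sum_coord_sq_sphere, hax', hxsum]
    module
  have hvec : evVec w x = y + φ • (x : Euc n) := by
    ext j
    simp [hw, hy, φ]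
    ring
  have hyy : ∑ j, ev (Y j) (x : Euc n) * ev (Y j) (x : Euc n) = ⟪y, y⟫ := by
    rw [inner_eq_sum]
    rfl
  have hGy : ∑ i, G i * ev (Y i) (x : Euc n) = ⟪y, G⟫ := by
    rw [real_inner_comm, inner_eq_sum]
    rfl
  have hA : ⟪evVec w x, evA w x⟫ = φ * δ + ((n : ℝ) - 1) * φ ^ 2 + ⟪y, y⟫ - ⟪y, G⟫ := by
    rw [evA, hdiv, hsum, hvec]
    simp only [inner_add_left, inner_sub_right, real_inner_smul_left,
      real_inner_smul_right, hyx, hxx, hxG, real_inner_comm y (x : Euc n)]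
    ring
  rw [energyDensity, hnorm, hdiv, hA, hyy, hGy]
  field_simp
  ring

/-- The decoupling of the quadratic form into the energies of the normal and tangential parts. -/
lemma integral_energyDensity (hn : 2 ≤ n) {w Y : Fin n → RPoly n} {f h : RPoly n}
    (hw : ∀ j, w j = Y j + X j * f) (hY : ∑ j, X j * Y j = (1 - ∑ j, X j * X j) * h) :
    ∫ x : Sph n, energyDensity w x ∂sphereMeasure n =
      (∑ j, (dirichlet (Y j) (Y j) - ((n : ℝ) - 1) * sInt (Y j * Y j))
        + ((n : ℝ) - 3) / ((n : ℝ) - 1) * sInt (tDiv Y * tDiv Y))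
      + (dirichlet f f - ((n : ℝ) - 1) * sInt (f * f)) := by
  have hYx : ∀ x : Sph n, ∑ i, (x : Euc n) i * ev (Y i) x = 0 := fun x => by
    have := congrArg (fun p => ev p (x : Euc n)) hY
    simpa [sum_coord_sq_sphere] using this
  -- This removes the cross term: `f div Y + ⟨∇f, Y⟩` is the divergence of the tangential field `f
  -- Y`.
  have hibp := integral_inner_tgrad_field f Y hYx
  have hi1 : ∀ j, Integrable (fun x : Sph n => ⟪tgrad (Y j) x, tgrad (Y j) x⟫)
      (sphereMeasure n) := fun j => integrable_inner_tgrad _ _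
  have hi2 : ∀ p : RPoly n, Integrable (fun x : Sph n => ev p x) (sphereMeasure n) := fun p =>
    integrable_sphere_of_continuous (continuous_ev_sphere p)
  have hi3 : Integrable (fun x : Sph n => ∑ i, tgrad f x i * ev (Y i) x) (sphereMeasure n) := by
    refine integrable_sphere_of_continuous (continuous_finsetSum _ fun i _ => Continuous.mul ?_
      (continuous_ev_sphere _))
    exact (EuclideanSpace.proj (𝕜 := ℝ) i).continuous.comp (continuous_tgrad_sphere f)
  have e : ∀ x : Sph n, energyDensity w x = (∑ j, ⟪tgrad (Y j) x, tgrad (Y j) x⟫ +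
      ⟪tgrad f x, tgrad f x⟫) + (((n : ℝ) - 3) * ∑ i, tgrad f x i * ev (Y i) x) +
      ev ((((n : ℝ) - 3) / ((n : ℝ) - 1)) • (tDiv Y * tDiv Y)
        - ((n : ℝ) - 1) • ∑ j, Y j * Y j - ((n : ℝ) - 1) • (f * f)
        + ((n : ℝ) - 3) • (f * tDiv Y)) (x : Euc n) := by
    intro x
    rw [energyDensity_decouple hn hw hY x]
    simp only [ev_add, ev_sub, ev_smul, ev_sum, ev_mul]
    ring
  simp only [e]
  rw [integral_add _ (hi2 _), integral_add _ (hi3.const_mul _), integral_add _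
    (integrable_inner_tgrad _ _), integral_finsetSum _ fun j _ => hi1 j, integral_const_mul, hibp,
    ← sInt_apply]
  · simp only [map_add, map_sub, map_smul, map_sum, smul_eq_mul, Finset.sum_sub_distrib,
      ← Finset.mul_sum]
    simp only [dirichlet, tDiv]
    ring
  · exact integrable_finsetSum _ fun j _ => hi1 j
  · exact (integrable_finsetSum _ fun j _ => hi1 j).add (integrable_inner_tgrad _ _)
  · exact ((integrable_finsetSum _ fun j _ => hi1 j).add (integrable_inner_tgrad _ _)).add
      (hi3.const_mul _)

end Decoupling

/-! ### The energy of tangential fields -/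

section TangentialEnergy

open MvPolynomial

variable {n : ℕ}

/-- The gradient field of a linear function on the sphere, normalized to have average `c`. -/
def conformalPart (c : Fin n → ℝ) (j : Fin n) : RPoly n :=
  ((n : ℝ) / ((n : ℝ) - 1)) • (C (c j) - X j * lin c)

lemma isHomogeneous_X_mul_lin (c : Fin n → ℝ) (j : Fin n) : (X j * lin c).IsHomogeneous 2 :=
  (isHomogeneous_X ℝ j).mul (isHomogeneous_lin c)

lemma flatLap_X_mul_lin (c : Fin n → ℝ) (j : Fin n) : flatLap (X j * lin c) = C (2 * c j) := by
  have h : ∀ i : Fin n, pderiv i (pderiv i (X j * lin c)) = if j = i then C (2 * c j) else 0 := by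
    intro i
    rw [pderiv_mul, pderiv_lin, pderiv_X, map_add, pderiv_mul, pderiv_mul, pderiv_lin, pderiv_X]
    by_cases hij : j = i
    · subst hij
      simp [two_mul]
    · simp [hij]
  rw [flatLap_apply, Finset.sum_congr rfl fun i _ => h i, Finset.sum_ite_eq,
    if_pos (Finset.mem_univ _)]

lemma sphLap_X_mul_lin (c : Fin n → ℝ) (j : Fin n) :
    sphLap (X j * lin c) = C (2 * c j) - (2 * (n : ℝ)) • (X j * lin c) := by
  rw [sphLap_of_isHomogeneous (isHomogeneous_X_mul_lin c j), flatLap_X_mul_lin]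
  congr 2
  push_cast
  ring

/-- On the sphere `x_j ⟨c, x⟩ - c_j / n` is a spherical harmonic of order two, so the deviation of
the conformal field from its mean has eigenvalue `2n`. -/
lemma sphLap_conformalPart (hn : 2 ≤ n) (c : Fin n → ℝ) (j : Fin n) :
    sphLap (conformalPart c j) = -((2 * (n : ℝ)) • (conformalPart c j - C (c j))) := by
  have h2 : (2 : ℝ) ≤ n := by exact_mod_cast hn
  have hm : (n : ℝ) - 1 ≠ 0 := by linarith
  rw [conformalPart, map_smul, map_sub, sphLap_C, sphLap_X_mul_lin]
  have e1 : (C (2 * c j) : RPoly n) = (2 : ℝ) • C (c j) := by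
    rw [C_mul, smul_eq_C_mul]
  rw [e1]
  match_scalars
  · field_simp
    ring
  · field_simp

lemma sum_coord_conformalPart (c : Fin n → ℝ) (x : Sph n) :
    ∑ j, (x : Euc n) j * ev (conformalPart c j) x = 0 := by
  have h : ∀ j, (x : Euc n) j * ev (conformalPart c j) x =
      (n : ℝ) / (n - 1) * (c j * (x : Euc n) j
        - (x : Euc n) j * (x : Euc n) j * ∑ i, c i * (x : Euc n) i) := by
    intro j
    simp only [conformalPart, ev_smul, ev_sub, ev_C, ev_mul, ev_X, ev_lin]
    ring
  simp only [h, ← Finset.mul_sum, Finset.sum_sub_distrib, ← Finset.sum_mul, sum_coord_sq_sphere]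
  ring

lemma sInt_conformalPart (hn : 2 ≤ n) (c : Fin n → ℝ) (j : Fin n) :
    sInt (conformalPart c j) = c j := by
  have h2 : (2 : ℝ) ≤ n := by exact_mod_cast hn
  have hm : (n : ℝ) - 1 ≠ 0 := by linarith
  have hn0 : (n : ℝ) ≠ 0 := by linarith
  rw [conformalPart, map_smul, map_sub, sInt_C (by omega), sInt_X_mul_lin hn, smul_eq_mul]
  field_simp

lemma sInt_conformalPart_mul_X (hn : 2 ≤ n) (c : Fin n → ℝ) (i j : Fin n) :
    sInt (conformalPart c j * X i) = 0 := by
  rw [conformalPart, smul_mul_assoc, map_smul, sub_mul, map_sub, ← smul_eq_C_mul, map_smul,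
    sInt_X hn, sInt_X_mul_lin_mul_X hn]
  simp

lemma sInt_mul_lin_eq_zero {p : RPoly n} (hp : ∀ i, sInt (p * X i) = 0) (a : Fin n → ℝ) :
    sInt (p * lin a) = 0 := by
  simp [lin, Finset.mul_sum, hp]

/-- The radial part of the conformal field is pointwise orthogonal to `Z`, so only its constant part
`n / (n - 1) c` contributes. With `Y` and the conformal field itself in the role of `Z`, this makes
the remainder orthogonal to the conformal part. -/
lemma sum_sInt_mul_conformalPart {Z : Fin n → RPoly n}
    (hZ : ∀ x : Sph n, ∑ i, (x : Euc n) i * ev (Z i) x = 0) (c : Fin n → ℝ) :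
    ∑ j, sInt (Z j * conformalPart c j) = (n : ℝ) / (n - 1) * ∑ j, c j * sInt (Z j) := by
  rw [← map_sum]
  have : ∑ j, c j * sInt (Z j) = sInt (∑ j, c j • Z j) := by simp
  rw [this, ← smul_eq_mul, ← map_smul]
  refine sInt_congr fun x => ?_
  have h : ∀ j, ev (Z j) x * ev (conformalPart c j) x =
      (n : ℝ) / (n - 1) * (c j * ev (Z j) x
        - (x : Euc n) j * ev (Z j) x * ∑ i, c i * (x : Euc n) i) := by
    intro j
    simp only [conformalPart, ev_smul, ev_sub, ev_C, ev_mul, ev_X, ev_lin]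
    ring
  simp only [ev_sum, ev_mul, h, ← Finset.mul_sum, Finset.sum_sub_distrib, ← Finset.sum_mul, hZ,
    ev_smul]
  ring

/-- Integration by parts: the tangential gradient of `⟨c, x⟩` is `c - ⟨c, x⟩ x`, whose radial part
does not see a tangential field. -/
lemma sInt_lin_mul_tDiv {Y : Fin n → RPoly n}
    (hY : ∀ x : Sph n, ∑ i, (x : Euc n) i * ev (Y i) x = 0) (c : Fin n → ℝ) :
    sInt (lin c * tDiv Y) = -∑ j, c j * sInt (Y j) := by
  have h := integral_inner_tgrad_field (lin c) Y hY
  have e : ∑ j, c j * sInt (Y j) = sInt (∑ j, c j • Y j) := by simp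
  rw [e, tDiv, ← neg_eq_iff_eq_neg, ← h]
  refine integral_congr_ae (.of_forall fun x => ?_)
  have h' : ∀ i, tgrad (lin c) (x : Euc n) i * ev (Y i) x = c i * ev (Y i) x
      - (∑ i, c i * (x : Euc n) i) * ((x : Euc n) i * ev (Y i) x) := by
    intro i
    rw [tgrad_lin]
    simp
    ring
  simp only [h', Finset.sum_sub_distrib, ← Finset.mul_sum, hY, ev_sum, ev_smul]
  ring

/-- The matrix of the linear part of a field. -/
def linearPart (Y : Fin n → RPoly n) (j i : Fin n) : ℝ := n * sInt (Y j * X i)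

/-- What remains of a tangential field after its conformal gradient part and its linear part are
removed. -/
def remainderPart (Y : Fin n → RPoly n) (j : Fin n) : RPoly n :=
  Y j - conformalPart (fun i => sInt (Y i)) j - lin (linearPart Y j)

lemma sInt_remainderPart (hn : 2 ≤ n) (Y : Fin n → RPoly n) (j : Fin n) :
    sInt (remainderPart Y j) = 0 := by
  simp [remainderPart, sInt_conformalPart hn, sInt_lin hn]

lemma sInt_remainderPart_mul_X (hn : 2 ≤ n) (Y : Fin n → RPoly n) (i j : Fin n) :
    sInt (remainderPart Y j * X i) = 0 := by
  have h2 : (2 : ℝ) ≤ n := by exact_mod_cast hn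
  have hn0 : (n : ℝ) ≠ 0 := by linarith
  rw [remainderPart, sub_mul, sub_mul, map_sub, map_sub, sInt_conformalPart_mul_X hn,
    sInt_lin_mul_X hn, linearPart]
  field_simp
  ring

/-- Split `Y` into remainder, conformal part and linear part. The linear part has eigenvalue `n - 1`
and costs nothing. The conformal part contributes `(n + 1) ∫ |T|² - 2n |c|² = -n (n - 3) / (n - 1)
|c|²`, since `∫ |T|² = n / (n - 1) |c|²`. Completing the square, `∫ (div Y + n ⟨c, x⟩)² = ∫ (div Y)²
- n |c|²`, produces the same deficit. -/
lemma tangential_energy_eq (hn : 2 ≤ n) {Y : Fin n → RPoly n}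
    (hY : ∀ x : Sph n, ∑ i, (x : Euc n) i * ev (Y i) x = 0) :
    ∑ j, (dirichlet (Y j) (Y j) - ((n : ℝ) - 1) * sInt (Y j * Y j))
        + ((n : ℝ) - 3) / ((n : ℝ) - 1) * sInt (tDiv Y * tDiv Y) =
      ∑ j, (dirichlet (remainderPart Y j) (remainderPart Y j)
        - ((n : ℝ) - 1) * sInt (remainderPart Y j * remainderPart Y j))
        + ((n : ℝ) - 3) / ((n : ℝ) - 1) *
          sInt ((tDiv Y + (n : ℝ) • lin fun i => sInt (Y i)) *
            (tDiv Y + (n : ℝ) • lin fun i => sInt (Y i))) := by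
  have h2 : (2 : ℝ) ≤ n := by exact_mod_cast hn
  have hm : (n : ℝ) - 1 ≠ 0 := by linarith
  have hn0 : (n : ℝ) ≠ 0 := by linarith
  set c : Fin n → ℝ := fun i => sInt (Y i) with hc
  set s : ℝ := ∑ j, c j * c j with hs
  have hYT : ∑ j, sInt (Y j * conformalPart c j) = n / (n - 1) * s :=
    sum_sInt_mul_conformalPart hY c
  have hTT : ∑ j, sInt (conformalPart c j * conformalPart c j) = n / (n - 1) * s := by
    rw [sum_sInt_mul_conformalPart (sum_coord_conformalPart c) c]
    simp only [sInt_conformalPart hn, hs]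
  -- This orthogonality holds only after summation over the components, because it rests on the
  -- tangency of `Y` and of the conformal part.
  have hrT : ∑ j, sInt (remainderPart Y j * conformalPart c j) = 0 := by
    have e : ∀ j, sInt (remainderPart Y j * conformalPart c j) = sInt (Y j * conformalPart c j)
        - sInt (conformalPart c j * conformalPart c j) := by
      intro j
      have : sInt (lin (linearPart Y j) * conformalPart c j) = 0 := by
        rw [mul_comm]
        exact sInt_mul_lin_eq_zero (fun i => sInt_conformalPart_mul_X hn c i j) _
      rw [remainderPart, sub_mul, sub_mul, map_sub, map_sub, this, sub_zero]
    simp only [e, Finset.sum_sub_distrib, hYT, hTT, sub_self]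
  have hdiv : sInt ((tDiv Y + (n : ℝ) • lin c) * (tDiv Y + (n : ℝ) • lin c)) =
      sInt (tDiv Y * tDiv Y) - n * s := by
    have e : (tDiv Y + (n : ℝ) • lin c) * (tDiv Y + (n : ℝ) • lin c) =
        tDiv Y * tDiv Y + (2 * (n : ℝ)) • (lin c * tDiv Y)
          + ((n : ℝ) * n) • (lin c * lin c) := by
      simp only [smul_eq_C_mul, C_mul, C_eq_coe_nat]
      have : (C (2 : ℝ) : RPoly n) = 2 := rfl
      rw [this]
      ring
    rw [e, map_add, map_add, map_smul, map_smul, sInt_lin_mul_tDiv hY, sInt_lin_mul_lin hn]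
    simp only [smul_eq_mul]
    change _ + 2 * (n : ℝ) * -s + n * n * (s / n) = _
    field_simp
    ring
  have hj : ∀ j, dirichlet (Y j) (Y j) - ((n : ℝ) - 1) * sInt (Y j * Y j) =
      (dirichlet (remainderPart Y j) (remainderPart Y j)
        - ((n : ℝ) - 1) * sInt (remainderPart Y j * remainderPart Y j))
      + (4 * n - 2 * (n - 1)) * sInt (remainderPart Y j * conformalPart c j)
      + (2 * n - (n - 1)) * sInt (conformalPart c j * conformalPart c j)
      - 2 * n * (c j * c j) := by
    intro j
    have hYj : Y j = remainderPart Y j + (conformalPart c j + lin (linearPart Y j)) := by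
      rw [remainderPart]
      abel
    have hr0 := sInt_remainderPart hn Y j
    have hrX := fun i => sInt_remainderPart_mul_X hn Y i j
    have hT0 := sInt_conformalPart hn c j
    have hTX := fun i => sInt_conformalPart_mul_X hn c i j
    have hL0 := sInt_lin hn (linearPart Y j)
    set r := remainderPart Y j
    set T := conformalPart c j with hT
    set L := lin (linearPart Y j) with hL
    have hrL : sInt (r * L) = 0 := sInt_mul_lin_eq_zero hrX _
    have hTL : sInt (T * L) = 0 := sInt_mul_lin_eq_zero hTX _
    have hq : sphLap (T + L) = -((2 * (n : ℝ)) • (T - C (c j)) + ((n : ℝ) - 1) • L) := by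
      rw [map_add, hT, sphLap_conformalPart hn, hL, sphLap_lin]
      abel
    have hmul : ∀ p : RPoly n, sInt (p * sphLap (T + L)) = -(2 * n * sInt (p * T)
        - 2 * n * (c j * sInt p) + (n - 1) * sInt (p * L)) := by
      intro p
      have : p * sphLap (T + L) = -((2 * (n : ℝ)) • (p * T) - (2 * (n : ℝ)) • (c j • p)
          + ((n : ℝ) - 1) • (p * L)) := by
        rw [hq]
        simp only [smul_eq_C_mul]
        ring
      rw [this]
      simp only [map_neg, map_add, map_sub, map_smul, smul_eq_mul]
    have hrq : dirichlet r (T + L) = 2 * n * sInt (r * T) := by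
      rw [dirichlet_eq, hmul, hr0, hrL]
      ring
    have hqq : dirichlet (T + L) (T + L) = 2 * n * sInt (T * T) - 2 * n * (c j * c j)
        + (n - 1) * sInt (L * L) := by
      rw [dirichlet_eq, hmul, add_mul, add_mul, map_add, map_add, map_add, mul_comm L T, hTL, hT0,
        hL0]
      ring
    have hYY : sInt (Y j * Y j) = sInt (r * r) + 2 * sInt (r * T) + sInt (T * T)
        + sInt (L * L) := by
      have : Y j * Y j = r * r + (2 : ℕ) • (r * T) + (2 : ℕ) • (r * L) + T * T + (2 : ℕ) • (T * L)
          + L * L := by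
        rw [hYj]
        ring
      rw [this]
      simp only [map_add, map_nsmul, hrL, hTL]
      simp
    have hBB : dirichlet (Y j) (Y j) = dirichlet r r + 2 * dirichlet r (T + L)
        + dirichlet (T + L) (T + L) := by
      conv_lhs => rw [hYj]
      exact dirichlet_add_self _ _
    rw [hBB, hYY, hrq, hqq]
    ring
  rw [hdiv]
  simp only [hj, Finset.sum_add_distrib, Finset.sum_sub_distrib, ← Finset.mul_sum, hrT, hTT]
  rw [← hs]
  field_simp
  ring

end TangentialEnergy

/-! ### Coercivity on polynomial fields -/

section PolynomialCoercivity

open MvPolynomial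

variable {n : ℕ}

/-- The polynomial field `S x + (e / n - ⟨e, x⟩ x)`. For skew-symmetric `S` this is an
infinitesimal Möbius transformation minus its average. -/
def mobiusField (S : Fin n → Fin n → ℝ) (e : Fin n → ℝ) (j : Fin n) : RPoly n :=
  lin (S j) + (C (e j / n) - X j * lin e)

lemma sInt_mobiusField (hn : 2 ≤ n) (S : Fin n → Fin n → ℝ) (e : Fin n → ℝ) (j : Fin n) :
    sInt (mobiusField S e j) = 0 := by
  rw [mobiusField, map_add, map_sub, sInt_lin hn, sInt_C (by omega), sInt_X_mul_lin hn]
  ring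

lemma dirichlet_lin_self (a : Fin n → ℝ) :
    dirichlet (lin a) (lin a) = ((n : ℝ) - 1) * sInt (lin a * lin a) := by
  rw [dirichlet_eq, sphLap_lin, mul_neg, mul_smul_comm, map_neg, map_smul, neg_neg, smul_eq_mul]

/-- The part of a function which is orthogonal to the linear functions. -/
def normalRemainder (f : RPoly n) : RPoly n := f - lin fun i => n * sInt (f * X i)

lemma sInt_normalRemainder (hn : 2 ≤ n) {f : RPoly n} (hf : sInt f = 0) :
    sInt (normalRemainder f) = 0 := by
  rw [normalRemainder, map_sub, hf, sInt_lin hn, sub_zero]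

lemma sInt_normalRemainder_mul_X (hn : 2 ≤ n) (f : RPoly n) (i : Fin n) :
    sInt (normalRemainder f * X i) = 0 := by
  have h2 : (2 : ℝ) ≤ n := by exact_mod_cast hn
  have hn0 : (n : ℝ) ≠ 0 := by linarith
  rw [normalRemainder, sub_mul, map_sub, sInt_lin_mul_X hn]
  field_simp
  ring

/-- Linear functions are eigenfunctions for `n - 1`, so they contribute nothing and do not couple to
their orthogonal complement. -/
lemma normal_energy_eq (hn : 2 ≤ n) (f : RPoly n) :
    dirichlet f f - ((n : ℝ) - 1) * sInt (f * f) =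
      dirichlet (normalRemainder f) (normalRemainder f)
        - ((n : ℝ) - 1) * sInt (normalRemainder f * normalRemainder f) := by
  obtain ⟨b, hb⟩ : ∃ b, f = normalRemainder f + lin b :=
    ⟨fun i => n * sInt (f * X i), by rw [normalRemainder]; abel⟩
  have hX := sInt_mul_lin_eq_zero (fun i => sInt_normalRemainder_mul_X hn f i) b
  set g := normalRemainder f
  have h1 : dirichlet g (lin b) = 0 := by
    rw [dirichlet_eq, sphLap_lin, mul_neg, mul_smul_comm, map_neg, map_smul, hX]
    simp
  have h2 : sInt ((g + lin b) * (g + lin b)) = sInt (g * g) + sInt (lin b * lin b) := by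
    have : (g + lin b) * (g + lin b) = g * g + (2 : ℕ) • (g * lin b) + lin b * lin b := by ring
    rw [this, map_add, map_add, map_nsmul, hX]
    simp
  rw [hb, dirichlet_add_self, h1, h2, dirichlet_lin_self]
  ring

/-- Orthogonality to affine functions gives `D ≥ 2n I` for the Dirichlet integral `D` and `I = ∫
p²`. Three quarters of `D` then pay for `(n - 1) I + I / 2`, as `3n / 2 ≥ n - 1 / 2`. -/
lemma spectral_gap (hn : 2 ≤ n) {p : RPoly n} (h0 : sInt p = 0) (h1 : ∀ i, sInt (p * X i) = 0) :
    1 / 4 * dirichlet p p + 1 / 2 * sInt (p * p) ≤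
      dirichlet p p - ((n : ℝ) - 1) * sInt (p * p) := by
  have h := poincare hn 1 (orthogonal_polyLE_one h0 h1)
  have h2 : (2 : ℝ) ≤ n := by exact_mod_cast hn
  have hs := sInt_mul_self_nonneg p
  push_cast at h
  nlinarith

/-- The gradient of `x_j f` is `x_j ∇f + f (e_j - x_j x)`. The cross terms vanish after summation
because `∇f` is tangential, and `∑ |e_j - x_j x|² = n - 1`. -/
lemma sum_dirichlet_X_mul (f : RPoly n) :
    ∑ j, dirichlet (X j * f) (X j * f) = dirichlet f f + ((n : ℝ) - 1) * sInt (f * f) := by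
  have key : ∀ x : Sph n, ∑ j, ⟪tgrad (X j * f) (x : Euc n), tgrad (X j * f) (x : Euc n)⟫ =
      ⟪tgrad f x, tgrad f x⟫ + ((n : ℝ) - 1) * ev (f * f) x := by
    intro x
    have hGx := inner_tgrad_sphere f x
    have hxG : ∑ j, (x : Euc n) j * tgrad f (x : Euc n) j = 0 := by
      rw [← inner_eq_sum, real_inner_comm, hGx]
    have e : ∀ j, ⟪tgrad (X j * f) (x : Euc n), tgrad (X j * f) (x : Euc n)⟫ =
        (x : Euc n) j * (x : Euc n) j * (⟪tgrad f x, tgrad f x⟫ - ev (f * f) x) + ev (f * f) x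
          + 2 * ev f (x : Euc n) * ((x : Euc n) j * tgrad f (x : Euc n) j) := by
      intro j
      rw [tgrad_mul, tgrad_X, ev_X]
      have hx : ⟪(x : Euc n), tgrad f (x : Euc n)⟫ = 0 := by rw [real_inner_comm, hGx]
      simp only [inner_add_left, inner_add_right, inner_sub_left, inner_sub_right,
        real_inner_smul_left, real_inner_smul_right, EuclideanSpace.inner_single_left,
        EuclideanSpace.inner_single_right, inner_self_sphere, hGx, hx, ev_mul]
      simp
      ring
    simp only [e, Finset.sum_add_distrib, ← Finset.mul_sum, ← Finset.sum_mul,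
      sum_coord_sq_sphere, hxG, Finset.sum_const, Finset.card_univ, Fintype.card_fin,
      nsmul_eq_mul]
    ring
  simp only [dirichlet]
  rw [← integral_finsetSum _ fun j _ => integrable_inner_tgrad _ _]
  simp only [key]
  rw [integral_add (integrable_inner_tgrad _ _)
    ((integrable_sphere_of_continuous (continuous_ev_sphere _)).const_mul _),
    integral_const_mul, sInt_apply]

lemma dirichlet_add_add_C_le (p q r : RPoly n) (k : ℝ) :
    dirichlet (p + q + r + C k) (p + q + r + C k) ≤
      3 * (dirichlet p p + dirichlet q q + dirichlet r r) := by
  have h : 3 * (dirichlet p p + dirichlet q q + dirichlet r r) = ∫ x : Sph n,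
      3 * (⟪tgrad p x, tgrad p x⟫ + ⟪tgrad q x, tgrad q x⟫ + ⟪tgrad r x, tgrad r x⟫)
        ∂sphereMeasure n := by
    have h12 : Integrable (fun x : Sph n => ⟪tgrad p x, tgrad p x⟫ + ⟪tgrad q x, tgrad q x⟫)
      (sphereMeasure n) := (integrable_inner_tgrad _ _).add (integrable_inner_tgrad _ _)
    rw [integral_const_mul, integral_add h12 (integrable_inner_tgrad _ _),
      integral_add (integrable_inner_tgrad _ _) (integrable_inner_tgrad _ _)]
    rfl
  rw [h]
  refine integral_mono (integrable_inner_tgrad _ _) ((((integrable_inner_tgrad _ _).add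
      (integrable_inner_tgrad _ _)).add (integrable_inner_tgrad _ _)).const_mul _) fun x => ?_
  simp only [tgrad_add, tgrad_C, add_zero]
  set a := tgrad p (x : Euc n)
  set b := tgrad q (x : Euc n)
  set c := tgrad r (x : Euc n)
  have h1 := real_inner_self_nonneg (x := a - b)
  have h2 := real_inner_self_nonneg (x := a - c)
  have h3 := real_inner_self_nonneg (x := b - c)
  simp only [inner_sub_left, inner_sub_right, inner_add_left, inner_add_right,
    real_inner_comm a b, real_inner_comm a c, real_inner_comm b c] at h1 h2 h3 ⊢
  linarith

/-- The symmetric trace-free linear part of a tangential field is controlled by the remainder. -/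
lemma sum_sInt_lin_sq_le {s : Fin n → Fin n → ℝ} (hsymm : ∀ i j, s i j = s j i)
    (htr : ∑ j, s j j = 0) {r : Fin n → RPoly n}
    (hr : ∀ x : Sph n, ev (∑ j, X j * lin (s j)) x = -∑ j, (x : Euc n) j * ev (r j) x) :
    ∑ j, sInt (lin (s j) * lin (s j)) ≤ ((n : ℝ) + 2) / 2 * ∑ j, sInt (r j * r j) := by
  set g : RPoly n := ∑ j, X j * lin (s j) with hg
  have hghom : g.IsHomogeneous 2 := IsHomogeneous.sum _ _ _ fun j _ => isHomogeneous_X_mul_lin _ _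
  have hpd : ∀ j, pderiv j g = (2 : ℝ) • lin (s j) := by
    intro j
    have e : ∀ i, pderiv j (X i * lin (s i)) =
        (if j = i then lin (s i) else 0) + s j i • X i := by
      intro i
      rw [pderiv_mul, pderiv_lin, pderiv_X, hsymm i j, mul_comm (X i), ← smul_eq_C_mul]
      by_cases hij : j = i
      · subst hij; simp
      · simp [hij, Ne.symm hij]
    rw [hg, map_sum]
    simp only [e, Finset.sum_add_distrib, Finset.sum_ite_eq, Finset.mem_univ, if_true, two_smul]
    rfl
  -- The moment recursion for the cubic `(s_j · x) g`, where `n - 1 + 3 = n + 2`. In the sum over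
  -- `j` the first term on the right disappears because `s` has trace zero.
  have hj : ∀ j, ((n : ℝ) + 2) * sInt (X j * (lin (s j) * g)) =
      s j j * sInt g + 2 * sInt (lin (s j) * lin (s j)) := by
    intro j
    have h := sInt_X_mul_of_isHomogeneous j ((isHomogeneous_lin (s j)).mul hghom)
    rw [pderiv_mul, pderiv_lin, hpd, map_add, ← smul_eq_C_mul, map_smul, mul_smul_comm,
      map_smul, smul_eq_mul, smul_eq_mul] at h
    rw [← h]
    push_cast
    ring
  have hgg : ((n : ℝ) + 2) * sInt (g * g) = 2 * ∑ j, sInt (lin (s j) * lin (s j)) := by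
    have e : g * g = ∑ j, X j * (lin (s j) * g) := by
      conv_lhs => rw [hg]
      rw [← hg, Finset.sum_mul]
      exact Finset.sum_congr rfl fun j _ => by ring
    rw [e, map_sum, Finset.mul_sum, Finset.sum_congr rfl fun j _ => hj j, Finset.sum_add_distrib,
      ← Finset.sum_mul, htr, ← Finset.mul_sum]
    ring
  -- By hypothesis `g = -⟨x, r⟩` on the sphere; this is Cauchy–Schwarz with `|x| = 1`.
  have hle : sInt (g * g) ≤ ∑ j, sInt (r j * r j) := by
    rw [← map_sum]
    refine integral_mono (integrable_sphere_of_continuous (continuous_ev_sphere _))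
      (integrable_sphere_of_continuous (continuous_ev_sphere _)) fun x => ?_
    simp only [ev_mul, hr, ev_sum, neg_mul_neg]
    have h := Finset.sum_mul_sq_le_sq_mul_sq Finset.univ (fun j => (x : Euc n) j)
      fun j => ev (r j) (x : Euc n)
    have h1 := sum_coord_sq_sphere x
    simp only [pow_two] at h
    rw [h1, one_mul] at h
    exact h
  have hn0 : (0 : ℝ) ≤ n := n.cast_nonneg
  nlinarith

lemma tangential_of_decomposition {Y : Fin n → RPoly n} {h : RPoly n}
    (hY : ∑ j, X j * Y j = (1 - ∑ j, X j * X j) * h) (x : Sph n) :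
    ∑ i, (x : Euc n) i * ev (Y i) x = 0 := by
  have := congrArg (fun p => ev p (x : Euc n)) hY
  simpa [sum_coord_sq_sphere] using this

/-- Here `m` is the dimension, `a` and `b` are the Dirichlet and `L²` energies of the tangential
remainder, `c` and `d` those of the normal remainder, `s` is the `L²` energy of the symmetric linear
part and `E` the total energy. -/
lemma coercivity_arithmetic {m a b c d s E : ℝ} (hm : 3 ≤ m) (ha : 0 ≤ a) (hb : 0 ≤ b)
    (hc : 0 ≤ c) (hd : 0 ≤ d) (hs : s ≤ (m + 2) / 2 * b)
    (hE : 1 / 4 * a + 1 / 2 * b + (1 / 4 * c + 1 / 2 * d) ≤ E) :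
    6 * (a + (m - 1) * s + (c + (m - 1) * d)) ≤ (24 + 12 * m * (m + 2)) * E := by
  have hm0 : 0 ≤ m := by linarith
  have hK : 0 ≤ 24 + 12 * m * (m + 2) := by positivity
  refine le_trans ?_ (mul_le_mul_of_nonneg_left hE hK)
  have hs2 := mul_le_mul_of_nonneg_left hs (show 0 ≤ m - 1 by linarith)
  have h1 : 0 ≤ m * a := by positivity
  have h2 : 0 ≤ m * (m * a) := by positivity
  have h3 : 0 ≤ m * b := by positivity
  have h4 : 0 ≤ m * (m * b) := by positivity
  have h5 : 0 ≤ m * c := by positivity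
  have h6 : 0 ≤ m * (m * c) := by positivity
  have h7 : 0 ≤ m * d := by positivity
  have h8 : 0 ≤ m * (m * d) := by positivity
  linarith

/-- The quadratic form controls the distance to the Möbius fields, for polynomial fields. -/
theorem exists_mobiusField_near (hn : 3 ≤ n) : ∃ K : ℝ, 0 < K ∧ ∀ w : Fin n → RPoly n,
    (∀ j, sInt (w j) = 0) → sInt (∑ j, X j * w j) = 0 →
    ∃ (S : Fin n → Fin n → ℝ) (e : Fin n → ℝ), (∀ i j, S i j = -S j i) ∧
      ∑ j, (sInt ((w j - mobiusField S e j) * (w j - mobiusField S e j))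
        + dirichlet (w j - mobiusField S e j) (w j - mobiusField S e j)) ≤
      K * ∫ x : Sph n, energyDensity w x ∂sphereMeasure n := by
  have hn2 : 2 ≤ n := by omega
  have h3 : (3 : ℝ) ≤ n := by exact_mod_cast hn
  refine ⟨24 + 12 * n * (n + 2), by positivity, fun w hw0 hwx => ?_⟩
  set f : RPoly n := ∑ j, X j * w j with hf
  set Y : Fin n → RPoly n := fun j => w j - X j * f with hYdef
  have hwY : ∀ j, w j = Y j + X j * f := fun j => by simp [hYdef]
  have hYρ : ∑ j, X j * Y j = (1 - ∑ j, X j * X j) * f := by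
    simp only [hYdef, mul_sub, Finset.sum_sub_distrib, ← mul_assoc, ← Finset.sum_mul, sub_mul,
      one_mul]
    rw [← hf]
  have hYx := tangential_of_decomposition hYρ
  have hE := integral_energyDensity hn2 hwY hYρ
  rw [tangential_energy_eq hn2 hYx, normal_energy_eq hn2 f] at hE
  set c : Fin n → ℝ := fun i => sInt (Y i) with hc
  set M := linearPart Y with hM
  set r := remainderPart Y with hr
  set g := normalRemainder f with hg
  set b : Fin n → ℝ := fun i => n * sInt (f * X i) with hb
  have hr0 : ∀ j, sInt (r j) = 0 := sInt_remainderPart hn2 Y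
  have hrX : ∀ j i, sInt (r j * X i) = 0 := fun j i => sInt_remainderPart_mul_X hn2 Y i j
  have hg0 : sInt g = 0 := sInt_normalRemainder hn2 hwx
  have hgX : ∀ i, sInt (g * X i) = 0 := sInt_normalRemainder_mul_X hn2 f
  have hYr : ∀ j, Y j = r j + conformalPart c j + lin (M j) := fun j => by
    rw [hr, remainderPart]
    abel
  have hfg : f = g + lin b := by
    rw [hg, normalRemainder]
    abel
  have hlower : ∑ j, (1 / 4 * dirichlet (r j) (r j) + 1 / 2 * sInt (r j * r j))
      + (1 / 4 * dirichlet g g + 1 / 2 * sInt (g * g)) ≤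
      ∫ x : Sph n, energyDensity w x ∂sphereMeasure n := by
    rw [hE]
    refine add_le_add (le_add_of_le_of_nonneg (Finset.sum_le_sum fun j _ =>
      spectral_gap hn2 (hr0 j) (hrX j)) (mul_nonneg (div_nonneg (by linarith) (by linarith))
        (sInt_mul_self_nonneg _))) (spectral_gap hn2 hg0 hgX)
  clear hE
  -- The choice matches the terms `x_j ⟨·, x⟩`: the conformal part of `Y` carries `-n / (n - 1) x_j
  -- ⟨c, x⟩` and the normal part `x_j ⟨b, x⟩`.
  set e : Fin n → ℝ := ((n : ℝ) / ((n : ℝ) - 1)) • c - b with he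
  set S : Fin n → Fin n → ℝ := fun j i => (M j i - M i j) / 2 with hS
  set s : Fin n → Fin n → ℝ := fun j i => (M j i + M i j) / 2 with hs
  have hMS : ∀ j, M j = S j + s j := fun j => by
    ext i
    simp only [hS, hs, Pi.add_apply]
    ring
  have hSskew : ∀ i j, S i j = -S j i := fun i j => by
    simp only [hS]
    ring
  have hquadS : ∀ x : Sph n, ∑ j, (x : Euc n) j * ∑ i, S j i * (x : Euc n) i = 0 := by
    intro x
    have h1 : ∑ j, (x : Euc n) j * ∑ i, S j i * (x : Euc n) i =
        -∑ j, (x : Euc n) j * ∑ i, S j i * (x : Euc n) i := by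
      simp only [Finset.mul_sum]
      conv_lhs => rw [Finset.sum_comm]
      rw [← Finset.sum_neg_distrib]
      refine Finset.sum_congr rfl fun j _ => ?_
      rw [← Finset.sum_neg_distrib]
      refine Finset.sum_congr rfl fun i _ => ?_
      rw [hSskew i j]
      ring
    linarith
  -- The trace of the linear part is `n ∫ ⟨x, Y⟩`, which vanishes by tangency.
  have htr : ∑ j, s j j = 0 := by
    have h1 : ∀ j, s j j = n * sInt (X j * Y j) := fun j => by
      simp only [hs, hM, linearPart, mul_comm (X j)]
      ring
    simp only [h1, ← Finset.mul_sum]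
    rw [← map_sum, sInt_congr (q := 0) fun x => by simpa using hYx x]
    simp
  have hsr : ∀ x : Sph n, ev (∑ j, X j * lin (s j)) x = -∑ j, (x : Euc n) j * ev (r j) x := by
    intro x
    have h1 := hYx x
    have h2 : ∀ i, (x : Euc n) i * ev (Y i) x = (x : Euc n) i * ev (r i) x
        + (x : Euc n) i * ev (conformalPart c i) x
        + (x : Euc n) i * ∑ k, S i k * (x : Euc n) k + ev (X i * lin (s i)) x := by
      intro i
      rw [hYr, hMS, lin_add]
      simp only [ev_add, ev_mul, ev_X, ev_lin]
      ring
    simp only [h2, Finset.sum_add_distrib, sum_coord_conformalPart, hquadS] at h1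
    rw [ev_sum]
    linarith
  have hsle := sum_sInt_lin_sq_le (fun i j => by simp only [hs]; ring) htr hsr
  refine ⟨S, e, hSskew, ?_⟩
  -- The value of the constant is irrelevant: both fields on the left have mean zero, so gradients
  -- control the difference.
  have hD : ∀ j, w j - mobiusField S e j =
      r j + lin (s j) + X j * g + C (n / (n - 1) * c j - e j / n) := by
    intro j
    have e1 : lin e = ((n : ℝ) / ((n : ℝ) - 1)) • lin c - lin b := by
      rw [he, lin_sub, lin_smul]
    rw [hwY, hYr, hMS, lin_add, mobiusField, e1, hfg, conformalPart]
    simp only [smul_eq_C_mul, C_sub, C_mul]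
    ring
  -- The factor 6 combines 3 from a sum of three gradients with 2 from the Poincaré inequality for
  -- mean zero, `∫ p² ≤ D` since `n - 1 ≥ 1`.
  have hDle : ∀ j, sInt ((w j - mobiusField S e j) * (w j - mobiusField S e j))
        + dirichlet (w j - mobiusField S e j) (w j - mobiusField S e j) ≤
      6 * (dirichlet (r j) (r j) + ((n : ℝ) - 1) * sInt (lin (s j) * lin (s j))
        + dirichlet (X j * g) (X j * g)) := by
    intro j
    have h0 : sInt (w j - mobiusField S e j) = 0 := by
      rw [map_sub, hw0, sInt_mobiusField hn2, sub_zero]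
    have hP := poincare hn2 0 (orthogonal_polyLE_zero h0)
    have hsq := sInt_mul_self_nonneg (w j - mobiusField S e j)
    have h1 : dirichlet (w j - mobiusField S e j) (w j - mobiusField S e j) ≤
        3 * (dirichlet (r j) (r j) + ((n : ℝ) - 1) * sInt (lin (s j) * lin (s j))
        + dirichlet (X j * g) (X j * g)) := by
      rw [hD, ← dirichlet_lin_self]
      exact dirichlet_add_add_C_le _ _ _ _
    push_cast at hP
    nlinarith
  refine (Finset.sum_le_sum fun j _ => hDle j).trans ?_
  rw [← Finset.mul_sum, Finset.sum_add_distrib, Finset.sum_add_distrib, ← Finset.mul_sum,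
    sum_dirichlet_X_mul]
  rw [Finset.sum_add_distrib, ← Finset.mul_sum, ← Finset.mul_sum] at hlower
  exact coercivity_arithmetic h3 (Finset.sum_nonneg fun j _ => dirichlet_self_nonneg _)
    (Finset.sum_nonneg fun j _ => sInt_mul_self_nonneg _) (dirichlet_self_nonneg g)
    (sInt_mul_self_nonneg g) hsle hlower

/-- The quadratic form vanishes on the Möbius fields. -/
lemma integral_energyDensity_mobiusField (hn : 2 ≤ n) {S : Fin n → Fin n → ℝ}
    (hS : ∀ i j, S i j = -S j i) (e : Fin n → ℝ) :
    ∫ x : Sph n, energyDensity (mobiusField S e) x ∂sphereMeasure n = 0 := by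
  have h2 : (2 : ℝ) ≤ n := by exact_mod_cast hn
  have hm : (n : ℝ) - 1 ≠ 0 := by linarith
  have hn0 : (n : ℝ) ≠ 0 := by linarith
  -- The splitting `e / n - ⟨e, x⟩ x = (e - ⟨e, x⟩ x) / n + (1 / n - 1) ⟨e, x⟩ x` into tangential
  -- and normal parts.
  set f : RPoly n := (1 / (n : ℝ) - 1) • lin e with hf
  set Y : Fin n → RPoly n := fun j => lin (S j) + (1 / (n : ℝ)) • (C (e j) - X j * lin e) with hYd
  have hwY : ∀ j, mobiusField S e j = Y j + X j * f := by
    intro j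
    simp only [mobiusField, hYd, hf, smul_eq_C_mul, div_eq_mul_inv, C_sub, C_mul, C_1]
    ring
  have hSX : ∑ j, X j * lin (S j) = 0 := by
    have h1 : ∑ j, X j * lin (S j) = -∑ j, X j * lin (S j) := by
      simp only [lin, Finset.mul_sum]
      conv_lhs => rw [Finset.sum_comm]
      rw [← Finset.sum_neg_distrib]
      refine Finset.sum_congr rfl fun j _ => ?_
      rw [← Finset.sum_neg_distrib]
      refine Finset.sum_congr rfl fun i _ => ?_
      rw [hS i j]
      simp only [smul_eq_C_mul, C_neg]
      ring
    exact self_eq_neg.1 h1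
  have hlin : ∑ j, X j * C (e j) = lin e := by
    simp only [lin, smul_eq_C_mul, mul_comm]
  have hYρ : ∑ j, X j * Y j = (1 - ∑ j, X j * X j) * ((1 / (n : ℝ)) • lin e) := by
    have e1 : ∀ j, X j * Y j = X j * lin (S j) + (1 / (n : ℝ)) • (X j * C (e j)
        - X j * X j * lin e) := by
      intro j
      simp only [hYd, smul_eq_C_mul]
      ring
    simp only [e1, Finset.sum_add_distrib, hSX]
    rw [← Finset.smul_sum, Finset.sum_sub_distrib, hlin, ← Finset.sum_mul, zero_add, sub_mul,
      one_mul, mul_smul_comm, smul_sub]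
  have hYx := tangential_of_decomposition hYρ
  have hc : (fun i => sInt (Y i)) = (((n : ℝ) - 1) / (n * n)) • e := by
    ext i
    simp only [hYd, map_add, map_smul, map_sub, sInt_lin hn, sInt_C (show 1 ≤ n by omega),
      sInt_X_mul_lin hn, smul_eq_mul, Pi.smul_apply]
    field_simp
    ring
  have hconf : ∀ j, conformalPart (fun i => sInt (Y i)) j =
      (1 / (n : ℝ)) • (C (e j) - X j * lin e) := by
    intro j
    have hk : (n : ℝ) / (n - 1) * ((n - 1) / (n * n)) = 1 / n := by
      field_simp
    rw [hc, conformalPart, lin_smul, Pi.smul_apply, smul_eq_mul, C_mul, mul_smul_comm,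
      ← smul_eq_C_mul, ← smul_sub, smul_smul, hk]
  have hlinp : ∀ j, linearPart Y j = S j := by
    intro j
    ext i
    simp only [linearPart, hYd, add_mul, map_add, sInt_lin_mul_X hn, smul_mul_assoc, map_smul,
      sub_mul, map_sub, ← smul_eq_C_mul, sInt_X hn, sInt_X_mul_lin_mul_X hn]
    simp
    field_simp
  -- The tangential part is exactly conformal part plus skew linear part. With `div Y = -n ⟨c, x⟩`
  -- and `f` linear, every term of the decoupled energy vanishes.
  have hr : ∀ j, remainderPart Y j = 0 := by
    intro j
    rw [remainderPart, hconf, hlinp]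
    simp only [hYd]
    abel
  have hdiv : ∀ x : Sph n, ev (tDiv Y + (n : ℝ) • lin fun i => sInt (Y i)) x = 0 := by
    intro x
    have hSjj : ∀ j, S j j = 0 := fun j => by linarith [hS j j]
    have d1 : ∀ i, pderiv i (Y i) = -(1 / (n : ℝ)) • (lin e + X i * C (e i)) := by
      intro i
      simp only [hYd, map_add, Derivation.map_smul, map_sub, pderiv_lin, hSjj, pderiv_mul,
        pderiv_X_self, pderiv_C, C_0, one_mul, zero_add, zero_sub, smul_neg, neg_smul]
    have d2 : ∀ i, euler (Y i) = lin (S i) - (2 / (n : ℝ)) • (X i * lin e) := by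
      intro i
      simp only [hYd, map_add, Derivation.map_smul, map_sub, euler_lin, euler_C, euler_mul,
        euler_X, div_eq_mul_inv]
      simp only [smul_eq_C_mul, C_mul, C_1]
      have : (C (2 : ℝ) : RPoly n) = 2 := rfl
      rw [this]
      ring
    have d3 : tDiv Y = -(1 / (n : ℝ)) • ((n : ℝ) • lin e + lin e)
        + (2 / (n : ℝ)) • ((∑ i, X i * X i) * lin e) := by
      simp only [tDiv, d1, d2, ← Finset.smul_sum, Finset.sum_add_distrib, hlin, mul_sub,
        Finset.sum_sub_distrib, hSX, mul_smul_comm, ← mul_assoc, ← Finset.sum_mul,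
        Finset.sum_const, Finset.card_univ, Fintype.card_fin, Nat.cast_smul_eq_nsmul]
      abel
    rw [d3, hc, lin_smul]
    simp only [ev_add, ev_smul, ev_mul, sum_X_mul_X_sphere]
    field_simp
    ring
  rw [integral_energyDensity hn hwY hYρ, tangential_energy_eq hn hYx]
  have hdd : sInt ((tDiv Y + (n : ℝ) • lin fun i => sInt (Y i)) *
      (tDiv Y + (n : ℝ) • lin fun i => sInt (Y i))) = 0 := by
    rw [sInt_congr (q := 0) fun x => by rw [ev_mul, hdiv]; simp]
    simp
  have hff : dirichlet f f = ((n : ℝ) - 1) * sInt (f * f) := by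
    rw [hf, ← lin_smul, dirichlet_lin_self]
  have h00 : dirichlet (0 : RPoly n) 0 = 0 := by
    rw [dirichlet_eq]
    simp
  simp only [hr, hdd, hff, h00]
  simp

end PolynomialCoercivity

/-! ### Completeness of `W^{1,2}` and density of the polynomial fields -/

section FunctionalAnalysis

variable {n : ℕ}

-- Multiplication operators on `L²` of the sphere

section PointwiseOperator

variable {E F : Type*} [NormedAddCommGroup E] [NormedSpace ℝ E] [NormedAddCommGroup F]
  [NormedSpace ℝ F]

lemma exists_pointwise_bound {L : Sph n → E →L[ℝ] F} (hL : Continuous L) :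
    ∃ C : ℝ, ∀ x v, ‖L x v‖ ≤ C * ‖v‖ := by
  obtain ⟨C, hC⟩ := isCompact_univ.exists_bound_of_continuousOn hL.continuousOn
  exact ⟨C, fun x v => (L x).le_of_opNorm_le (hC x (Set.mem_univ x)) v⟩

lemma memLp_pointwise {L : Sph n → E →L[ℝ] F} (hL : Continuous L) {u : Sph n → E}
    (hu : MemLp u 2 (sphereMeasure n)) : MemLp (fun x => L x (u x)) 2 (sphereMeasure n) := by
  obtain ⟨C, hC⟩ := exists_pointwise_bound hL
  exact hu.of_le_mul ((ContinuousLinearMap.id ℝ (E →L[ℝ] F)).aestronglyMeasurable_comp₂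
    hL.aestronglyMeasurable hu.1) (.of_forall fun x => hC x _)

/-- The operator on `L²` of the sphere given by a continuous family of linear maps. -/
def pointwiseLp (L : Sph n → E →L[ℝ] F) (hL : Continuous L) :
    Lp E 2 (sphereMeasure n) →L[ℝ] Lp F 2 (sphereMeasure n) :=
  LinearMap.mkContinuousOfExistsBound
    { toFun := fun u => (memLp_pointwise hL (Lp.memLp u)).toLp
      map_add' := fun u v => by
        rw [← MemLp.toLp_add]
        refine MemLp.toLp_congr _ _ ?_
        filter_upwards [Lp.coeFn_add u v] with x hx
        change L x ((u + v : Lp E 2 (sphereMeasure n)) x) = L x (u x) + L x (v x)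
        rw [hx, Pi.add_apply, map_add]
      map_smul' := fun c u => by
        rw [RingHom.id_apply, ← MemLp.toLp_const_smul]
        refine MemLp.toLp_congr _ _ ?_
        filter_upwards [Lp.coeFn_smul c u] with x hx
        simp [hx] }
    (by
      obtain ⟨C, hC⟩ := exists_pointwise_bound hL
      refine ⟨C, fun u => Lp.norm_le_mul_norm_of_ae_le_mul ?_⟩
      filter_upwards [(memLp_pointwise hL (Lp.memLp u)).coeFn_toLp] with x hx
      have hx' : ((memLp_pointwise hL (Lp.memLp u)).toLp : Sph n → F) x = L x (u x) := hx
      exact hx' ▸ hC x _)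

lemma pointwiseLp_coeFn (L : Sph n → E →L[ℝ] F) (hL : Continuous L)
    (u : Lp E 2 (sphereMeasure n)) :
    pointwiseLp L hL u =ᵐ[sphereMeasure n] fun x => L x (u x) :=
  (memLp_pointwise hL (Lp.memLp u)).coeFn_toLp

end PointwiseOperator

/-- Integration as a continuous functional on `L²`. -/
def integralL2 (n : ℕ) : Lp ℝ 2 (sphereMeasure n) →L[ℝ] ℝ :=
  innerSL ℝ (memLp_const (1 : ℝ) : MemLp (fun _ : Sph n => (1 : ℝ)) 2 (sphereMeasure n)).toLp

lemma integralL2_apply (u : Lp ℝ 2 (sphereMeasure n)) :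
    integralL2 n u = ∫ x, u x ∂sphereMeasure n := by
  rw [integralL2, innerSL_apply_apply, L2.inner_def]
  refine integral_congr_ae ?_
  filter_upwards [(memLp_const (1 : ℝ) : MemLp (fun _ : Sph n => (1 : ℝ)) 2
    (sphereMeasure n)).coeFn_toLp] with x hx
  rw [hx]
  simp

/-- The `j`-th row of a gradient. -/
abbrev rowL (n : ℕ) (j : Fin n) : Grad n →L[ℝ] Euc n := PiLp.proj (𝕜 := ℝ) 2 (fun _ => Euc n) j

/-- The `j`-th coordinate. -/
abbrev coordL (n : ℕ) (j : Fin n) : Euc n →L[ℝ] ℝ := EuclideanSpace.proj (𝕜 := ℝ) j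

lemma continuous_innerSL_comp_row {X : Sph n → Euc n} (hX : Continuous X) (j : Fin n) :
    Continuous fun x : Sph n => (innerSL ℝ (X x)).comp (rowL n j) :=
  ((innerSL ℝ).continuous.comp hX).clm_comp continuous_const

/-- Tangency of the gradient and each integration-by-parts identity are closed conditions, because
they equate continuous linear maps on the pair of `L²` spaces. -/
lemma isClosed_sobolevW12 (n : ℕ) : IsClosed (sobolevW12 n : Set (L2Pair n)) := by
  have h : (sobolevW12 n : Set (L2Pair n)) = ⋂ j : Fin n,
      {p | pointwiseLp (fun x : Sph n => (innerSL ℝ (x : Euc n)).comp (rowL n j))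
        (continuous_innerSL_comp_row continuous_subtype_val j) (WithLp.sndL 2 ℝ _ _ p) = 0} ∩
      ⋂ X : {X : Euc n → Euc n // IsTangentTestField X},
      {p | integralL2 n (pointwiseLp (fun x : Sph n => tangDiv X.1 (x : Euc n) • coordL n j)
          ((continuous_tangDiv X.2.1).smul continuous_const) (WithLp.fstL 2 ℝ _ _ p)) =
        -integralL2 n (pointwiseLp (fun x : Sph n => (innerSL ℝ (X.1 x)).comp (rowL n j))
        (continuous_innerSL_comp_row (X.2.1.continuous.comp continuous_subtype_val) j)
          (WithLp.sndL 2 ℝ _ _ p))} := by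
    ext p
    simp only [Set.mem_iInter, Set.mem_inter_iff, Set.mem_ofPred_eq]
    refine forall_congr' fun j => and_congr ?_ ?_
    · rw [Lp.eq_zero_iff_ae_eq_zero]
      have := pointwiseLp_coeFn (fun x : Sph n => (innerSL ℝ (x : Euc n)).comp (rowL n j))
        (continuous_innerSL_comp_row continuous_subtype_val j) (WithLp.sndL 2 ℝ _ _ p)
      constructor
      · intro h
        filter_upwards [this, h] with x h1 h2
        rw [h1]
        simpa [real_inner_comm] using h2
      · intro h
        filter_upwards [this, h] with x h1 h2
        rw [h1] at h2
        simpa [real_inner_comm] using h2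
    · rw [Subtype.forall]
      refine forall_congr' fun X => forall_congr' fun hX => ?_
      rw [integralL2_apply, integralL2_apply, integral_congr_ae (pointwiseLp_coeFn _ _ _),
        integral_congr_ae (pointwiseLp_coeFn _ _ _)]
      refine Eq.congr ?_ ?_
      · congr 1
        ext x
        simp [mul_comm]
      · congr 2
        ext x
        simp [real_inner_comm]
  rw [h]
  refine isClosed_iInter fun j => IsClosed.inter ?_ (isClosed_iInter fun X => ?_)
  · exact isClosed_eq (by fun_prop) continuous_const
  · exact isClosed_eq (by fun_prop) (by fun_prop)

instance completeSpace_W12 (n : ℕ) : CompleteSpace (W12 n) :=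
  (isClosed_sobolevW12 n).completeSpace_coe

/-- A polynomial which is orthogonal in `L²` to all polynomials vanishes. -/
lemma eq_zero_of_orthogonal_polynomials {z : Lp ℝ 2 (sphereMeasure n)}
    (h : ∀ q : RPoly n, ⟪toL2 q, z⟫ = 0) : z = 0 := by
  let co : Fin n → C(Sph n, ℝ) := fun i => ⟨fun x => (x : Euc n) i, continuous_coord_sphere i⟩
  let T : RPoly n →ₐ[ℝ] C(Sph n, ℝ) := MvPolynomial.aeval co
  have hT : ∀ q (x : Sph n), T q x = ev q x := by
    intro q x
    induction q using MvPolynomial.induction_on with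
    | C a => simp [T]
    | add p q hp hq => rw [map_add, ContinuousMap.add_apply, hp, hq, ev_add]
    | mul_X p i hp =>
      rw [map_mul, ContinuousMap.mul_apply, hp, ev_mul, ev_X]
      simp [T, co]
  have hsep : T.range.SeparatesPoints := by
    intro x y hxy
    have : ∃ i, (x : Euc n) i ≠ (y : Euc n) i := by
      by_contra hcon
      push Not at hcon
      exact hxy (Subtype.ext (by ext i; exact hcon i))
    obtain ⟨i, hi⟩ := this
    exact ⟨T (MvPolynomial.X i), ⟨_, ⟨_, rfl⟩, rfl⟩, by simpa [hT] using hi⟩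
  -- Stone–Weierstrass: orthogonality passes from polynomials to all continuous functions, in
  -- particular to the smooth test functions that detect zero.
  have hdense := ContinuousMap.subalgebra_topologicalClosure_eq_top_of_separatesPoints _ hsep
  have hTq : ∀ q, ContinuousMap.toLp 2 (sphereMeasure n) ℝ (T q) = toL2 q := by
    intro q
    refine Lp.ext ?_
    filter_upwards [ContinuousMap.coeFn_toLp (p := 2) (𝕜 := ℝ) (sphereMeasure n) (T q),
      (memLp_sphere_of_continuous (continuous_ev_sphere q)).coeFn_toLp] with x h1 h2
    have h2' : toL2 q x = ev q x := h2
    rw [h1, h2', hT]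
  have hall : ∀ φ : C(Sph n, ℝ), ⟪ContinuousMap.toLp 2 (sphereMeasure n) ℝ φ, z⟫ = 0 := by
    intro φ
    have hcl : IsClosed {φ : C(Sph n, ℝ) |
        ⟪ContinuousMap.toLp 2 (sphereMeasure n) ℝ φ, z⟫ = 0} :=
      isClosed_eq (by fun_prop) continuous_const
    have hsub : (T.range : Set C(Sph n, ℝ)) ⊆ {φ : C(Sph n, ℝ) |
        ⟪ContinuousMap.toLp 2 (sphereMeasure n) ℝ φ, z⟫ = 0} := by
      rintro _ ⟨q, rfl⟩
      simpa [hTq] using h q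
    have hmem : φ ∈ T.range.topologicalClosure := by
      rw [hdense]
      trivial
    exact closure_minimal hsub hcl hmem
  refine (Lp.eq_zero_iff_ae_eq_zero).2 (eq_zero_of_forall_test
    ((Lp.memLp z).integrable one_le_two) fun φ hφ => ?_)
  have h1 := hall ⟨fun x => φ x, hφ.continuous.comp continuous_subtype_val⟩
  rw [L2.inner_def] at h1
  rw [← h1]
  refine integral_congr_ae ?_
  filter_upwards [ContinuousMap.coeFn_toLp (p := 2) (𝕜 := ℝ) (sphereMeasure n)
    (⟨fun x => φ x, hφ.continuous.comp continuous_subtype_val⟩ : C(Sph n, ℝ))] with x hx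
  rw [hx]
  simp [mul_comm]

/-- Polynomials have their tangential gradients as weak gradients. -/
lemma isWeakTangGrad_ev (p : RPoly n) :
    IsWeakTangGrad (fun x : Sph n => ev p x) (fun x : Sph n => tgrad p x) := by
  refine ⟨.of_forall fun x => inner_tgrad_sphere p x, fun X hX => ?_⟩
  obtain ⟨hXs, hXt⟩ := hX
  have hXi : ∀ i, ContDiff ℝ 1 fun y => X y i := fun i =>
    ((EuclideanSpace.proj (𝕜 := ℝ) i).contDiff.comp hXs).of_le (by simp)
  have hp1 : ContDiff ℝ 1 (ev p) := (contDiff_ev p).of_le (by simp)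
  have hdX : ∀ i y v, fderiv ℝ (fun y => X y i) y v = fderiv ℝ X y v i := by
    intro i y v
    have h := (EuclideanSpace.proj (𝕜 := ℝ) i).hasFDerivAt.comp y
      ((hXs.differentiable (by simp) y).hasFDerivAt)
    have h' : HasFDerivAt (fun y => X y i)
      ((EuclideanSpace.proj (𝕜 := ℝ) i).comp (fderiv ℝ X y)) y := h
    rw [h'.fderiv]
    rfl
  have hd : ∀ i (y v : Euc n), fderiv ℝ (fun y => ev p y * X y i) y v =
      ev p y * fderiv ℝ X y v i + X y i * fderiv ℝ (ev p) y v := by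
    intro i y v
    rw [(((hp1.differentiable (by simp) y).hasFDerivAt).fun_mul
      (((hXi i).differentiable (by simp) y).hasFDerivAt)).fderiv]
    simp [hdX]
  have key : ∀ i, ∫ x : Sph n, (ev p x * fderiv ℝ X x (EuclideanSpace.single i 1) i
      + X x i * fderiv ℝ (ev p) x (EuclideanSpace.single i 1)
      - (x : Euc n) i * (ev p x * fderiv ℝ X x x i + X x i * fderiv ℝ (ev p) x x
        + ((n : ℝ) - 1) * (ev p x * X x i))) ∂sphereMeasure n = 0 := by
    intro i
    have h := integral_fderiv_single i (hp1.mul (hXi i))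
    simp only [hd] at h
    rw [integral_sub, sub_eq_zero]
    · exact h
    all_goals
      refine integrable_sphere_of_continuous ?_
      have c1 : Continuous fun x : Sph n => ev p x := continuous_ev_sphere p
      have c2 : Continuous fun x : Sph n => X x :=
        hXs.continuous.comp continuous_subtype_val
      have c3 : Continuous fun x : Sph n => fderiv ℝ X x :=
        (hXs.continuous_fderiv (by simp)).comp continuous_subtype_val
      have c4 : Continuous fun x : Sph n => fderiv ℝ (ev p) x :=
        (hp1.continuous_fderiv (by simp)).comp continuous_subtype_val
      fun_prop
  have hI : ∀ i, Integrable (fun x : Sph n =>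
      ev p x * fderiv ℝ X x (EuclideanSpace.single i 1) i
      + X x i * fderiv ℝ (ev p) x (EuclideanSpace.single i 1)
      - (x : Euc n) i * (ev p x * fderiv ℝ X x x i + X x i * fderiv ℝ (ev p) x x
        + ((n : ℝ) - 1) * (ev p x * X x i))) (sphereMeasure n) := by
    intro i
    refine integrable_sphere_of_continuous ?_
    have c1 : Continuous fun x : Sph n => ev p x := continuous_ev_sphere p
    have c2 : Continuous fun x : Sph n => X x :=
      hXs.continuous.comp continuous_subtype_val
    have c3 : Continuous fun x : Sph n => fderiv ℝ X x :=
      (hXs.continuous_fderiv (by simp)).comp continuous_subtype_val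
    have c4 : Continuous fun x : Sph n => fderiv ℝ (ev p) x :=
      (hp1.continuous_fderiv (by simp)).comp continuous_subtype_val
    fun_prop
  have hsum := Finset.sum_eq_zero fun i (_ : i ∈ Finset.univ) => key i
  rw [← integral_finsetSum _ fun i _ => hI i] at hsum
  rw [eq_neg_iff_add_eq_zero, ← integral_add, ← hsum]
  · refine integral_congr_ae (.of_forall fun x => ?_)
    have hXx : ∑ i, (x : Euc n) i * X x i = 0 := by
      rw [← inner_eq_sum, real_inner_comm, hXt]
    have e1 : ⟪tgrad p x, X x⟫ = ∑ i, X x i * fderiv ℝ (ev p) x (EuclideanSpace.single i 1) := by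
      have hXt' : ⟪(x : Euc n), X x⟫ = 0 := by rw [real_inner_comm, hXt]
      rw [tgrad, inner_sub_left, real_inner_smul_left, hXt', inner_eq_sum]
      simp only [fderiv_ev_single, mul_zero, sub_zero]
      exact Finset.sum_congr rfl fun i _ => mul_comm _ _
    have e2 : ∀ i, ev p x * fderiv ℝ X x (EuclideanSpace.single i 1) i
      + X x i * fderiv ℝ (ev p) x (EuclideanSpace.single i 1)
      - (x : Euc n) i * (ev p x * fderiv ℝ X x x i + X x i * fderiv ℝ (ev p) x x
        + ((n : ℝ) - 1) * (ev p x * X x i)) =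
      ev p x * fderiv ℝ X x (EuclideanSpace.single i 1) i
      + X x i * fderiv ℝ (ev p) x (EuclideanSpace.single i 1)
      - ev p x * (fderiv ℝ X x x i * (x : Euc n) i) - (fderiv ℝ (ev p) x x
        + ((n : ℝ) - 1) * ev p x) * ((x : Euc n) i * X x i) := by
      intro i
      ring
    simp only [e1, e2, Finset.sum_add_distrib, Finset.sum_sub_distrib, ← Finset.mul_sum, hXx,
      tangDiv, inner_eq_sum (fderiv ℝ X x x)]
    ring
  · exact integrable_sphere_of_continuous ((continuous_ev_sphere p).mul (continuous_tangDiv hXs))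
  · exact integrable_sphere_of_continuous ((continuous_tgrad_sphere p).inner
      (hXs.continuous.comp continuous_subtype_val))

/-- The gradient of a polynomial field. -/
def evGrad (w : Fin n → RPoly n) (x : Euc n) : Grad n := WithLp.toLp 2 fun j => tgrad (w j) x

@[simp] lemma evGrad_apply (w : Fin n → RPoly n) (x : Euc n) (j : Fin n) :
    evGrad w x j = tgrad (w j) x := rfl

lemma continuous_evVec_sphere (w : Fin n → RPoly n) : Continuous fun x : Sph n => evVec w x :=
  (PiLp.continuous_toLp 2 _).comp (continuous_pi fun j => continuous_ev_sphere (w j))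

lemma continuous_evGrad_sphere (w : Fin n → RPoly n) : Continuous fun x : Sph n => evGrad w x :=
  (PiLp.continuous_toLp 2 _).comp (continuous_pi fun j => continuous_tgrad_sphere (w j))

/-- The element of `W^{1,2}` defined by a polynomial field. -/
def polyMap (w : Fin n → RPoly n) : W12 n :=
  ⟨WithLp.toLp 2 ((memLp_sphere_of_continuous (continuous_evVec_sphere w)).toLp,
    (memLp_sphere_of_continuous (continuous_evGrad_sphere w)).toLp), by
    intro j
    have h1 := (memLp_sphere_of_continuous (continuous_evVec_sphere w)).coeFn_toLp
    have h2 := (memLp_sphere_of_continuous (continuous_evGrad_sphere w)).coeFn_toLp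
    obtain ⟨h3, h4⟩ := isWeakTangGrad_ev (w j)
    refine ⟨?_, fun X hX => ?_⟩
    · filter_upwards [h2, h3] with x hx hx'
      exact (congrArg (fun g : Grad n => ⟪g j, (x : Euc n)⟫) hx).trans hx'
    · have h5 := h4 X hX
      refine Eq.trans ?_ (h5.trans (congrArg Neg.neg ?_))
      · refine integral_congr_ae ?_
        filter_upwards [h1] with x hx
        exact congrArg (fun v : Euc n => v j * tangDiv X (x : Euc n)) hx
      · refine integral_congr_ae ?_
        filter_upwards [h2] with x hx
        exact (congrArg (fun g : Grad n => ⟪g j, X (x : Euc n)⟫) hx).symm⟩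

lemma polyMap_fn (w : Fin n → RPoly n) :
    (polyMap w).fn =ᵐ[sphereMeasure n] fun x => evVec w x :=
  (memLp_sphere_of_continuous (continuous_evVec_sphere w)).coeFn_toLp

lemma polyMap_grad (w : Fin n → RPoly n) :
    (polyMap w).grad =ᵐ[sphereMeasure n] fun x => evGrad w x :=
  (memLp_sphere_of_continuous (continuous_evGrad_sphere w)).coeFn_toLp

lemma polyMap_add (v w : Fin n → RPoly n) : polyMap (v + w) = polyMap v + polyMap w := by
  apply W12.eq_of_fn_ae
  filter_upwards [polyMap_fn (v + w), polyMap_fn v, polyMap_fn w,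
    W12.fn_add (polyMap v) (polyMap w)] with x h1 h2 h3 h4
  rw [h1, h4, Pi.add_apply, h2, h3]
  ext j
  simp

lemma polyMap_smul (c : ℝ) (w : Fin n → RPoly n) : polyMap (c • w) = c • polyMap w := by
  apply W12.eq_of_fn_ae
  filter_upwards [polyMap_fn (c • w), polyMap_fn w, W12.fn_smul c (polyMap w)] with x h1 h2 h3
  rw [h1, h3, Pi.smul_apply, h2]
  ext j
  simp

/-- Polynomial fields as elements of `W^{1,2}`. -/
def polyMapL (n : ℕ) : (Fin n → RPoly n) →ₗ[ℝ] W12 n where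
  toFun := polyMap
  map_add' := polyMap_add
  map_smul' := polyMap_smul

lemma polyMap_sub (v w : Fin n → RPoly n) : polyMap (v - w) = polyMap v - polyMap w :=
  map_sub (polyMapL n) v w

lemma W12.inner_eq (v w : W12 n) : ⟪v, w⟫ = ∫ x, ⟪v.fn x, w.fn x⟫ ∂sphereMeasure n
    + ∫ x, ⟪v.grad x, w.grad x⟫ ∂sphereMeasure n := by
  have : ⟪v, w⟫ = ⟪(v : L2Pair n), (w : L2Pair n)⟫ := rfl
  rw [this, WithLp.prod_inner_apply, L2.inner_def, L2.inner_def]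
  rfl

lemma inner_polyMap (v w : Fin n → RPoly n) :
    ⟪polyMap v, polyMap w⟫ = ∑ j, (sInt (v j * w j) + dirichlet (v j) (w j)) := by
  rw [W12.inner_eq, Finset.sum_add_distrib]
  congr 1
  · rw [← map_sum]
    refine integral_congr_ae ?_
    filter_upwards [polyMap_fn v, polyMap_fn w] with x h1 h2
    rw [h1, h2, inner_eq_sum]
    simp
  · simp only [dirichlet]
    rw [← integral_finsetSum _ fun j _ => integrable_inner_tgrad _ _]
    refine integral_congr_ae ?_
    filter_upwards [polyMap_grad v, polyMap_grad w] with x h1 h2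
    rw [h1, h2, PiLp.inner_apply]
    rfl

lemma tangDiv_tgrad (q : RPoly n) (x : Sph n) : tangDiv (tgrad q) (x : Euc n) = ev (sphLap q) x := by
  have hd : ∀ (i : Fin n) (y v : Euc n), fderiv ℝ (tgrad q) y v i =
      fderiv ℝ (ev (MvPolynomial.pderiv i q - MvPolynomial.X i * euler q)) y v := by
    intro i y v
    have h := (EuclideanSpace.proj (𝕜 := ℝ) i).hasFDerivAt.comp y
      (((contDiff_tgrad q).differentiable (by simp) y).hasFDerivAt)
    have h' : HasFDerivAt (fun y => tgrad q y i)
      ((EuclideanSpace.proj (𝕜 := ℝ) i).comp (fderiv ℝ (tgrad q) y)) y := h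
    have e : (ev (MvPolynomial.pderiv i q - MvPolynomial.X i * euler q) : Euc n → ℝ) =
        fun y => tgrad q y i := by
      funext z
      simp [tgrad_apply, mul_comm]
    rw [e, h'.fderiv]
    rfl
  rw [← ev_tangDiv_tgrad, tangDiv, inner_eq_sum]
  simp only [hd, fderiv_ev_single, fderiv_ev_self, ev_sub, ev_sum, ev_mul, ev_X]
  congr 1
  exact Finset.sum_congr rfl fun i _ => mul_comm _ _

/-- A component of an element of `W^{1,2}`, as an element of `L²`. -/
def W12.comp (z : W12 n) (j : Fin n) : Lp ℝ 2 (sphereMeasure n) :=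
  (memLp_coord (z : L2Pair n).fst j).toLp

lemma W12.comp_coeFn (z : W12 n) (j : Fin n) :
    z.comp j =ᵐ[sphereMeasure n] fun x => z.fn x j :=
  (memLp_coord (z : L2Pair n).fst j).coeFn_toLp

lemma inner_toL2_comp (q : RPoly n) (z : W12 n) (j : Fin n) :
    ⟪toL2 q, z.comp j⟫ = ∫ x : Sph n, z.fn x j * ev q x ∂sphereMeasure n := by
  rw [L2.inner_def]
  refine integral_congr_ae ?_
  filter_upwards [(memLp_sphere_of_continuous (continuous_ev_sphere q)).coeFn_toLp,
    z.comp_coeFn j] with x h1 h2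
  have h1' : toL2 q x = ev q x := h1
  rw [h1', h2]
  rfl

/-- The tangential gradient of `q` is an admissible test field, so the weak gradient of `z` can be
traded for the spherical Laplacian of `q`. -/
lemma inner_polyMap_single (z : W12 n) (j : Fin n) (q : RPoly n) :
    ⟪z, polyMap (Pi.single j q)⟫ = ⟪toL2 (q - sphLap q), z.comp j⟫ := by
  have hfn : ∫ x, ⟪z.fn x, (polyMap (Pi.single j q)).fn x⟫ ∂sphereMeasure n =
      ∫ x : Sph n, z.fn x j * ev q x ∂sphereMeasure n := by
    refine integral_congr_ae ?_
    filter_upwards [polyMap_fn (Pi.single j q)] with x hx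
    rw [hx, inner_eq_sum, Finset.sum_eq_single j]
    · simp
    · intro i _ hij
      simp [hij]
    · simp
  have hgr : ∫ x, ⟪z.grad x, (polyMap (Pi.single j q)).grad x⟫ ∂sphereMeasure n =
      ∫ x : Sph n, ⟪z.grad x j, tgrad q x⟫ ∂sphereMeasure n := by
    refine integral_congr_ae ?_
    filter_upwards [polyMap_grad (Pi.single j q)] with x hx
    have h0 : tgrad (0 : RPoly n) (x : Euc n) = 0 := by
      rw [← MvPolynomial.C_0, tgrad_C]
    rw [hx, PiLp.inner_apply, Finset.sum_eq_single j]
    · simp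
    · intro i _ hij
      simp [hij, h0]
    · simp
  have hw := (z.2 j).2 (tgrad q) ⟨contDiff_tgrad q, inner_tgrad_sphere q⟩
  simp only [tangDiv_tgrad] at hw
  have hw' : ∫ x : Sph n, z.fn x j * ev (sphLap q) x ∂sphereMeasure n =
      -∫ x : Sph n, ⟪z.grad x j, tgrad q x⟫ ∂sphereMeasure n := hw
  rw [W12.inner_eq, hfn, hgr, map_sub, inner_sub_left, inner_toL2_comp, inner_toL2_comp, hw']
  ring

/-- Orthogonality in `W^{1,2}` is `L²` orthogonality to all `q - sphLap q`. For homogeneous `q` of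
degree `k` this is `(1 + k (k + n - 2)) q` minus its flat Laplacian; the first factor is positive
and the Laplacian has lower degree, so induction on `k` gives `L²` orthogonality to all polynomials.
-/
lemma eq_zero_of_orthogonal_polyMap (hn : 2 ≤ n) {z : W12 n} (h : ∀ w, ⟪z, polyMap w⟫ = 0) :
    z = 0 := by
  have h1 : ∀ j q, ⟪toL2 (q - sphLap q), z.comp j⟫ = 0 := fun j q => by
    rw [← inner_polyMap_single, h]
  have h2 : ∀ (j : Fin n) (k : ℕ) (q : RPoly n), q.IsHomogeneous k → ⟪toL2 q, z.comp j⟫ = 0 := by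
    intro j k
    induction k using Nat.strong_induction_on with
    | _ k ih =>
      intro q hq
      have h3 := h1 j q
      rw [sphLap_of_isHomogeneous hq] at h3
      have h4 : ⟪toL2 (flatLap q), z.comp j⟫ = 0 := by
        rcases Nat.eq_zero_or_pos k with rfl | hk
        · rw [flatLap_apply]
          have : ∀ i, MvPolynomial.pderiv i q = 0 := by
            intro i
            rw [MvPolynomial.totalDegree_eq_zero_iff_eq_C.1
              (Nat.le_zero.1 hq.totalDegree_le), MvPolynomial.pderiv_C]
          simp [this]
        · exact ih _ (by omega) _ (isHomogeneous_flatLap hq)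
      rw [map_sub, map_sub, map_smul, inner_sub_left, inner_sub_left, h4, real_inner_smul_left]
        at h3
      have h5 : (0 : ℝ) ≤ (k : ℝ) * (k + n - 2) := by
        have : (2 : ℝ) ≤ n := by exact_mod_cast hn
        have hk : (0 : ℝ) ≤ k := k.cast_nonneg
        exact mul_nonneg hk (by linarith)
      have h6 : (1 + (k : ℝ) * (k + n - 2)) * ⟪toL2 q, z.comp j⟫ = 0 := by linarith
      exact (mul_eq_zero.1 h6).resolve_left (by linarith)
  have h3 : ∀ j, z.comp j = 0 := by
    intro j
    refine eq_zero_of_orthogonal_polynomials fun q => ?_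
    rw [← MvPolynomial.sum_homogeneousComponent q, map_sum, sum_inner]
    exact Finset.sum_eq_zero fun k _ =>
      h2 j k _ (MvPolynomial.homogeneousComponent_isHomogeneous k q)
  apply W12.eq_of_fn_ae
  have h4 : ∀ᵐ x ∂sphereMeasure n, ∀ j, z.fn x j = 0 := by
    rw [ae_all_iff]
    intro j
    have h5 := z.comp_coeFn j
    rw [h3] at h5
    filter_upwards [h5, Lp.coeFn_zero ℝ 2 (sphereMeasure n)] with x hx hx'
    rw [← hx, hx']
    rfl
  filter_upwards [h4, W12.fn_zero (n := n)] with x hx hx'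
  rw [hx']
  ext j
  exact hx j

lemma dense_range_polyMap (hn : 2 ≤ n) : DenseRange (polyMap (n := n)) := by
  have h : (LinearMap.range (polyMapL n)).topologicalClosure = ⊤ := by
    rw [Submodule.topologicalClosure_eq_top_iff, Submodule.eq_bot_iff]
    intro z hz
    refine eq_zero_of_orthogonal_polyMap hn fun w => ?_
    rw [real_inner_comm]
    exact hz _ ⟨w, rfl⟩
  have h2 : Dense (LinearMap.range (polyMapL n) : Set (W12 n)) :=
    Submodule.dense_iff_topologicalClosure_eq_top.2 h
  exact h2

end FunctionalAnalysis

/-! ### The quadratic form on `W^{1,2}` -/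

section QuadraticForm

variable {n : ℕ}

/-- The underlying map, as a continuous linear operator. -/
def fnLp (n : ℕ) : W12 n →L[ℝ] Lp (Euc n) 2 (sphereMeasure n) :=
  (WithLp.fstL 2 ℝ _ _).comp (sobolevW12 n).subtypeL

/-- The gradient, as a continuous linear operator. -/
def gradLp (n : ℕ) : W12 n →L[ℝ] Lp (Grad n) 2 (sphereMeasure n) :=
  (WithLp.sndL 2 ℝ _ _).comp (sobolevW12 n).subtypeL

/-- The trace of a gradient. -/
def traceL (n : ℕ) : Grad n →L[ℝ] ℝ := ∑ j, (coordL n j).comp (rowL n j)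

lemma traceL_apply (g : Grad n) : traceL n g = ∑ j, g j j := by
  simp [traceL]

/-- The tangential divergence, as a continuous linear operator. -/
def divLp (n : ℕ) : W12 n →L[ℝ] Lp ℝ 2 (sphereMeasure n) :=
  (pointwiseLp (fun _ => traceL n) continuous_const).comp (gradLp n)

lemma divLp_coeFn (w : W12 n) : divLp n w =ᵐ[sphereMeasure n] w.div := by
  filter_upwards [pointwiseLp_coeFn (fun _ : Sph n => traceL n) continuous_const (gradLp n w)]
    with x hx
  refine hx.trans ?_
  rw [traceL_apply]
  rfl

/-- The coefficients of the operator `A`. -/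
def opAFamily (n : ℕ) (x : Sph n) : Grad n →L[ℝ] Euc n :=
  (traceL n).smulRight (x : Euc n) - ∑ j, (x : Euc n) j • rowL n j

lemma continuous_opAFamily (n : ℕ) : Continuous (opAFamily n) := by
  refine Continuous.sub ?_ (continuous_finsetSum _ fun j _ =>
    (continuous_coord_sphere j).smul continuous_const)
  exact ((ContinuousLinearMap.smulRightL ℝ (Grad n) (Euc n)) (traceL n)).continuous.comp
    continuous_subtype_val

/-- The operator `A`, as a continuous linear operator. -/
def opALp (n : ℕ) : W12 n →L[ℝ] Lp (Euc n) 2 (sphereMeasure n) :=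
  (pointwiseLp (opAFamily n) (continuous_opAFamily n)).comp (gradLp n)

lemma opALp_coeFn (w : W12 n) : opALp n w =ᵐ[sphereMeasure n] w.opA := by
  filter_upwards [pointwiseLp_coeFn (opAFamily n) (continuous_opAFamily n) (gradLp n w)]
    with x hx
  refine hx.trans ?_
  simp only [opAFamily, _root_.sub_apply, ContinuousLinearMap.smulRight_apply,
    traceL_apply, _root_.sum_apply, _root_.smul_apply]
  rfl

lemma quadQ_eq (w : W12 n) : quadQ n w = (n : ℝ) / (2 * ((n : ℝ) - 1)) *
    (⟪gradLp n w, gradLp n w⟫ + ((n : ℝ) - 3) / ((n : ℝ) - 1) * ⟪divLp n w, divLp n w⟫)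
      - (n : ℝ) / 2 * ⟪fnLp n w, opALp n w⟫ := by
  have hA : ⟪fnLp n w, opALp n w⟫ = ∫ x, ⟪w.fn x, w.opA x⟫ ∂sphereMeasure n := by
    rw [L2.inner_def]
    refine integral_congr_ae ?_
    filter_upwards [opALp_coeFn w] with x hx
    rw [hx]
    rfl
  have hi1 := L2.integrable_inner (𝕜 := ℝ) (gradLp n w) (gradLp n w)
  have hi2 := L2.integrable_inner (𝕜 := ℝ) (divLp n w) (divLp n w)
  have hG : ∫ x, (‖w.grad x‖ ^ 2 + ((n : ℝ) - 3) / ((n : ℝ) - 1) * w.div x ^ 2) ∂sphereMeasure n =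
      ⟪gradLp n w, gradLp n w⟫ + ((n : ℝ) - 3) / ((n : ℝ) - 1) * ⟪divLp n w, divLp n w⟫ := by
    rw [L2.inner_def, L2.inner_def, ← integral_const_mul, ← integral_add hi1 (hi2.const_mul _)]
    refine integral_congr_ae ?_
    filter_upwards [divLp_coeFn w] with x hx
    rw [hx, real_inner_self_eq_norm_sq, real_inner_self_eq_norm_sq, Real.norm_eq_abs, sq_abs]
    rfl
  rw [quadQ, hA, hG]

lemma continuous_quadQ (n : ℕ) : Continuous (quadQ n) := by
  rw [funext quadQ_eq]
  fun_prop

lemma inner_add_smul_add_smul {E : Type*} [NormedAddCommGroup E] [InnerProductSpace ℝ E]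
    (t : ℝ) (a b c d : E) : ⟪a + t • b, c + t • d⟫ =
      ⟪a, c⟫ + t * (⟪a, d⟫ + ⟪b, c⟫) + t ^ 2 * ⟪b, d⟫ := by
  rw [inner_add_left, inner_add_right, inner_add_right, real_inner_smul_left,
    real_inner_smul_left, real_inner_smul_right, real_inner_smul_right]
  ring

/-- Only bilinearity of the three pairings is used, so the function spaces are kept abstract. -/
lemma exists_expansion_add_smul {E F G D : Type*} [NormedAddCommGroup E] [NormedSpace ℝ E]
    [NormedAddCommGroup F] [InnerProductSpace ℝ F] [NormedAddCommGroup G] [InnerProductSpace ℝ G]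
    [NormedAddCommGroup D] [InnerProductSpace ℝ D] (g : E →L[ℝ] G) (d : E →L[ℝ] D)
    (f a : E →L[ℝ] F) (α β γ : ℝ) {q : E → ℝ}
    (hq : ∀ w, q w = α * (⟪g w, g w⟫ + β * ⟪d w, d w⟫) - γ * ⟪f w, a w⟫) (v w : E) :
    ∃ B : ℝ, ∀ t : ℝ, q (w + t • v) = q w + t * B + t ^ 2 * q v := by
  refine ⟨α * ((⟪g w, g v⟫ + ⟪g v, g w⟫) + β * (⟪d w, d v⟫ + ⟪d v, d w⟫))
    - γ * (⟪f w, a v⟫ + ⟪f v, a w⟫), fun t => ?_⟩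
  simp only [hq, map_add, map_smul, inner_add_smul_add_smul]
  ring

lemma quadQ_add_smul (t : ℝ) (v w : W12 n) :
    quadQ n (w + t • v) = quadQ n w + t * QuadraticMap.polar (quadQ n) v w
      + t ^ 2 * quadQ n v := by
  obtain ⟨B, hB⟩ := exists_expansion_add_smul (gradLp n) (divLp n) (fnLp n) (opALp n) _ _ _
    quadQ_eq v w
  have h1 := hB 1
  rw [one_smul] at h1
  rw [hB, QuadraticMap.polar, add_comm v w, h1]
  ring

/-- The polynomial `t ↦ Q (w + t v)` is nonnegative and has no constant term, so its discriminant,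
the square of the linear coefficient, cannot be positive. -/
lemma polar_eq_zero_of_nonneg {H : Submodule ℝ (W12 n)} (hH : ∀ v ∈ H, 0 ≤ quadQ n v)
    {v w : W12 n} (hv : v ∈ H) (hw : w ∈ H) (h0 : quadQ n w = 0) :
    QuadraticMap.polar (quadQ n) v w = 0 := by
  have h : ∀ t : ℝ, 0 ≤ quadQ n v * (t * t) + QuadraticMap.polar (quadQ n) v w * t + 0 := by
    intro t
    have := hH _ (H.add_mem hw (H.smul_mem t hv))
    rw [quadQ_add_smul, h0] at this
    linarith
  have hd := discrim_le_zero h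
  rw [discrim] at hd
  nlinarith [sq_nonneg (QuadraticMap.polar (quadQ n) v w)]

lemma quadQ_polyMap (hn : 2 ≤ n) (w : Fin n → RPoly n) :
    quadQ n (polyMap w) = (n : ℝ) / (2 * ((n : ℝ) - 1)) *
      ∫ x : Sph n, energyDensity w x ∂sphereMeasure n := by
  have h2 : (2 : ℝ) ≤ n := by exact_mod_cast hn
  have hm : (n : ℝ) - 1 ≠ 0 := by linarith
  have h := fun j => continuous_tgrad_sphere (n := n) (w j)
  have h' : ∀ j, Continuous fun x : Sph n => tgrad (w j) x j := fun j =>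
    (EuclideanSpace.proj (𝕜 := ℝ) j).continuous.comp (h j)
  have hx := fun j => continuous_coord_sphere (n := n) j
  have hw := continuous_evVec_sphere w
  have e1 : ∫ x, (‖(polyMap w).grad x‖ ^ 2
      + ((n : ℝ) - 3) / ((n : ℝ) - 1) * (polyMap w).div x ^ 2) ∂sphereMeasure n =
      ∫ x : Sph n, (∑ j, ⟪tgrad (w j) x, tgrad (w j) x⟫
        + ((n : ℝ) - 3) / ((n : ℝ) - 1) * (∑ j, tgrad (w j) x j) ^ 2) ∂sphereMeasure n := by
    refine integral_congr_ae ?_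
    filter_upwards [polyMap_grad w] with x hx
    rw [W12.div, hx, ← real_inner_self_eq_norm_sq, PiLp.inner_apply]
    rfl
  have e2 : ∫ x, ⟪(polyMap w).fn x, (polyMap w).opA x⟫ ∂sphereMeasure n =
      ∫ x : Sph n, ⟪evVec w x, evA w x⟫ ∂sphereMeasure n := by
    refine integral_congr_ae ?_
    filter_upwards [polyMap_fn w, polyMap_grad w] with x h1 h2
    rw [W12.opA, W12.div, h1, h2]
    rfl
  rw [quadQ, e1, e2]
  simp only [energyDensity]
  rw [integral_sub, integral_const_mul]
  · field_simp
  · exact integrable_sphere_of_continuous (by fun_prop)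
  · refine integrable_sphere_of_continuous ?_
    simp only [evA]
    fun_prop

/-- The average of a component. -/
def meanL (n : ℕ) (j : Fin n) : W12 n →L[ℝ] ℝ :=
  (integralL2 n).comp ((pointwiseLp (fun _ => coordL n j) continuous_const).comp (fnLp n))

/-- The average of the normal component. -/
def radialL (n : ℕ) : W12 n →L[ℝ] ℝ :=
  (integralL2 n).comp ((pointwiseLp (fun x : Sph n => innerSL ℝ (x : Euc n))
    ((innerSL ℝ).continuous.comp continuous_subtype_val)).comp (fnLp n))

lemma meanL_apply (j : Fin n) (w : W12 n) :
    meanL n j w = ∫ x, w.fn x j ∂sphereMeasure n := by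
  rw [meanL, ContinuousLinearMap.comp_apply, integralL2_apply]
  exact integral_congr_ae
    (pointwiseLp_coeFn (fun _ : Sph n => coordL n j) continuous_const (fnLp n w))

lemma radialL_apply (w : W12 n) :
    radialL n w = ∫ x : Sph n, ⟪w.fn x, (x : Euc n)⟫ ∂sphereMeasure n := by
  rw [radialL, ContinuousLinearMap.comp_apply, integralL2_apply]
  refine (integral_congr_ae (pointwiseLp_coeFn (fun x : Sph n => innerSL ℝ (x : Euc n))
    ((innerSL ℝ).continuous.comp continuous_subtype_val) (fnLp n w))).trans ?_
  refine integral_congr_ae (.of_forall fun x => ?_)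
  exact real_inner_comm (w.fn x) (x : Euc n)

lemma mem_spaceH_iff (w : W12 n) : w ∈ spaceH n ↔ (∀ j, meanL n j w = 0) ∧ radialL n w = 0 := by
  rw [radialL_apply]
  refine and_congr ?_ Iff.rfl
  have h : ∀ j, (∫ x, w.fn x ∂sphereMeasure n) j = meanL n j w := by
    intro j
    rw [meanL_apply]
    exact ((coordL n j).integral_comp_comm w.integrable_fn).symm
  constructor
  · intro h0 j
    rw [← h, h0]
    rfl
  · intro h0
    ext j
    rw [h, h0]
    rfl

lemma meanL_polyMap (j : Fin n) (w : Fin n → RPoly n) : meanL n j (polyMap w) = sInt (w j) := by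
  rw [meanL_apply]
  refine integral_congr_ae ?_
  filter_upwards [polyMap_fn w] with x hx
  rw [hx]
  rfl

lemma radialL_polyMap (w : Fin n → RPoly n) :
    radialL n (polyMap w) = sInt (∑ j, MvPolynomial.X j * w j) := by
  rw [radialL_apply]
  refine integral_congr_ae ?_
  filter_upwards [polyMap_fn w] with x hx
  rw [hx, inner_eq_sum]
  simp [mul_comm]

lemma polyMap_mem_spaceH_iff (w : Fin n → RPoly n) : polyMap w ∈ spaceH n ↔
    (∀ j, sInt (w j) = 0) ∧ sInt (∑ j, MvPolynomial.X j * w j) = 0 := by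
  simp only [mem_spaceH_iff, meanL_polyMap, radialL_polyMap]

/-- A continuous projection onto `H_n` which preserves polynomial fields. -/
def correction (n : ℕ) (w : W12 n) : W12 n :=
  w - ∑ j, meanL n j w • polyMap (Pi.single j 1) - radialL n w • polyMap MvPolynomial.X

lemma continuous_correction (n : ℕ) : Continuous (correction n) := by
  unfold correction
  fun_prop

lemma correction_of_mem {w : W12 n} (hw : w ∈ spaceH n) : correction n w = w := by
  obtain ⟨h1, h2⟩ := (mem_spaceH_iff w).1 hw
  simp [correction, h1, h2]

/-- The constraints are restored by subtracting constants and a multiple of the identity field. The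
two corrections do not interfere: `x` has mean zero, constants have zero normal average, and `∫ |x|²
= 1`. -/
lemma correction_polyMap (hn : 2 ≤ n) (w : Fin n → RPoly n) :
    ∃ v, correction n (polyMap w) = polyMap v ∧ polyMap v ∈ spaceH n := by
  have h2 : (2 : ℝ) ≤ n := by exact_mod_cast hn
  have hn0 : (n : ℝ) ≠ 0 := by linarith
  set s : ℝ := sInt (∑ j, MvPolynomial.X j * w j) with hs
  let v : Fin n → RPoly n := w - ∑ j, sInt (w j) • (Pi.single j (1 : RPoly n) : Fin n → RPoly n)
    - s • (MvPolynomial.X : Fin n → RPoly n)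
  refine ⟨v, ?_, ?_⟩
  · have e : polyMapL n v = polyMapL n w - ∑ j, sInt (w j) • polyMapL n
        (Pi.single j (1 : RPoly n)) - s • polyMapL n MvPolynomial.X := by
      rw [map_sub, map_sub, map_sum, map_smul]
      simp only [map_smul]
    refine Eq.trans ?_ e.symm
    simp only [correction, meanL_polyMap, radialL_polyMap]
    rfl
  · have hc : ∀ j, v j = w j - sInt (w j) • 1 - s • MvPolynomial.X j := by
      intro j
      simp only [v]
      rw [Pi.sub_apply, Pi.sub_apply, Finset.sum_apply, Finset.sum_eq_single j]
      · simp
      · intro i _ hij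
        simp [Ne.symm hij]
      · simp
    rw [polyMap_mem_spaceH_iff]
    simp only [hc]
    constructor
    · intro j
      simp [sInt_one (show 1 ≤ n by omega), sInt_X hn]
    · have e : ∀ j, (MvPolynomial.X j * (w j - sInt (w j) • 1 - s • MvPolynomial.X j) : RPoly n) =
          MvPolynomial.X j * w j - sInt (w j) • MvPolynomial.X j
            - s • (MvPolynomial.X j * MvPolynomial.X j) := by
        intro j
        rw [mul_sub, mul_sub, mul_smul_comm, mul_smul_comm, mul_one]
      simp only [e, Finset.sum_sub_distrib, map_sub, ← hs]
      simp [sInt_X hn, sInt_X_mul_X hn]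
      field_simp
      ring

end QuadraticForm

/-! ### The space `H_{n,0}` -/

section KernelSpace

open MvPolynomial

variable {n : ℕ}

lemma polyMap_congr {v w : Fin n → RPoly n} (h : ∀ (x : Sph n) j, ev (v j) x = ev (w j) x) :
    polyMap v = polyMap w := by
  apply W12.eq_of_fn_ae
  filter_upwards [polyMap_fn v, polyMap_fn w] with x h1 h2
  rw [h1, h2]
  ext j
  exact h x j

lemma isRestriction_polyMap (w : Fin n → RPoly n) : IsRestriction (polyMap w) w := by
  filter_upwards [polyMap_fn w] with x hx j
  rw [hx]
  rfl

lemma IsRestriction.eq_polyMap {w : W12 n} {p : Fin n → RPoly n} (h : IsRestriction w p) :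
    w = polyMap p := by
  apply W12.eq_of_fn_ae
  filter_upwards [h, polyMap_fn p] with x h1 h2
  rw [h2]
  ext j
  exact h1 j

lemma polyDiv_lin (M : Fin n → Fin n → ℝ) : polyDiv (fun j => lin (M j)) = C (∑ j, M j j) := by
  simp [polyDiv, pderiv_lin]

/-- The radial terms `⟨M x, x⟩ x` of the two summands cancel, which leaves trace times `x` minus the
transpose applied to `x`. For trace zero, `A w = w` thus says that `M` is skew. -/
lemma evA_lin (M : Fin n → Fin n → ℝ) (x : Sph n) :
    evA (fun j => lin (M j)) x =
      (∑ j, M j j) • (x : Euc n) - WithLp.toLp 2 fun i => ∑ j, M j i * (x : Euc n) j := by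
  ext i
  have h1 : ∑ j, (M j j - (∑ k, M j k * (x : Euc n) k) * (x : Euc n) j) =
      ∑ j, M j j - ∑ j, (∑ k, M j k * (x : Euc n) k) * (x : Euc n) j := Finset.sum_sub_distrib ..
  have h2 : ∑ j, (x : Euc n) j * (M j i - (∑ k, M j k * (x : Euc n) k) * (x : Euc n) i) =
      ∑ j, M j i * (x : Euc n) j
        - (∑ j, (∑ k, M j k * (x : Euc n) k) * (x : Euc n) j) * (x : Euc n) i := by
    rw [Finset.sum_mul, ← Finset.sum_sub_distrib]
    exact Finset.sum_congr rfl fun j _ => by ring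
  simp only [evA, tgrad_lin, PiLp.sub_apply, PiLp.smul_apply, smul_eq_mul, WithLp.ofLp_sum,
    Finset.sum_apply, WithLp.ofLp_sub, WithLp.ofLp_smul, Pi.sub_apply, Pi.smul_apply]
  rw [h1, h2]
  ring

lemma opA_polyMap (w : Fin n → RPoly n) :
    (polyMap w).opA =ᵐ[sphereMeasure n] fun x => evA w x := by
  filter_upwards [polyMap_grad w] with x hx
  rw [W12.opA, W12.div, hx]
  rfl

lemma continuous_evA_sphere (w : Fin n → RPoly n) : Continuous fun x : Sph n => evA w x := by
  have h := fun j => continuous_tgrad_sphere (n := n) (w j)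
  have h' : ∀ j, Continuous fun x : Sph n => tgrad (w j) x j := fun j =>
    (EuclideanSpace.proj (𝕜 := ℝ) j).continuous.comp (h j)
  have hx := fun j => continuous_coord_sphere (n := n) j
  simp only [evA]
  fun_prop

/-- Both sides are continuous and the surface measure charges every open set, so equality almost
everywhere is equality everywhere. -/
lemma opA_polyMap_eq_smul_iff {c : ℝ} {w : Fin n → RPoly n} :
    (∀ᵐ x ∂sphereMeasure n, (polyMap w).opA x = c • (polyMap w).fn x) ↔
      ∀ x : Sph n, evA w x = c • evVec w x := by
  have h : (∀ᵐ x ∂sphereMeasure n, (polyMap w).opA x = c • (polyMap w).fn x) ↔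
      (fun x : Sph n => evA w x) =ᵐ[sphereMeasure n] fun x : Sph n => c • evVec w x := by
    refine Filter.eventually_congr ?_
    filter_upwards [opA_polyMap w, polyMap_fn w] with x h1 h2
    rw [h1, h2]
  rw [h, (continuous_evA_sphere w).ae_eq_iff_eq _ (g := fun x : Sph n => c • evVec w x)
    ((continuous_evVec_sphere w).const_smul c), funext_iff]

/-- `H_{n,1,2}` consists of the infinitesimal rotations. -/
lemma mem_spaceHk2_one_iff (hn : 2 ≤ n) (w : W12 n) : w ∈ spaceHk2 n 1 ↔
    ∃ S : Fin n → Fin n → ℝ, (∀ i j, S i j = -S j i) ∧ w = polyMap fun j => lin (S j) := by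
  constructor
  · rintro ⟨⟨hH, p, hp, hwp, hdiv⟩, hA⟩
    obtain rfl := hwp.eq_polyMap
    choose M hM using fun j => exists_coeff_of_isHomogeneous_one (hp j).1
    obtain rfl : p = fun j => lin (M j) := funext hM
    refine ⟨M, fun i k => ?_, rfl⟩
    rw [polyDiv_lin, C_eq_zero] at hdiv
    rw [opA_polyMap_eq_smul_iff] at hA
    -- At the point `e_k` the `i`-th component of the eigenvalue equation is `-M k i = M i k`.
    have h := congrArg (fun v : Euc n => v i)
      (hA ⟨EuclideanSpace.single k 1, by simp⟩)
    rw [evA_lin, hdiv] at h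
    simp at h
    linarith
  · rintro ⟨S, hS, rfl⟩
    have hd : ∀ j, S j j = 0 := fun j => by linarith [hS j j]
    refine ⟨⟨?_, _, fun j => ⟨isHomogeneous_lin _, flatLap_lin _⟩, isRestriction_polyMap _, ?_⟩, ?_⟩
    · rw [polyMap_mem_spaceH_iff]
      simp [sInt_lin hn, sInt_X_mul_lin hn, hd]
    · simp [polyDiv_lin, hd]
    · rw [opA_polyMap_eq_smul_iff]
      intro x
      rw [evA_lin]
      ext i
      simp only [hd]
      simp [Finset.sum_neg_distrib, fun j => hS j i]

/-- The harmonic representative of the conformal gradient field with parameter `e`. -/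
def harmonicConformal (e : Fin n → ℝ) (j : Fin n) : RPoly n :=
  (e j / n) • (∑ i, X i * X i) - X j * lin e

lemma polyMap_harmonicConformal (e : Fin n → ℝ) :
    polyMap (harmonicConformal e) = polyMap (mobiusField 0 e) := by
  refine polyMap_congr fun x j => ?_
  have := sum_X_mul_X_sphere x
  simp only [harmonicConformal, mobiusField, ev_sub, ev_smul, ev_add, ev_mul, ev_lin, this]
  simp

lemma pderiv_sum_X_mul_X (j : Fin n) : pderiv j (∑ i, X i * X i : RPoly n) = C 2 * X j := by
  rw [map_sum, Finset.sum_eq_single j]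
  · rw [pderiv_mul, pderiv_X_self, show (C 2 : RPoly n) = 2 from rfl]
    ring
  · intro i _ hij
    rw [pderiv_mul, pderiv_X_of_ne hij]
    simp
  · simp

lemma harmonicConformal_mem (hn : 2 ≤ n) (e : Fin n → ℝ) :
    harmonicConformal e ∈ solidHarmonics n 2 := by
  have hn0 : (n : ℝ) ≠ 0 := by
    have : (2 : ℝ) ≤ n := by exact_mod_cast hn
    linarith
  intro j
  constructor
  · refine IsHomogeneous.sub ?_ (isHomogeneous_X_mul_lin e j)
    rw [smul_eq_C_mul]
    refine IsHomogeneous.C_mul (IsHomogeneous.sum _ _ _ fun i _ => ?_) _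
    exact (isHomogeneous_X ℝ i).mul (isHomogeneous_X ℝ i)
  · change flatLap _ = 0
    have h : flatLap (∑ i, X i * X i : RPoly n) = C (2 * (n : ℝ)) := by
      simp only [flatLap_apply, pderiv_sum_X_mul_X, pderiv_C_mul, pderiv_X_self]
      simp [mul_comm]
    rw [harmonicConformal, map_sub, map_smul, flatLap_X_mul_lin, h, smul_eq_C_mul, ← C_mul,
      ← C_sub]
    rw [show e j / n * (2 * n) - 2 * e j = 0 by field_simp; ring, C_0]

/-- The factor is nonzero because `2 / n ≤ 1`, so these fields realize every linear form as a
divergence. They therefore span a complement of the solenoidal fields. -/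
lemma polyDiv_harmonicConformal (e : Fin n → ℝ) :
    polyDiv (harmonicConformal e) = (2 / (n : ℝ) - n - 1) • lin e := by
  have h : ∀ j, pderiv j (harmonicConformal e j) =
      (2 / (n : ℝ)) • (e j • X j) - lin e - e j • X j := by
    intro j
    rw [harmonicConformal, map_sub, smul_eq_C_mul, pderiv_C_mul, pderiv_sum_X_mul_X, pderiv_mul,
      pderiv_X_self, pderiv_lin]
    simp only [smul_eq_C_mul, div_eq_mul_inv, C_mul]
    ring
  rw [polyDiv, Finset.sum_congr rfl fun j _ => h j, Finset.sum_sub_distrib,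
    Finset.sum_sub_distrib, ← Finset.smul_sum, Finset.sum_const, Finset.card_univ,
    Fintype.card_fin, ← Nat.cast_smul_eq_nsmul ℝ, sub_smul, sub_smul, one_smul]
  rfl

lemma sInt_sum_X_mul_mobiusField (hn : 2 ≤ n) {S : Fin n → Fin n → ℝ}
    (hS : ∀ i j, S i j = -S j i) (e : Fin n → ℝ) :
    sInt (∑ j, X j * mobiusField S e j) = 0 := by
  have hd : ∀ j, S j j = 0 := fun j => by linarith [hS j j]
  have h : ∀ j, sInt (X j * mobiusField S e j) = 0 := by
    intro j
    have e1 : (X j * mobiusField S e j : RPoly n) =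
        X j * lin (S j) + (e j / n) • X j - X j * (X j * lin e) := by
      rw [mobiusField, smul_eq_C_mul]
      ring
    rw [e1, map_sub, map_add, map_smul, sInt_X_mul_lin hn, sInt_X hn, hd, mul_left_comm,
      mul_comm (X j) (X j * lin e), sInt_X_mul_lin_mul_X hn]
    simp
  rw [map_sum]
  exact Finset.sum_eq_zero fun j _ => h j

lemma polyMap_mobiusField_mem_spaceH (hn : 2 ≤ n) {S : Fin n → Fin n → ℝ}
    (hS : ∀ i j, S i j = -S j i) (e : Fin n → ℝ) : polyMap (mobiusField S e) ∈ spaceH n :=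
  (polyMap_mem_spaceH_iff _).2 ⟨sInt_mobiusField hn S e, sInt_sum_X_mul_mobiusField hn hS e⟩

lemma polyMap_harmonicConformal_mem (hn : 2 ≤ n) (e : Fin n → ℝ) :
    polyMap (harmonicConformal e) ∈ spaceHk n 2 := by
  refine ⟨?_, _, harmonicConformal_mem hn e, isRestriction_polyMap _⟩
  rw [polyMap_harmonicConformal]
  exact polyMap_mobiusField_mem_spaceH hn (by simp) e

/-- The term with `|x|²` pairs to a multiple of `∫ q = 0`. The moment recursion turns `∫ ⟨e, x⟩ ⟨x,
q⟩` into a multiple of `∫ ⟨e, q⟩ + ∫ ⟨e, x⟩ div q`, where both integrals vanish. -/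
lemma sInt_conformal_mul_solenoidal {q : Fin n → RPoly n} (hn : 2 ≤ n)
    (hq : q ∈ solidHarmonics n 2) (h0 : ∀ j, sInt (q j) = 0) (hdiv : polyDiv q = 0)
    (e : Fin n → ℝ) : ∑ j, sInt (harmonicConformal e j * q j) = 0 := by
  have h2 : (2 : ℝ) ≤ n := by exact_mod_cast hn
  have e1 : ∀ j, sInt (harmonicConformal e j * q j) = -sInt (X j * (lin e * q j)) := by
    intro j
    have : sInt (harmonicConformal e j * q j) =
        sInt ((e j / n) • q j - X j * (lin e * q j)) := by
      refine sInt_congr fun x => ?_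
      have := sum_X_mul_X_sphere x
      simp only [harmonicConformal, ev_sub, ev_smul, ev_mul, ev_lin, this]
      ring
    rw [this, map_sub, map_smul, h0]
    simp
  have e2 : ∀ j, ((n : ℝ) - 1 + (1 + 2 : ℕ)) * sInt (X j * (lin e * q j)) =
      sInt (lin e * pderiv j (q j)) := by
    intro j
    rw [sInt_X_mul_of_isHomogeneous j ((isHomogeneous_lin e).mul (hq j).1), pderiv_mul, pderiv_lin,
      map_add, ← smul_eq_C_mul, map_smul, h0]
    simp
  have e3 : ((n : ℝ) - 1 + (1 + 2 : ℕ)) * ∑ j, sInt (X j * (lin e * q j)) = 0 := by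
    rw [Finset.mul_sum, Finset.sum_congr rfl fun j _ => e2 j, ← map_sum, ← Finset.mul_sum]
    change sInt (lin e * polyDiv q) = 0
    rw [hdiv]
    simp
  have e4 : ((n : ℝ) - 1 + (1 + 2 : ℕ)) ≠ 0 := by
    push_cast
    linarith
  rw [Finset.sum_congr rfl fun j _ => e1 j, Finset.sum_neg_distrib,
    (mul_eq_zero.1 e3).resolve_left e4, neg_zero]

lemma sInt_eq_zero_of_mem {q : Fin n → RPoly n} (h : polyMap q ∈ spaceH n) (j : Fin n) :
    sInt (q j) = 0 :=
  ((polyMap_mem_spaceH_iff q).1 h).1 j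

lemma polyMap_harmonicConformal_mem_spaceHk3 (hn : 2 ≤ n) (e : Fin n → ℝ) :
    polyMap (harmonicConformal e) ∈ spaceHk3 n 2 := by
  refine ⟨polyMap_harmonicConformal_mem hn e, ?_⟩
  rw [SetLike.mem_coe, Submodule.mem_orthogonal']
  rintro w ⟨hH, q, hq, hwq, hdiv⟩
  obtain rfl := hwq.eq_polyMap
  -- The components of `q` are spherical harmonics of order two, so the `W^{1,2}` product is `1 +
  -- 2n` times the `L²` product.
  have h : ∀ j, sInt (harmonicConformal e j * q j) + dirichlet (harmonicConformal e j) (q j) =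
      (1 + (2 : ℕ) * ((2 : ℕ) + (n : ℝ) - 2)) * sInt (harmonicConformal e j * q j) := by
    intro j
    have : flatLap (q j) = 0 := (hq j).2
    rw [dirichlet_eq, sphLap_of_isHomogeneous (hq j).1, this, zero_sub, mul_neg, mul_smul_comm,
      map_neg, map_smul, smul_eq_mul]
    ring
  rw [inner_polyMap, Finset.sum_congr rfl fun j _ => h j, ← Finset.mul_sum,
    sInt_conformal_mul_solenoidal hn hq (sInt_eq_zero_of_mem hH) hdiv, mul_zero]

/-- `H_{n,2,3}` consists of the conformal gradient fields, normalized to average zero. -/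
lemma mem_spaceHk3_two_iff (hn : 2 ≤ n) (w : W12 n) : w ∈ spaceHk3 n 2 ↔
    ∃ e : Fin n → ℝ, w = polyMap (mobiusField 0 e) := by
  constructor
  · rintro ⟨⟨hH, p, hp, hwp⟩, horth⟩
    obtain rfl := hwp.eq_polyMap
    have hdiv : (polyDiv p).IsHomogeneous 1 :=
      IsHomogeneous.sum _ _ _ fun j _ => (hp j).1.pderiv
    obtain ⟨c, hc⟩ := exists_coeff_of_isHomogeneous_one hdiv
    have h2 : (2 : ℝ) ≤ n := by exact_mod_cast hn
    have hk : 2 / (n : ℝ) - n - 1 ≠ 0 := by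
      have : 2 / (n : ℝ) ≤ 1 := by
        rw [div_le_one (by linarith)]
        exact h2
      linarith
    set k : ℝ := 2 / (n : ℝ) - n - 1 with hkdef
    -- The parameter is chosen to match the divergence of `p`. The difference is then solenoidal and
    -- also orthogonal to all solenoidal fields, hence zero.
    refine ⟨k⁻¹ • c, ?_⟩
    rw [← polyMap_harmonicConformal, ← sub_eq_zero]
    have hV := polyMap_harmonicConformal_mem_spaceHk3 hn (k⁻¹ • c)
    set V := harmonicConformal (k⁻¹ • c) with hVdef
    have hsol : polyMap p - polyMap V ∈ spaceHkSol n 2 := by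
      rw [← polyMap_sub]
      refine ⟨?_, p - V, Submodule.sub_mem _ hp (harmonicConformal_mem hn _),
        isRestriction_polyMap _, ?_⟩
      · rw [polyMap_sub]
        exact Submodule.sub_mem _ hH hV.1.1
      · have : polyDiv (p - V) = polyDiv p - polyDiv V := by
          simp [polyDiv]
        rw [this, hVdef, polyDiv_harmonicConformal, ← hkdef, lin_smul, smul_smul,
          mul_inv_cancel₀ hk, one_smul, hc]
        exact sub_self _
    have horth' : polyMap p - polyMap V ∈ (spaceHkSol n 2)ᗮ := Submodule.sub_mem _ horth hV.2
    exact inner_self_eq_zero.1 ((Submodule.mem_orthogonal _ _).1 horth' _ hsol)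
  · rintro ⟨e, rfl⟩
    rw [← polyMap_harmonicConformal]
    exact polyMap_harmonicConformal_mem_spaceHk3 hn e

lemma mobiusField_eq_add (S : Fin n → Fin n → ℝ) (e : Fin n → ℝ) :
    mobiusField S e = (fun j => lin (S j)) + mobiusField 0 e := by
  funext j
  have : lin (0 : Fin n → ℝ) = 0 := by simp [lin]
  simp [mobiusField, this]

lemma mem_spaceH0_iff (hn : 2 ≤ n) (w : W12 n) : w ∈ spaceH0 n ↔
    ∃ (S : Fin n → Fin n → ℝ) (e : Fin n → ℝ), (∀ i j, S i j = -S j i) ∧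
      w = polyMap (mobiusField S e) := by
  rw [spaceH0, Submodule.mem_sup]
  constructor
  · rintro ⟨u, hu, v, hv, rfl⟩
    obtain ⟨S, hS, rfl⟩ := (mem_spaceHk2_one_iff hn u).1 hu
    obtain ⟨e, rfl⟩ := (mem_spaceHk3_two_iff hn v).1 hv
    exact ⟨S, e, hS, by rw [mobiusField_eq_add S e, polyMap_add]⟩
  · rintro ⟨S, e, hS, rfl⟩
    exact ⟨_, (mem_spaceHk2_one_iff hn _).2 ⟨S, hS, rfl⟩, _,
      (mem_spaceHk3_two_iff hn _).2 ⟨e, rfl⟩, by rw [mobiusField_eq_add S e, polyMap_add]⟩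

lemma spaceH0_le_spaceH (hn : 2 ≤ n) : spaceH0 n ≤ spaceH n := by
  intro w hw
  obtain ⟨S, e, hS, rfl⟩ := (mem_spaceH0_iff hn w).1 hw
  exact polyMap_mobiusField_mem_spaceH hn hS e

/-- Linear functions are `L²` orthogonal to constants and to quadratic monomials, since the relevant
odd moments vanish; being eigenfunctions, they are then Dirichlet orthogonal as well. -/
lemma isOrtho_spaceHk2_spaceHk3 (hn : 2 ≤ n) : spaceHk2 n 1 ⟂ spaceHk3 n 2 := by
  rw [Submodule.isOrtho_iff_inner_eq]
  intro u hu v hv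
  obtain ⟨S, hS, rfl⟩ := (mem_spaceHk2_one_iff hn u).1 hu
  obtain ⟨e, rfl⟩ := (mem_spaceHk3_two_iff hn v).1 hv
  rw [inner_polyMap]
  refine Finset.sum_eq_zero fun j _ => ?_
  have h : sInt (mobiusField 0 e j * lin (S j)) = 0 := by
    refine sInt_mul_lin_eq_zero (fun i => ?_) _
    have e1 : mobiusField 0 e j * X i = lin 0 * X i + (e j / n) • X i - X j * lin e * X i := by
      rw [mobiusField, smul_eq_C_mul]
      simp only [Pi.zero_apply]
      ring
    rw [e1, map_sub, map_add, map_smul, sInt_X_mul_lin_mul_X hn, sInt_lin_mul_X hn, sInt_X hn]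
    simp
  rw [dirichlet_comm, dirichlet_eq, sphLap_lin, mul_neg, mul_smul_comm, map_neg, map_smul, h,
    mul_comm, h]
  simp

end KernelSpace

/-! ### The coercivity estimate and the kernel -/

section Coercivity

variable {n : ℕ}

lemma norm_polyMap_sq (w : Fin n → RPoly n) :
    ‖polyMap w‖ ^ 2 = ∑ j, (sInt (w j * w j) + dirichlet (w j) (w j)) := by
  rw [← real_inner_self_eq_norm_sq, inner_polyMap]

lemma norm_sub_projH0_le {u : W12 n} (w : W12 n) (hu : u ∈ spaceH0 n) :
    ‖w - projH0 n w‖ ≤ ‖w - u‖ := by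
  rw [projH0, Submodule.starProjection_minimal]
  exact ciInf_le ⟨0, Set.forall_mem_range.2 fun _ => norm_nonneg _⟩ (⟨u, hu⟩ : spaceH0 n)

/-- The `W^{1,2}` distance to `H_{n,0}` is controlled by the quadratic form. -/
theorem exists_coercivity (hn : 3 ≤ n) : ∃ C : ℝ, 0 < C ∧ ∀ w ∈ spaceH n,
    C * ‖w - projH0 n w‖ ^ 2 ≤ quadQ n w := by
  have h3 : (3 : ℝ) ≤ n := by exact_mod_cast hn
  have hn2 : 2 ≤ n := by omega
  obtain ⟨K, hK, hmain⟩ := exists_mobiusField_near hn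
  have ha : 0 < (n : ℝ) / (2 * ((n : ℝ) - 1)) := div_pos (by linarith) (by linarith)
  set a : ℝ := (n : ℝ) / (2 * ((n : ℝ) - 1)) with ha_def
  refine ⟨a / K, div_pos ha hK, ?_⟩
  have hpoly : ∀ v, polyMap v ∈ spaceH n →
      a / K * ‖polyMap v - projH0 n (polyMap v)‖ ^ 2 ≤ quadQ n (polyMap v) := by
    intro v hv
    obtain ⟨h0, h1⟩ := (polyMap_mem_spaceH_iff v).1 hv
    obtain ⟨S, e, hS, hle⟩ := hmain v h0 h1
    have hmem : polyMap (mobiusField S e) ∈ spaceH0 n := (mem_spaceH0_iff hn2 _).2 ⟨S, e, hS, rfl⟩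
    have hnorm : ‖polyMap v - projH0 n (polyMap v)‖ ^ 2 ≤
        K * ∫ x : Sph n, energyDensity v x ∂sphereMeasure n := by
      refine le_trans ?_ hle
      have := norm_sub_projH0_le (polyMap v) hmem
      refine (pow_le_pow_left₀ (norm_nonneg _) this 2).trans (le_of_eq ?_)
      rw [← polyMap_sub, norm_polyMap_sq]
      rfl
    rw [quadQ_polyMap hn2, ← ha_def]
    refine (mul_le_mul_of_nonneg_left hnorm (div_pos ha hK).le).trans (le_of_eq ?_)
    field_simp
  -- Composition with `correction` turns the estimate on `H_n` into a closed condition on all of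
  -- `W^{1,2}`, so density of polynomial fields in the whole space is enough.
  have hclosed : IsClosed {v : W12 n | a / K * ‖correction n v - projH0 n (correction n v)‖ ^ 2 ≤
      quadQ n (correction n v)} := by
    have hc := continuous_correction n
    exact isClosed_le (continuous_const.mul
      ((hc.sub ((projH0 n).continuous.comp hc)).norm.pow 2)) ((continuous_quadQ n).comp hc)
  have hall : ∀ v : W12 n, a / K * ‖correction n v - projH0 n (correction n v)‖ ^ 2 ≤
      quadQ n (correction n v) := fun v =>
    (dense_range_polyMap hn2).induction_on (p := fun v => a / K *
      ‖correction n v - projH0 n (correction n v)‖ ^ 2 ≤ quadQ n (correction n v)) v hclosed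
      fun p => by
        obtain ⟨q, hq, hmem⟩ := correction_polyMap hn2 p
        rw [hq]
        exact hpoly q hmem
  intro w hw
  have := hall w
  rwa [correction_of_mem hw] at this

lemma quadQ_nonneg (hn : 3 ≤ n) {w : W12 n} (hw : w ∈ spaceH n) : 0 ≤ quadQ n w := by
  obtain ⟨C, hC, h⟩ := exists_coercivity hn
  exact le_trans (by positivity) (h w hw)

lemma mem_spaceH0_iff_quadQ_eq_zero (hn : 3 ≤ n) (w : W12 n) :
    w ∈ spaceH0 n ↔ w ∈ spaceH n ∧ quadQ n w = 0 := by
  constructor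
  · intro hw
    refine ⟨spaceH0_le_spaceH (by omega) hw, ?_⟩
    obtain ⟨S, e, hS, rfl⟩ := (mem_spaceH0_iff (by omega) w).1 hw
    rw [quadQ_polyMap (by omega), integral_energyDensity_mobiusField (by omega) hS, mul_zero]
  · rintro ⟨hw, h0⟩
    obtain ⟨C, hC, h⟩ := exists_coercivity hn
    have h1 := h w hw
    rw [h0] at h1
    have h2 : ‖w - projH0 n w‖ ^ 2 = 0 :=
      le_antisymm (nonpos_of_mul_nonpos_right h1 hC) (sq_nonneg _)
    have h3 : w = projH0 n w := sub_eq_zero.1 (norm_eq_zero.1 (pow_eq_zero_iff two_ne_zero |>.1 h2))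
    rw [h3]
    exact Submodule.starProjection_apply_mem _ _

lemma mem_spaceH0_iff_polar_eq_zero (hn : 3 ≤ n) (w : W12 n) : w ∈ spaceH0 n ↔
    w ∈ spaceH n ∧ ∀ v ∈ spaceH n, QuadraticMap.polar (quadQ n) v w = 0 := by
  rw [mem_spaceH0_iff_quadQ_eq_zero hn]
  refine and_congr_right fun hw => ⟨fun h0 v hv => ?_, fun h => ?_⟩
  · exact polar_eq_zero_of_nonneg (fun u hu => quadQ_nonneg hn hu) hv hw h0
  · have h1 := quadQ_add_smul (-1) w w
    have h0 : quadQ n (0 : W12 n) = 0 := by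
      rw [quadQ_eq]
      simp
    rw [h w hw, neg_one_smul, add_neg_cancel, h0] at h1
    linarith

lemma integral_norm_grad_sq_le (z : W12 n) :
    ∫ x, ‖z.grad x‖ ^ 2 ∂sphereMeasure n ≤ ‖z‖ ^ 2 := by
  rw [← real_inner_self_eq_norm_sq, W12.inner_eq]
  simp only [real_inner_self_eq_norm_sq]
  exact le_add_of_nonneg_left (integral_nonneg fun x => sq_nonneg _)

lemma exists_gradient_coercivity (hn : 3 ≤ n) : ∃ C : ℝ, 0 < C ∧ ∀ w ∈ spaceH n,
    C * ∫ x, ‖w.grad x - (projH0 n w).grad x‖ ^ 2 ∂sphereMeasure n ≤ quadQ n w := by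
  obtain ⟨C, hC, h⟩ := exists_coercivity hn
  refine ⟨C, hC, fun w hw => le_trans (mul_le_mul_of_nonneg_left ?_ hC.le) (h w hw)⟩
  refine le_trans (le_of_eq (integral_congr_ae ?_)) (integral_norm_grad_sq_le _)
  have : (w - projH0 n w).grad =ᵐ[sphereMeasure n] w.grad - (projH0 n w).grad :=
    Lp.coeFn_sub _ _
  filter_upwards [this] with x hx
  rw [hx]
  rfl

end Coercivity

/-! ### Infinitesimal Möbius transformations -/

section InfinitesimalMobius

variable {n : ℕ}

/-- The restriction to the sphere of an affine map. -/
def IsSphereAffine {F : Type*} [AddCommGroup F] [Module ℝ F] (A : Sph n → F) : Prop :=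
  ∃ (u : F) (m : Fin n → F), ∀ x, A x = u + ∑ i, (x : Euc n) i • m i

/-- The standard basis vectors, as points of the sphere. -/
def basisPt (i : Fin n) : Sph n := ⟨EuclideanSpace.single i 1, by simp⟩

lemma basisPt_apply (i j : Fin n) : (basisPt i : Euc n) j = if j = i then 1 else 0 := by
  simp [basisPt]

/-- An affine map is recovered from its values at the points `±e_i` by a formula linear in those
values. Such a formula survives differentiation in a parameter. -/
lemma IsSphereAffine.eq_sum {F : Type*} [AddCommGroup F] [Module ℝ F] {A : Sph n → F}
    (hA : IsSphereAffine A) (k : Fin n) (x : Sph n) :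
    A x = (1 / 2 : ℝ) • (A (basisPt k) + A (-basisPt k))
      + ∑ i, (x : Euc n) i • ((1 / 2 : ℝ) • (A (basisPt i) - A (-basisPt i))) := by
  obtain ⟨u, m, h⟩ := hA
  have hp : ∀ i, A (basisPt i) = u + m i := by
    intro i
    simp [h, basisPt_apply]
  have hm : ∀ i, A (-basisPt i) = u - m i := by
    intro i
    simp [h, basisPt_apply, sub_eq_add_neg]
  have e : ∀ i, (1 / 2 : ℝ) • (A (basisPt i) - A (-basisPt i)) = m i := by
    intro i
    rw [hp, hm]
    module
  simp only [e]
  rw [h x, hp, hm]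
  module

/-- The derivative of a family of affine maps is affine. -/
lemma isSphereAffine_of_hasDerivAt {F : Type*} [NormedAddCommGroup F] [NormedSpace ℝ F]
    (k : Fin n) {A : ℝ → Sph n → F} {G : Sph n → F} (hA : ∀ t, IsSphereAffine (A t))
    (hG : ∀ x, HasDerivAt (fun t => A t x) (G x) 0) : IsSphereAffine G := by
  refine ⟨(1 / 2 : ℝ) • (G (basisPt k) + G (-basisPt k)),
    fun i => (1 / 2 : ℝ) • (G (basisPt i) - G (-basisPt i)), fun x => (hG x).unique ?_⟩
  rw [show (fun t => A t x) = _ from funext fun t => (hA t).eq_sum k x]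
  exact (((hG _).add (hG _)).const_smul _).add (HasDerivAt.fun_sum fun i _ =>
    (((hG _).sub (hG _)).const_smul _).const_smul _)

/-- The conformal weight of `φ_{ξ,λ}`: the reciprocal of its conformal factor. -/
def conformalWeight (ξ : Sph n) (l : ℝ) (x : Sph n) : ℝ :=
  l / 2 * (1 - ⟪(x : Euc n), (ξ : Euc n)⟫) + (1 + ⟪(x : Euc n), (ξ : Euc n)⟫) / (2 * l)

lemma inner_sphere_le_one (x y : Sph n) : ⟪(x : Euc n), (y : Euc n)⟫ ≤ 1 := by
  simpa using real_inner_le_norm (x : Euc n) (y : Euc n)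

lemma neg_one_le_inner_sphere (x y : Sph n) : -1 ≤ ⟪(x : Euc n), (y : Euc n)⟫ := by
  have := inner_sphere_le_one (-x) y
  rw [coe_neg_sphere, inner_neg_left] at this
  linarith

lemma conformalWeight_pos (ξ : Sph n) {l : ℝ} (hl : 0 < l) (x : Sph n) :
    0 < conformalWeight ξ l x := by
  have h1 := inner_sphere_le_one x ξ
  have h2 := neg_one_le_inner_sphere x ξ
  rw [conformalWeight]
  rcases h1.lt_or_eq with h | h
  · have : 0 < l / 2 * (1 - ⟪(x : Euc n), (ξ : Euc n)⟫) := mul_pos (by linarith) (by linarith)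
    have : 0 ≤ (1 + ⟪(x : Euc n), (ξ : Euc n)⟫) / (2 * l) :=
      div_nonneg (by linarith) (by linarith)
    linarith
  · rw [h]
    have : 0 < (1 + 1) / (2 * l) := by positivity
    linarith

/-- The denominator of `φ_{ξ,λ}` is `2λ` times the weight, and the numerator is affine in `x`. -/
lemma conformalWeight_smul_mobiusDilation (ξ : Sph n) {l : ℝ} (hl : 0 < l) (x : Sph n) :
    conformalWeight ξ l x • mobiusDilation ξ l x = (x : Euc n) +
      (-⟪(x : Euc n), (ξ : Euc n)⟫ - l / 2 * (1 - ⟪(x : Euc n), (ξ : Euc n)⟫)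
        + (1 + ⟪(x : Euc n), (ξ : Euc n)⟫) / (2 * l)) • (ξ : Euc n) := by
  have hd := conformalWeight_pos ξ hl x
  have hd2 : l ^ 2 * (1 - ⟪(x : Euc n), (ξ : Euc n)⟫) + (1 + ⟪(x : Euc n), (ξ : Euc n)⟫) =
      2 * l * conformalWeight ξ l x := by
    rw [conformalWeight]
    field_simp
  rw [mobiusDilation, hd2, smul_smul]
  have e : conformalWeight ξ l x * (2 * l * conformalWeight ξ l x)⁻¹ = (2 * l)⁻¹ := by
    field_simp
  rw [e]
  generalize ⟪(x : Euc n), (ξ : Euc n)⟫ = s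
  match_scalars <;> field_simp
  ring

lemma isSphereAffine_inner (ξ : Euc n) : IsSphereAffine fun x : Sph n => ⟪(x : Euc n), ξ⟫ :=
  ⟨0, fun i => ξ i, fun x => by simp [inner_eq_sum]⟩

lemma IsSphereAffine.comp_affine {F G : Type*} [AddCommGroup F] [Module ℝ F] [AddCommGroup G]
    [Module ℝ G] {A : Sph n → F} (hA : IsSphereAffine A) (L : F →ₗ[ℝ] G) (c : G) :
    IsSphereAffine fun x => c + L (A x) := by
  obtain ⟨u, m, h⟩ := hA
  exact ⟨c + L u, fun i => L (m i), fun x => by simp [h, add_assoc]⟩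

lemma IsSphereAffine.add {F : Type*} [AddCommGroup F] [Module ℝ F] {A B : Sph n → F}
    (hA : IsSphereAffine A) (hB : IsSphereAffine B) : IsSphereAffine fun x => A x + B x := by
  obtain ⟨u, m, h⟩ := hA
  obtain ⟨u', m', h'⟩ := hB
  exact ⟨u + u', fun i => m i + m' i, fun x => by
    simp only [h, h', smul_add, Finset.sum_add_distrib]
    abel⟩

lemma isSphereAffine_coe : IsSphereAffine fun x : Sph n => (x : Euc n) :=
  ⟨0, fun i => EuclideanSpace.single i 1, fun x => by rw [sum_coord_smul_single, zero_add]⟩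

/-- Every element of the conformal group has an affine conformal weight, multiplication by which
makes it affine. -/
lemma exists_weight_of_mem_confSphere {φ : Sph n → Euc n} (hφ : φ ∈ confSphere n) :
    ∃ d : Sph n → ℝ, IsSphereAffine d ∧ IsSphereAffine (fun x => d x • φ x) ∧ (∀ x, 0 < d x) ∧
      ∀ x y : Sph n, d x * d y * (1 - ⟪φ x, φ y⟫) = 1 - ⟪(x : Euc n), (y : Euc n)⟫ := by
  obtain ⟨O, ξ, l, hl, rfl⟩ := hφ
  refine ⟨conformalWeight ξ l, ?_, ?_, conformalWeight_pos ξ hl, fun x y => ?_⟩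
  · have := (isSphereAffine_inner (ξ : Euc n)).comp_affine
      ((-(l / 2) + 1 / (2 * l)) • (LinearMap.id : ℝ →ₗ[ℝ] ℝ)) (l / 2 + 1 / (2 * l))
    convert this using 2 with x
    simp [conformalWeight]
    ring
  · have h1 := (isSphereAffine_inner (ξ : Euc n)).comp_affine
      ((-1 + l / 2 + 1 / (2 * l)) • LinearMap.toSpanSingleton ℝ (Euc n) (ξ : Euc n))
      ((-(l / 2) + 1 / (2 * l)) • (ξ : Euc n))
    have h2 := (isSphereAffine_coe.add h1).comp_affine (O : Euc n →ₗ[ℝ] Euc n) 0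
    convert h2 using 2 with x
    rw [← map_smul, conformalWeight_smul_mobiusDilation ξ hl, zero_add]
    change O _ = O _
    congr 1
    simp only [LinearMap.smul_apply, LinearMap.toSpanSingleton_apply]
    module
  -- Since `|u - v|² = 2 (1 - ⟨u, v⟩)` for unit vectors, this is the scaling of chordal distances
  -- under a Möbius map; at `x = y` it says that the image lies on the sphere.
  · have e : conformalWeight ξ l x * conformalWeight ξ l y *
        ⟪O (mobiusDilation ξ l x), O (mobiusDilation ξ l y)⟫ =
        ⟪conformalWeight ξ l x • mobiusDilation ξ l x,
          conformalWeight ξ l y • mobiusDilation ξ l y⟫ := by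
      rw [O.inner_map_map, real_inner_smul_left, real_inner_smul_right]
      ring
    rw [mul_sub, mul_one, e, conformalWeight_smul_mobiusDilation ξ hl,
      conformalWeight_smul_mobiusDilation ξ hl]
    simp only [inner_add_left, inner_add_right, real_inner_smul_left, real_inner_smul_right,
      inner_self_sphere, conformalWeight]
    rw [real_inner_comm (y : Euc n) (ξ : Euc n)]
    generalize ⟪(x : Euc n), (ξ : Euc n)⟫ = s
    generalize ⟪(y : Euc n), (ξ : Euc n)⟫ = s'
    field_simp
    ring

lemma one_sub_inner_ne_zero {x y : Sph n} (h : x ≠ y) : 1 - ⟪(x : Euc n), (y : Euc n)⟫ ≠ 0 := by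
  intro h0
  refine h (Subtype.ext ((inner_eq_one_iff_of_norm_eq_one (𝕜 := ℝ) (by simp) (by simp)).1 ?_))
  linarith

/-- Otherwise every basis vector would be `x` or `-x`, and two coordinates of the unit vector `x`
would have square one. -/
lemma exists_ne_ne (hn : 2 ≤ n) (x : Sph n) : ∃ z : Sph n, z ≠ x ∧ z ≠ -x := by
  have h0 : (⟨0, by omega⟩ : Fin n) ≠ ⟨1, by omega⟩ := by simp
  by_contra! h
  have hsq : ∀ i, (x : Euc n) i ^ 2 = 1 := by
    intro i
    have hi := basisPt_apply i i
    by_cases hx : basisPt i = x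
    · rw [← hx, hi]
      simp
    · rw [h _ hx] at hi
      simp at hi
      nlinarith
  have h1 := hsq ⟨0, by omega⟩
  have h2 := hsq ⟨1, by omega⟩
  have h3 := sum_coord_sq_sphere x
  have h4 := Finset.sum_le_univ_sum_of_nonneg (s := {⟨0, by omega⟩, ⟨1, by omega⟩})
    fun i => mul_self_nonneg ((x : Euc n) i)
  rw [Finset.sum_pair h0, h3] at h4
  nlinarith

/-- The conformal weight along a differentiable curve through the identity is differentiable. -/
lemma hasDerivAt_weight (hn : 2 ≤ n) {γ : ℝ → Sph n → Euc n} {Y : Sph n → Euc n}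
    (h0 : ∀ x, γ 0 x = x) (hY : ∀ x, HasDerivAt (fun t => γ t x) (Y x) 0) {d : ℝ → Sph n → ℝ}
    (hpos : ∀ t x, 0 < d t x) (hd : ∀ t (x y : Sph n), d t x * d t y * (1 - ⟪γ t x, γ t y⟫) =
      1 - ⟪(x : Euc n), (y : Euc n)⟫) (x : Sph n) :
    d 0 x = 1 ∧ DifferentiableAt ℝ (fun t => d t x) 0 := by
  obtain ⟨y, hyx, hyx'⟩ := exists_ne_ne hn x
  have hxx : -x ≠ x := fun h => by
    have := congrArg (fun u : Sph n => ⟪(u : Euc n), (x : Euc n)⟫) h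
    simp at this
    norm_num at this
  have hxy := one_sub_inner_ne_zero hyx.symm
  have hxz := one_sub_inner_ne_zero hxx.symm
  have hyz := one_sub_inner_ne_zero hyx'
  set z := -x with hz
  have hne : ∀ t (u v : Sph n), 1 - ⟪(u : Euc n), (v : Euc n)⟫ ≠ 0 → 1 - ⟪γ t u, γ t v⟫ ≠ 0 :=
    fun t u v huv h => huv (by rw [← hd t, h, mul_zero])
  -- The scaling identities for `(x, y)` and `(x, z)`, multiplied and divided by the one for `(y,
  -- z)`, leave `d(x)²`. This expresses the weight through the curve itself, so its
  -- differentiability need not be assumed. The points `x`, `y`, `z = -x` are distinct, which keeps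
  -- the denominators nonzero.
  let N : ℝ → ℝ := fun t => (1 - ⟪(x : Euc n), (y : Euc n)⟫) * (1 - ⟪(x : Euc n), (z : Euc n)⟫)
    * (1 - ⟪γ t y, γ t z⟫) / ((1 - ⟪γ t x, γ t y⟫) * (1 - ⟪γ t x, γ t z⟫)
      * (1 - ⟪(y : Euc n), (z : Euc n)⟫))
  have hN : ∀ t, d t x = √(N t) := by
    intro t
    have e : N t = d t x ^ 2 := by
      have h1 := hne t x y hxy
      have h2 := hne t x z hxz
      have h3 := hne t y z hyz
      have p1 := hpos t x
      have p2 := hpos t y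
      have p3 := hpos t z
      simp only [N, ← hd t]
      field_simp
    rw [e, Real.sqrt_sq (hpos t x).le]
  have hN0 : N 0 = 1 := by
    simp only [N, h0]
    field_simp
  have hdiff : ∀ u v : Sph n, DifferentiableAt ℝ (fun t => 1 - ⟪γ t u, γ t v⟫) 0 := fun u v =>
    ((hY u).differentiableAt.inner ℝ (hY v).differentiableAt).const_sub 1
  constructor
  · rw [hN, hN0, Real.sqrt_one]
  · rw [funext hN]
    refine DifferentiableAt.sqrt ?_ (by rw [hN0]; exact one_ne_zero)
    refine DifferentiableAt.div ((hdiff y z).const_mul _)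
      (((hdiff x y).mul (hdiff x z)).mul_const _) ?_
    exact mul_ne_zero (mul_ne_zero (hne 0 x y hxy) (hne 0 x z hxz)) hyz

/-- The polynomial form `S x + b - ⟨b, x⟩ x` of an infinitesimal Möbius transformation. -/
def mobiusVF (S : Fin n → Fin n → ℝ) (b : Fin n → ℝ) (j : Fin n) : RPoly n :=
  lin (S j) + (MvPolynomial.C (b j) - MvPolynomial.X j * lin b)

lemma evVec_mobiusVF_apply (S : Fin n → Fin n → ℝ) (b : Fin n → ℝ) (x : Euc n) (j : Fin n) :
    evVec (mobiusVF S b) x j =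
      ∑ i, S j i * x i + (b j - x j * ∑ i, b i * x i) := by
  simp [mobiusVF]

/-- A tangential field of the form `M x + u - (a + ⟨c, x⟩) x` is given by a skew matrix and a
vector. -/
lemma exists_eq_mobiusVF_of_tangential {Y G : Sph n → Euc n} {D : Sph n → ℝ}
    (hG : IsSphereAffine G) (hD : IsSphereAffine D) (hY : ∀ x, Y x = G x - D x • (x : Euc n))
    (htan : ∀ x : Sph n, ⟪Y x, (x : Euc n)⟫ = 0) :
    ∃ (S : Fin n → Fin n → ℝ) (b : Fin n → ℝ), (∀ i j, S i j = -S j i) ∧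
      ∀ x : Sph n, Y x = evVec (mobiusVF S b) x := by
  obtain ⟨u, m, hG⟩ := hG
  obtain ⟨a, c, hD⟩ := hD
  have h : ∀ x : Sph n, ∑ i, u i * (x : Euc n) i + ∑ j, (∑ i, (x : Euc n) i * m i j) * (x : Euc n) j
      - (a + ∑ i, (x : Euc n) i * c i) = 0 := by
    intro x
    have h1 := htan x
    rw [hY, inner_sub_left, real_inner_smul_left, inner_self_sphere, hG, hD, inner_add_left,
      inner_eq_sum, inner_eq_sum] at h1
    simpa using h1
  -- Tangency at `e_i` and `-e_i`: the odd part compares `u` with `c`, the even part gives the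
  -- diagonal of `m`.
  have hodd : ∀ i, u i = c i := by
    intro i
    have h1 := h (basisPt i)
    have h2 := h (-basisPt i)
    simp [basisPt_apply] at h1 h2
    linarith
  have hdiag : ∀ i, m i i = a := by
    intro i
    have h1 := h (basisPt i)
    simp [basisPt_apply] at h1
    linarith [hodd i]
  have hskew : ∀ i j, i ≠ j → m i j = -m j i := by
    intro i j hij
    -- A rational point of the circle through `e_i` and `e_j`. Its diagonal contribution is already
    -- `a`, so the mixed term `m i j + m j i` must vanish.
    let p : Sph n := ⟨(3 / 5 : ℝ) • EuclideanSpace.single i 1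
      + (4 / 5 : ℝ) • EuclideanSpace.single j 1, by
        rw [mem_sphere_zero_iff_norm, ← sq_eq_sq₀ (norm_nonneg _) zero_le_one,
          ← real_inner_self_eq_norm_sq, inner_eq_sum]
        simp [hij, mul_add, add_mul, Finset.sum_add_distrib, hij.symm]
        norm_num⟩
    have hp : ∀ k, (p : Euc n) k = 3 / 5 * (if k = i then 1 else 0)
        + 4 / 5 * (if k = j then 1 else 0) := by
      intro k
      simp [p]
    have h1 := h p
    have hu : ∑ k, (p : Euc n) k * c k = ∑ k, u k * (p : Euc n) k :=
      Finset.sum_congr rfl fun k _ => by rw [hodd, mul_comm]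
    rw [hu] at h1
    have h2 : ∑ k, (∑ l, (p : Euc n) l * m l k) * (p : Euc n) k = a := by linarith
    simp only [hp, add_mul, mul_add, Finset.sum_add_distrib, mul_ite, ite_mul, mul_one, mul_zero,
      zero_mul, Finset.sum_ite_eq', Finset.mem_univ, if_true, hdiag] at h2
    linarith
  -- The linear part of `G` is `a` times the identity plus a skew matrix, and `a x` cancels against
  -- the constant part of `D x`. The first index of `m` is the input coordinate, hence the
  -- transpose.
  refine ⟨fun j i => m i j - if i = j then a else 0, u, fun i j => ?_, fun x => ?_⟩
  · rcases eq_or_ne i j with rfl | hij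
    · simp [hdiag]
    · simp [hij, hij.symm, hskew j i hij.symm]
  · ext j
    rw [evVec_mobiusVF_apply, hY, hG, hD]
    simp only [PiLp.sub_apply, PiLp.add_apply, PiLp.smul_apply, smul_eq_mul, WithLp.ofLp_sum,
      Finset.sum_apply, WithLp.ofLp_smul, Pi.smul_apply, sub_mul, Finset.sum_sub_distrib, ite_mul,
      zero_mul, Finset.sum_ite_eq', Finset.mem_univ, if_true]
    have e1 : ∑ i, (x : Euc n) i * c i = ∑ i, u i * (x : Euc n) i :=
      Finset.sum_congr rfl fun k _ => by rw [hodd, mul_comm]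
    have e2 : ∑ i, (x : Euc n) i * m i j = ∑ i, m i j * (x : Euc n) i :=
      Finset.sum_congr rfl fun k _ => mul_comm _ _
    rw [e1, e2]
    ring

/-- The velocity of a curve of Möbius transformations through the identity. -/
lemma exists_eq_mobiusVF_of_hasDerivAt (hn : 2 ≤ n) {γ : ℝ → Sph n → Euc n} {Y : Sph n → Euc n}
    (hγ : ∀ t, γ t ∈ confSphere n) (h0 : ∀ x, γ 0 x = x)
    (hY : ∀ x, HasDerivAt (fun t => γ t x) (Y x) 0) :
    ∃ (S : Fin n → Fin n → ℝ) (b : Fin n → ℝ), (∀ i j, S i j = -S j i) ∧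
      ∀ x : Sph n, Y x = evVec (mobiusVF S b) x := by
  choose d hd1 hd2 hpos hd using fun t => exists_weight_of_mem_confSphere (hγ t)
  have hw := hasDerivAt_weight hn h0 hY hpos hd
  let k : Fin n := ⟨0, by omega⟩
  have hD := isSphereAffine_of_hasDerivAt k hd1 fun x => (hw x).2.hasDerivAt
  have hG := isSphereAffine_of_hasDerivAt k hd2 fun x => (hw x).2.hasDerivAt.fun_smul (hY x)
  -- The product rule for `d γ` at time zero, where `d = 1` and `γ` is the identity, gives `G = Y +
  -- D x`. Tangency comes from differentiating `|γ|² = 1`.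
  refine exists_eq_mobiusVF_of_tangential hG hD (fun x => ?_) fun x => ?_
  · rw [(hw x).1, h0, one_smul, add_sub_cancel_right]
  · have hnorm : ∀ t, ⟪γ t x, γ t x⟫ = 1 := by
      intro t
      have h1 := hd t x x
      rw [inner_self_sphere, sub_self, mul_eq_zero] at h1
      have h2 := h1.resolve_left (mul_pos (hpos t x) (hpos t x)).ne'
      linarith
    have h1 := (hY x).inner ℝ (hY x)
    have h2 := h1.unique (by rw [funext hnorm]; exact hasDerivAt_const 0 1)
    rw [h0, real_inner_comm] at h2
    linarith

end InfinitesimalMobius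

-- Parametrization of the Möbius algebra and of `H_{n,0}` by pairs `(S, b)`

section MobiusIsomorphism

variable {n : ℕ}

lemma mobiusDilation_one (ξ x : Sph n) : mobiusDilation ξ 1 x = x := by
  rw [mobiusDilation]
  generalize ⟪(x : Euc n), (ξ : Euc n)⟫ = s
  match_scalars <;> ring

lemma hasDerivAt_mobiusDilation_exp (ξ x : Sph n) :
    HasDerivAt (fun t : ℝ => mobiusDilation ξ (Real.exp t) x)
      (⟪(x : Euc n), (ξ : Euc n)⟫ • (x : Euc n) - (ξ : Euc n)) 0 := by
  set s := ⟪(x : Euc n), (ξ : Euc n)⟫ with hs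
  have he := Real.hasDerivAt_exp 0
  have he2 := he.pow 2
  have hden := (he2.mul_const (1 - s)).add_const (1 + s)
  have hnum := (((he2.mul_const (1 - s)).neg.smul_const (ξ : Euc n)).add
    ((he.const_mul 2).smul_const ((x : Euc n) - s • (ξ : Euc n)))).add_const
      ((1 + s) • (ξ : Euc n))
  have h := (hden.inv (by simp)).smul hnum
  refine (h.congr_deriv ?_)
  simp only [Pi.pow_apply, Real.exp_zero]
  norm_num
  match_scalars <;> ring

lemma single_sub_mem_mobiusAlgebra (i : Fin n) :
    (fun x : Sph n => (x : Euc n) i • (x : Euc n) - EuclideanSpace.single i 1) ∈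
      mobiusAlgebra n := by
  refine Submodule.subset_span ⟨fun t x => mobiusDilation (basisPt i) (Real.exp t) x, fun t => ?_,
    fun x => ?_, fun x => ?_⟩
  · exact ⟨LinearIsometryEquiv.refl ℝ _, basisPt i, _, Real.exp_pos t, rfl⟩
  · change mobiusDilation (basisPt i) (Real.exp 0) x = x
    rw [Real.exp_zero, mobiusDilation_one]
  · refine (hasDerivAt_mobiusDilation_exp (basisPt i) x).congr_deriv ?_
    simp [basisPt, EuclideanSpace.inner_single_right]

lemma rotation_mem_mobiusAlgebra (i j : Fin n) :
    (fun x : Sph n => (2 * (x : Euc n) i) • EuclideanSpace.single j 1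
      - (2 * (x : Euc n) j) • EuclideanSpace.single i (1 : ℝ)) ∈ mobiusAlgebra n := by
  rcases eq_or_ne i j with rfl | hij
  · simp only [sub_self]
    exact Submodule.zero_mem _
  refine Submodule.subset_span ⟨fun t x => planeRotation i j t x, fun t => ?_, fun x => ?_,
    fun x => ?_⟩
  · exact ⟨planeRotation i j t, basisPt i, 1, one_pos, by simp only [mobiusDilation_one]⟩
  · exact planeRotation_zero hij _
  · exact (hasDerivAt_planeRotation hij 0 _).congr_deriv (planeRotationDeriv_zero i j _)

lemma mobiusVF_mem_mobiusAlgebra {S : Fin n → Fin n → ℝ} (hS : ∀ i j, S i j = -S j i)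
    (b : Fin n → ℝ) : (fun x : Sph n => evVec (mobiusVF S b) x) ∈ mobiusAlgebra n := by
  have h : (fun x : Sph n => evVec (mobiusVF S b) x) =
      -- The factor 1/4 offsets the double speed of the rotation generators and the double counting
      -- of each pair of indices.
      (∑ i, ∑ j, (S j i / 4) • fun x : Sph n => (2 * (x : Euc n) i) • EuclideanSpace.single j 1
        - (2 * (x : Euc n) j) • EuclideanSpace.single i (1 : ℝ))
      - ∑ i, b i • fun x : Sph n =>
        (x : Euc n) i • (x : Euc n) - EuclideanSpace.single i (1 : ℝ) := by
    funext x
    ext k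
    rw [evVec_mobiusVF_apply]
    simp only [Pi.sub_apply, Finset.sum_apply, Pi.smul_apply, PiLp.sub_apply, WithLp.ofLp_sum,
      PiLp.smul_apply, smul_eq_mul, PiLp.single_apply, mul_sub, Finset.sum_sub_distrib,
      mul_ite, mul_one, mul_zero, Finset.sum_ite_eq, Finset.mem_univ, if_true]
    have e1 : ∑ i, ∑ j, (if k = i then S j i / 4 * (2 * (x : Euc n) j) else 0) =
        -∑ i, S k i / 4 * (2 * (x : Euc n) i) := by
      rw [Finset.sum_comm, ← Finset.sum_neg_distrib]
      refine Finset.sum_congr rfl fun j _ => ?_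
      rw [Finset.sum_ite_eq, if_pos (Finset.mem_univ _), hS j k]
      ring
    have e2 : ∑ i, S k i / 4 * (2 * (x : Euc n) i) = 1 / 2 * ∑ i, S k i * (x : Euc n) i := by
      rw [Finset.mul_sum]
      exact Finset.sum_congr rfl fun i _ => by ring
    have e3 : ∑ i, b i * ((x : Euc n) i * (x : Euc n) k) =
        (x : Euc n) k * ∑ i, b i * (x : Euc n) i := by
      rw [Finset.mul_sum]
      exact Finset.sum_congr rfl fun i _ => by ring
    rw [e1, e2, e3]
    ring
  rw [h]
  refine Submodule.sub_mem _ (Submodule.sum_mem _ fun i _ => Submodule.sum_mem _ fun j _ =>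
    Submodule.smul_mem _ _ (rotation_mem_mobiusAlgebra i j)) (Submodule.sum_mem _ fun i _ =>
    Submodule.smul_mem _ _ (single_sub_mem_mobiusAlgebra i))

/-- Pairs of a skew matrix and a vector, which parametrize the infinitesimal Möbius
transformations. -/
def mobiusParam (n : ℕ) : Submodule ℝ ((Fin n → Fin n → ℝ) × (Fin n → ℝ)) where
  carrier := {q | ∀ i j, q.1 i j = -q.1 j i}
  zero_mem' i j := by simp
  add_mem' {p q} hp hq i j := by
    simp only [Prod.fst_add, Pi.add_apply]
    rw [hp, hq]
    ring
  smul_mem' c q hq i j := by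
    simp only [Prod.smul_fst, Pi.smul_apply, smul_eq_mul]
    rw [hq]
    ring

lemma evVec_add (v w : Fin n → RPoly n) (x : Euc n) : evVec (v + w) x = evVec v x + evVec w x := by
  ext j
  simp

lemma evVec_smul (c : ℝ) (w : Fin n → RPoly n) (x : Euc n) : evVec (c • w) x = c • evVec w x := by
  ext j
  simp

lemma mobiusVF_add (p q : (Fin n → Fin n → ℝ) × (Fin n → ℝ)) :
    mobiusVF (p + q).1 (p + q).2 = mobiusVF p.1 p.2 + mobiusVF q.1 q.2 := by
  funext j
  simp only [mobiusVF, Prod.fst_add, Prod.snd_add, Pi.add_apply, lin_add, MvPolynomial.C_add]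
  ring

lemma mobiusVF_smul (c : ℝ) (q : (Fin n → Fin n → ℝ) × (Fin n → ℝ)) :
    mobiusVF (c • q).1 (c • q).2 = c • mobiusVF q.1 q.2 := by
  funext j
  simp only [mobiusVF, Prod.smul_fst, Prod.smul_snd, Pi.smul_apply, lin_smul, smul_eq_mul,
    MvPolynomial.C_mul, MvPolynomial.smul_eq_C_mul]
  ring

lemma mobiusField_add (p q : (Fin n → Fin n → ℝ) × (Fin n → ℝ)) :
    mobiusField (p + q).1 (p + q).2 = mobiusField p.1 p.2 + mobiusField q.1 q.2 := by
  funext j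
  simp only [mobiusField, Prod.fst_add, Prod.snd_add, Pi.add_apply, lin_add, add_div,
    MvPolynomial.C_add]
  ring

lemma mobiusField_smul (c : ℝ) (q : (Fin n → Fin n → ℝ) × (Fin n → ℝ)) :
    mobiusField (c • q).1 (c • q).2 = c • mobiusField q.1 q.2 := by
  funext j
  simp only [mobiusField, Prod.smul_fst, Prod.smul_snd, Pi.smul_apply, lin_smul, smul_eq_mul,
    mul_div_assoc, MvPolynomial.C_mul, MvPolynomial.smul_eq_C_mul]
  ring

/-- Evaluate at `±e_k`: the even part with `k ≠ j` gives `κ b_j = 0`, after which the odd part gives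
`S`. The factor `κ` serves both parametrizations, `κ = 1` before and `κ = 1 / n` after subtracting
the mean. -/
lemma mobiusParam_eq_zero (hn : 2 ≤ n) {κ : ℝ} (hκ : κ ≠ 0) {S : Fin n → Fin n → ℝ}
    {b : Fin n → ℝ} (h : ∀ (x : Sph n) j, ∑ i, S j i * (x : Euc n) i
      + (κ * b j - (x : Euc n) j * ∑ i, b i * (x : Euc n) i) = 0) : S = 0 ∧ b = 0 := by
  have := Fin.nontrivial_iff_two_le.2 hn
  have hp : ∀ k j, S j k + (κ * b j - (if j = k then b k else 0)) = 0 := by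
    intro k j
    simpa [basisPt_apply] using h (basisPt k) j
  have hm : ∀ k j, -S j k + (κ * b j - (if j = k then b k else 0)) = 0 := by
    intro k j
    have := h (-basisPt k) j
    simp [basisPt_apply] at this
    split_ifs at this ⊢ <;> linarith
  have hb : ∀ j, b j = 0 := by
    intro j
    obtain ⟨k, hk⟩ := exists_ne j
    have h1 := hp k j
    have h2 := hm k j
    rw [if_neg hk.symm] at h1 h2
    exact (mul_eq_zero.1 (show κ * b j = 0 by linarith)).resolve_left hκ
  refine ⟨?_, funext hb⟩
  funext j k
  simpa [hb] using hp k j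

/-- The infinitesimal Möbius transformation with given parameters. -/
def paramToAlgebra (n : ℕ) : mobiusParam n →ₗ[ℝ] mobiusAlgebra n where
  toFun q := ⟨fun x => evVec (mobiusVF q.1.1 q.1.2) x, mobiusVF_mem_mobiusAlgebra q.2 _⟩
  map_add' p q := by
    refine Subtype.ext (funext fun x => ?_)
    change evVec (mobiusVF (p.1 + q.1).1 (p.1 + q.1).2) x = _
    rw [mobiusVF_add, evVec_add]
    rfl
  map_smul' c q := by
    refine Subtype.ext (funext fun x => ?_)
    change evVec (mobiusVF (c • q.1).1 (c • q.1).2) x = _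
    rw [mobiusVF_smul, evVec_smul]
    rfl

/-- The element of `H_{n,0}` with given parameters. -/
def paramToKernel (hn : 2 ≤ n) : mobiusParam n →ₗ[ℝ] spaceH0 n where
  toFun q := ⟨polyMap (mobiusField q.1.1 q.1.2), (mem_spaceH0_iff hn _).2 ⟨_, _, q.2, rfl⟩⟩
  map_add' p q := by
    refine Subtype.ext ?_
    change polyMap (mobiusField (p.1 + q.1).1 (p.1 + q.1).2) = _
    rw [mobiusField_add, polyMap_add]
    rfl
  map_smul' c q := by
    refine Subtype.ext ?_
    change polyMap (mobiusField (c • q.1).1 (c • q.1).2) = _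
    rw [mobiusField_smul, polyMap_smul]
    rfl

lemma bijective_paramToAlgebra (hn : 2 ≤ n) : Function.Bijective (paramToAlgebra n) := by
  constructor
  · rw [← LinearMap.ker_eq_bot, LinearMap.ker_eq_bot']
    intro q hq
    have h : ∀ x : Sph n, evVec (mobiusVF q.1.1 q.1.2) x = 0 := fun x =>
      congrFun (congrArg Subtype.val hq) x
    obtain ⟨h1, h2⟩ := mobiusParam_eq_zero hn one_ne_zero (S := q.1.1) (b := q.1.2) fun x j => by
      rw [one_mul, ← evVec_mobiusVF_apply, h]
      rfl
    exact Subtype.ext (Prod.ext h1 h2)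
  -- Velocities of curves already have the parametrized form, and these fields form a subspace, so
  -- passing to the span adds nothing.
  · have hle : mobiusAlgebra n ≤ (LinearMap.range (paramToAlgebra n)).map
        (mobiusAlgebra n).subtype := by
      refine Submodule.span_le.2 ?_
      rintro Y ⟨γ, hγ, h0, hY⟩
      obtain ⟨S, b, hS, h⟩ := exists_eq_mobiusVF_of_hasDerivAt hn hγ h0 hY
      exact ⟨_, ⟨⟨(S, b), hS⟩, rfl⟩, (funext h).symm⟩
    intro Y
    obtain ⟨_, ⟨q, rfl⟩, hq⟩ := hle Y.2
    exact ⟨q, Subtype.ext hq⟩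

lemma evVec_mobiusField_apply (S : Fin n → Fin n → ℝ) (e : Fin n → ℝ) (x : Euc n) (j : Fin n) :
    evVec (mobiusField S e) x j =
      ∑ i, S j i * x i + (1 / (n : ℝ) * e j - x j * ∑ i, e i * x i) := by
  simp [mobiusField]
  ring

lemma bijective_paramToKernel (hn : 2 ≤ n) : Function.Bijective (paramToKernel hn) := by
  have hn0 : (n : ℝ) ≠ 0 := by
    have : (2 : ℝ) ≤ n := by exact_mod_cast hn
    linarith
  constructor
  · rw [← LinearMap.ker_eq_bot, LinearMap.ker_eq_bot']
    intro q hq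
    have h0 : polyMap (mobiusField q.1.1 q.1.2) = 0 := congrArg Subtype.val hq
    have h1 : (fun x : Sph n => evVec (mobiusField q.1.1 q.1.2) x) =ᵐ[sphereMeasure n]
        fun _ => 0 := by
      refine (polyMap_fn _).symm.trans ?_
      rw [h0]
      exact W12.fn_zero
    have h := ((continuous_evVec_sphere _).ae_eq_iff_eq _ continuous_const).1 h1
    obtain ⟨h1, h2⟩ := mobiusParam_eq_zero hn (one_div_ne_zero hn0) (S := q.1.1) (b := q.1.2)
      fun x j => by
        rw [← evVec_mobiusField_apply, congrFun h x]
        rfl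
    exact Subtype.ext (Prod.ext h1 h2)
  · intro w
    obtain ⟨S, e, hS, hw⟩ := (mem_spaceH0_iff hn w.1).1 w.2
    exact ⟨⟨(S, e), hS⟩, Subtype.ext hw.symm⟩

lemma integral_evVec_apply (w : Fin n → RPoly n) (j : Fin n) :
    (∫ x : Sph n, evVec w x ∂sphereMeasure n) j = sInt (w j) :=
  ((coordL n j).integral_comp_comm
    (integrable_sphere_of_continuous (continuous_evVec_sphere w))).symm

/-- The mean of `b - ⟨b, x⟩ x` is `b - b / n` and rotations have mean zero, so subtracting the mean
replaces `b` by `b / n` and keeps the parameters `(S, b)`. -/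
lemma evVec_mobiusField_eq_sub_integral (hn : 2 ≤ n) (S : Fin n → Fin n → ℝ) (b : Fin n → ℝ)
    (x : Sph n) : evVec (mobiusField S b) x =
      evVec (mobiusVF S b) x - ∫ y : Sph n, evVec (mobiusVF S b) y ∂sphereMeasure n := by
  ext j
  rw [PiLp.sub_apply, integral_evVec_apply, evVec_mobiusField_apply, evVec_mobiusVF_apply]
  have : sInt (mobiusVF S b j) = b j - b j / n := by
    rw [mobiusVF, map_add, map_sub, sInt_lin hn, sInt_C (by omega), sInt_X_mul_lin hn, zero_add]
  rw [this]
  ring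

lemma exists_mobiusAlgebra_equiv (hn : 2 ≤ n) : ∃ Φ : mobiusAlgebra n ≃ₗ[ℝ] spaceH0 n,
    ∀ Y : mobiusAlgebra n, ∀ᵐ x ∂sphereMeasure n, (Φ Y : W12 n).fn x =
      (Y : Sph n → Euc n) x - ∫ y, (Y : Sph n → Euc n) y ∂sphereMeasure n := by
  let E₁ := LinearEquiv.ofBijective _ (bijective_paramToAlgebra hn)
  let E₂ := LinearEquiv.ofBijective _ (bijective_paramToKernel hn)
  refine ⟨E₁.symm.trans E₂, fun Y => ?_⟩
  obtain ⟨q, rfl⟩ := E₁.surjective Y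
  rw [LinearEquiv.trans_apply, E₁.symm_apply_apply]
  filter_upwards [polyMap_fn (mobiusField q.1.1 q.1.2)] with x hx
  refine hx.trans ?_
  exact evVec_mobiusField_eq_sub_integral hn _ _ x

end MobiusIsomorphism

end

theorem theorem1p5 (n : ℕ) (hn : 3 ≤ n) :
    -- the sum defining `H_{n,0}` is direct, and orthogonal
    spaceHk2 n 1 ⟂ spaceHk3 n 2 ∧
    -- `H_{n,0}` is the kernel of (the bilinear form of) `Q_n` in `H_n`
    (∀ w : W12 n, w ∈ spaceH0 n ↔
      w ∈ spaceH n ∧ ∀ v ∈ spaceH n, QuadraticMap.polar (quadQ n) v w = 0) ∧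
    -- `H_{n,0}` is the zero set of `Q_n` in `H_n`
    (∀ w : W12 n, w ∈ spaceH0 n ↔ w ∈ spaceH n ∧ quadQ n w = 0) ∧
    -- `Y ↦ Y - average  Y` is an isomorphism of the infinitesimal Möbius maps onto `H_{n,0}`
    (∃ Φ : mobiusAlgebra n ≃ₗ[ℝ] spaceH0 n, ∀ Y : mobiusAlgebra n,
      ∀ᵐ x ∂sphereMeasure n, (Φ Y : W12 n).fn x =
        (Y : Sph n → Euc n) x - ∫ y, (Y : Sph n → Euc n) y ∂sphereMeasure n) ∧
    -- the coercivity estimate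
    ∃ C : ℝ, 0 < C ∧ ∀ w ∈ spaceH n,
      C * ∫ x, ‖w.grad x - (projH0 n w).grad x‖ ^ 2 ∂sphereMeasure n ≤ quadQ n w := by
  have hn2 : 2 ≤ n := by omega
  exact ⟨isOrtho_spaceHk2_spaceHk3 hn2, mem_spaceH0_iff_polar_eq_zero hn,
    mem_spaceH0_iff_quadQ_eq_zero hn, exists_mobiusAlgebra_equiv hn2,
    exists_gradient_coercivity hn⟩
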